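/- **Setting.** A *dependent type theory* is a formal system that derives statements $\mathcal J\,[\Gamma]$, where $\Gamma=[x_0\in A_0,\ldots,x_{n-1}\in A_{n-1}(x_0,\ldots,x_{n-2})]$ is a context and $\mathcal J$ is a judgement of one of the forms $A\in\mathrm{Type}$, $a\in A$, $A=B\in\mathrm{Type}$, $a=b\in A$. Its expressions are built from variables by arbitrary type and term constructors, which may bind variables. A statement is derivable only if its context and the types and terms that occur in the judgement are well-formed. The derivable statements are closed under the variable axiom, weakening and substitution; under reflexivity, symmetry and transitivity of definitional equality; under the rules that $a\in A$ and $A=B$ give $a\in B$, and that $a=b\in A$ and $A=B$ give $a=b\in B$; and under congruence (substituting definitionally equal terms in a type or a term yields definitionally equal results). The theory may have any further rules. In particular no unit type and no $\Sigma$-types are assumed. The theory has *propositional identity types* if it has constructors $\mathrm{Id},\mathbf r,\mathbf J,\mathbf H$, commuting with substitution, that satisfy the congruence rules and, in every ambient context, the following rules. - Formation: if $a\in A$ and $b\in A$, then $\mathrm{Id}_A(a,b)\in\mathrm{Type}$. - Introduction: if $a\in A$, then $\mathbf r(a)\in\mathrm{Id}_A(a,a)$. - Elimination: if $C(x,y,u)\in\mathrm{Type}\,[x\in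 A,y\in A,u\in\mathrm{Id}_A(x,y),\Delta(x,y,u)]$, $a,b\in A$, $p\in\mathrm{Id}_A(a,b)$ and $d(x)\in C(x,x,\mathbf r(x))\,[x\in A,\Delta(x,x,\mathbf r(x))]$, then $\mathbf J(a,b,p,d)\in C(a,b,p)\,[\Delta(a,b,p)]$. - Computation: if $C$ and $d$ are as in the elimination rule and $a\in A$, then $\mathbf H(a,d)\in\mathrm{Id}_{C(a,a,\mathbf r(a))}\bigl(\mathbf J(a,a,\mathbf r(a),d),d(a)\bigr)\,[\Delta(a,a,\mathbf r(a))]$. The *classifying category* of the theory has as objects the well-formed contexts up to definitional equality of contexts of the same length. A morphism $\Delta\to\Gamma$, with $\Gamma$ as above, is a sequence $(t_0,\ldots,t_{n-1})$ with $t_i\in A_i(t_0,\ldots,t_{i-1})\,[\Delta]$ for all $i$, up to definitional equality; composition is substitution. A *fibration* is a morphism isomorphic (as an arrow) to a dependent projection $[\Gamma,\Delta]\to[\Gamma]$, which drops a final segment of a context. A *path category* is a category with two classes of maps, fibrations and weak equivalences (maps in both classes are called acyclic fibrations), such that: 1. isomorphisms are fibrations, and fibrations are closed under composition; 2. the pullback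 of a fibration along any map exists and is a fibration; 3. there is a terminal object $1$, and every map $X\to1$ is a fibration; 4. isomorphisms are weak equivalences; 5. if $f:A\to B$, $g:B\to C$, $h:C\to D$ are maps such that $gf$ and $hg$ are weak equivalences, then so are $f,g,h$ and $hgf$; 6. for every object $B$ the diagonal $B\to B\times B$ factors as a weak equivalence $r:B\to PB$ followed by a fibration $(s,t):PB\to B\times B$; 7. every acyclic fibration has a section; 8. the pullback of an acyclic fibration along any map is an acyclic fibration. **Theorem.** The classifying category of any dependent type theory with propositional identity types carries the structure of a path category: there is a class of weak equivalences which, together with the fibrations defined above, satisfies axioms 1–8. -/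

import Mathlib

open CategoryTheory CategoryTheory.Limits

universe u v

namespace DepTT

/-! ### Raw expressions -/

/-- A signature of type and term constructors. A constructor `f` takes `arity f` arguments, and its
`i`-th argument binds `binds f i` variables. -/
structure Signature : Type (u + 1) where
  Op : Type u
  arity : Op → ℕ
  binds : (f : Op) → Fin (arity f) → ℕ

/-- Raw expressions (for types and for terms) with free variables `x_0, …, x_{n-1}`, up to renaming
of bound variables. The variables bound in an argument are numbered from `n` on. -/
inductive Expr (S : Signature.{u}) : ℕ → Type u
  | var {n : ℕ} (i : Fin n) : Expr S n
  | op {n : ℕ} (f : S.Op) (args : (i : Fin (S.arity f)) → Expr S (n + S.binds f i)) : Expr S n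

variable {S : Signature.{u}}

/-- A sequence of `n` expressions in `m` variables, to be substituted for `x_0, …, x_{n-1}`. -/
abbrev Sub (S : Signature.{u}) (n m : ℕ) : Type u := Fin n → Expr S m

/-- A renaming, extended by the identity to `k` further variables. -/
def liftRen {n m : ℕ} (k : ℕ) (ρ : Fin n → Fin m) : Fin (n + k) → Fin (m + k) :=
  Fin.addCases (fun i => Fin.castAdd k (ρ i)) (fun j => Fin.natAdd m j)

namespace Expr

/-- Renaming of free variables. -/
def rename : ∀ {n m : ℕ}, Expr S n → (Fin n → Fin m) → Expr S m
  | _, _, var i, ρ => var (ρ i)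
  | _, _, op f args, ρ => op f (fun i => (args i).rename (liftRen (S.binds f i) ρ))

end Expr

/-- A substitution, extended by the identity to `k` further variables. -/
def Sub.lift {n m : ℕ} (k : ℕ) (σ : Sub S n m) : Sub S (n + k) (m + k) :=
  Fin.addCases (fun i => (σ i).rename (Fin.castAdd k)) (fun j => Expr.var (Fin.natAdd m j))

namespace Expr

/-- Simultaneous capture-avoiding substitution. -/
def subst : ∀ {n m : ℕ}, Expr S n → Sub S n m → Expr S m
  | _, _, var i, σ => σ i
  | _, _, op f args, σ => op f (fun i => (args i).subst (Sub.lift (S.binds f i) σ))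

end Expr

namespace Sub

/-- `(x_0, …, x_{n-1})` -/
def id (S : Signature.{u}) (n : ℕ) : Sub S n n := Expr.var

/-- `(x_0, …, x_{n-1})`, regarded as expressions in one more variable. -/
def wk (S : Signature.{u}) (n : ℕ) : Sub S n (n + 1) := fun i => Expr.var i.castSucc

/-- Adding one more expression to a sequence. -/
def snoc {n m : ℕ} (σ : Sub S n m) (a : Expr S m) : Sub S (n + 1) m :=
  Fin.snoc (α := fun _ => Expr S m) σ a

/-- The first `n` of `n + 1` expressions. -/
def init {n m : ℕ} (σ : Sub S (n + 1) m) : Sub S n m := fun i => σ i.castSucc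

/-- Substitution in a sequence of expressions. -/
def comp {n m k : ℕ} (σ : Sub S n m) (τ : Sub S m k) : Sub S n k := fun i => (σ i).subst τ

/-- `[a/x]` for the last variable `x`. -/
def inst {n : ℕ} (a : Expr S n) : Sub S (n + 1) n := snoc (id S n) a

end Sub

/-- The last variable. -/
def Expr.last (S : Signature.{u}) (n : ℕ) : Expr S (n + 1) := Expr.var (Fin.last n)

/-- An expression, regarded as an expression in one more variable. -/
def Expr.wk {n : ℕ} (e : Expr S n) : Expr S (n + 1) := e.subst (Sub.wk S n)

section SubstitutionLemmas

theorem Expr.rename_op {n m : ℕ} (f : S.Op) (args : (i : Fin (S.arity f)) → Expr S (n + S.binds f i))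
    (ρ : Fin n → Fin m) : (Expr.op f args).rename ρ
      = Expr.op f (fun i => (args i).rename (liftRen (S.binds f i) ρ)) := rfl

theorem Expr.subst_op {n m : ℕ} (f : S.Op) (args : (i : Fin (S.arity f)) → Expr S (n + S.binds f i))
    (σ : Sub S n m) : (Expr.op f args).subst σ
      = Expr.op f (fun i => (args i).subst (Sub.lift (S.binds f i) σ)) := rfl

theorem Expr.rename_var {n m : ℕ} (i : Fin n) (ρ : Fin n → Fin m) :
    (Expr.var i : Expr S n).rename ρ = Expr.var (ρ i) := rfl

theorem Expr.subst_var {n m : ℕ} (i : Fin n) (σ : Sub S n m) :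
    (Expr.var i : Expr S n).subst σ = σ i := rfl

theorem Expr.subst_rename {n : ℕ} (e : Expr S n) : ∀ {m k : ℕ} (ρ : Fin n → Fin m) (σ : Sub S m k),
    (e.rename ρ).subst σ = e.subst (fun i => σ (ρ i)) := by
  induction e with
  | var i => intros; rfl
  | op f args ih =>
    intro m k ρ σ
    rw [Expr.rename_op, Expr.subst_op, Expr.subst_op]
    congr 1; funext i
    rw [ih]
    congr 1; funext j
    refine Fin.addCases (fun a => ?_) (fun b => ?_) j <;> simp [Sub.lift, liftRen]

theorem Expr.rename_rename {n : ℕ} (e : Expr S n) : ∀ {m k : ℕ} (ρ : Fin n → Fin m)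
    (ρ' : Fin m → Fin k), (e.rename ρ).rename ρ' = e.rename (fun i => ρ' (ρ i)) := by
  induction e with
  | var i => intros; rfl
  | op f args ih =>
    intro m k ρ σ
    rw [Expr.rename_op, Expr.rename_op, Expr.rename_op]
    congr 1; funext i
    rw [ih]
    congr 1; funext j
    refine Fin.addCases (fun a => ?_) (fun b => ?_) j <;> simp [liftRen]

theorem Expr.rename_subst {n : ℕ} (e : Expr S n) : ∀ {m k : ℕ} (σ : Sub S n m) (ρ : Fin m → Fin k),
    (e.subst σ).rename ρ = e.subst (fun i => (σ i).rename ρ) := by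
  induction e with
  | var i => intros; rfl
  | op f args ih =>
    intro m k σ ρ
    rw [Expr.subst_op, Expr.rename_op, Expr.subst_op]
    congr 1; funext i
    rw [ih]
    congr 1; funext j
    refine Fin.addCases (fun a => ?_) (fun b => ?_) j
    · simp [Sub.lift, liftRen, Expr.rename_rename]
    · simp [Sub.lift, liftRen, Expr.rename_var]

theorem Sub.lift_comp {n m l : ℕ} (k : ℕ) (σ : Sub S n m) (τ : Sub S m l) :
    (Sub.lift k σ).comp (Sub.lift k τ) = Sub.lift k (σ.comp τ) := by
  funext j
  refine Fin.addCases (fun a => ?_) (fun b => ?_) j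
  · simp [Sub.lift, Sub.comp, Expr.subst_rename, Expr.rename_subst]
  · simp [Sub.lift, Sub.comp, Expr.subst_var]

theorem Expr.subst_subst {n : ℕ} (e : Expr S n) : ∀ {m k : ℕ} (σ : Sub S n m) (τ : Sub S m k),
    (e.subst σ).subst τ = e.subst (σ.comp τ) := by
  induction e with
  | var i => intros; rfl
  | op f args ih =>
    intro m k σ τ
    rw [Expr.subst_op, Expr.subst_op, Expr.subst_op]
    congr 1; funext i
    rw [ih, Sub.lift_comp]

theorem Sub.lift_id (n k : ℕ) : Sub.lift k (Sub.id S n) = Sub.id S (n + k) := by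
  funext j
  refine Fin.addCases (fun a => ?_) (fun b => ?_) j <;>
    simp [Sub.lift, Sub.id, Expr.rename_var]

theorem Expr.subst_id {n : ℕ} (e : Expr S n) : e.subst (Sub.id S n) = e := by
  induction e with
  | var i => rfl
  | op f args ih =>
    rw [Expr.subst_op]
    congr 1; funext i
    rw [Sub.lift_id, ih]

theorem Sub.id_comp {n m : ℕ} (σ : Sub S n m) : (Sub.id S n).comp σ = σ := rfl

theorem Sub.comp_id {n m : ℕ} (σ : Sub S n m) : σ.comp (Sub.id S m) = σ :=
  funext fun _ => Expr.subst_id _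

theorem Sub.comp_assoc {n m k l : ℕ} (σ : Sub S n m) (τ : Sub S m k) (υ : Sub S k l) :
    (σ.comp τ).comp υ = σ.comp (τ.comp υ) :=
  funext fun _ => Expr.subst_subst _ _ _

theorem Sub.snoc_castSucc {n m : ℕ} (σ : Sub S n m) (a : Expr S m) (i : Fin n) :
    σ.snoc a i.castSucc = σ i := by simp [Sub.snoc]

theorem Sub.snoc_last {n m : ℕ} (σ : Sub S n m) (a : Expr S m) :
    σ.snoc a (Fin.last n) = a := by simp [Sub.snoc]

theorem Sub.init_snoc {n m : ℕ} (σ : Sub S n m) (a : Expr S m) : (σ.snoc a).init = σ :=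
  funext fun _ => Sub.snoc_castSucc _ _ _

theorem Sub.snoc_init {n m : ℕ} (σ : Sub S (n + 1) m) : σ.init.snoc (σ (Fin.last n)) = σ := by
  funext i
  refine Fin.lastCases ?_ (fun j => ?_) i
  · rw [Sub.snoc_last]
  · rw [Sub.snoc_castSucc]; rfl

theorem Sub.wk_comp {n m : ℕ} (σ : Sub S (n + 1) m) : (Sub.wk S n).comp σ = σ.init := rfl

theorem Sub.snoc_comp {n m k : ℕ} (σ : Sub S n m) (a : Expr S m) (τ : Sub S m k) :
    (σ.snoc a).comp τ = (σ.comp τ).snoc (a.subst τ) := by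
  funext i
  refine Fin.lastCases ?_ (fun j => ?_) i
  · simp [Sub.comp, Sub.snoc_last]
  · simp [Sub.comp, Sub.snoc_castSucc]

theorem Sub.lift_one {n m : ℕ} (σ : Sub S n m) :
    Sub.lift 1 σ = (σ.comp (Sub.wk S m)).snoc (Expr.last S m) := by
  funext i
  refine Fin.lastCases ?_ (fun j => ?_) i
  · rw [Sub.snoc_last]
    exact Fin.addCases_right (0 : Fin 1)
  · rw [Sub.snoc_castSucc]
    refine (Fin.addCases_left j).trans ?_
    have h := Expr.subst_rename (σ j) (Fin.castAdd 1) (Sub.id S (m + 1))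
    rw [Expr.subst_id] at h
    exact h

theorem Sub.lift_one_inst {n m : ℕ} (σ : Sub S n m) (a : Expr S m) :
    (Sub.lift 1 σ).comp (Sub.inst a) = σ.snoc a := by
  rw [Sub.lift_one, Sub.snoc_comp, Sub.comp_assoc]
  have h1 : (Sub.wk S m).comp (Sub.inst a) = Sub.id S m := by
    rw [Sub.wk_comp]; exact Sub.init_snoc _ _
  have h2 : (Expr.last S m).subst (Sub.inst a) = a := Sub.snoc_last _ _
  rw [h1, h2, Sub.comp_id]

end SubstitutionLemmas

/-! ### Contexts and judgements -/

/-- Contexts `[x_0 ∈ A_0, …, x_{n-1} ∈ A_{n-1}(x_0, …, x_{n-2})]` (raw). -/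
inductive Ctx (S : Signature.{u}) : ℕ → Type u
  | nil : Ctx S 0
  | snoc {n : ℕ} (Γ : Ctx S n) (A : Expr S n) : Ctx S (n + 1)

/-- Telescopes of length `m` over a context of length `n`, that is, the lists `Δ` of types with which
a context `Γ` of length `n` can be extended to a context `[Γ, Δ]` of length `n + m` (raw). -/
inductive Tel (S : Signature.{u}) (n : ℕ) : ℕ → Type u
  | nil : Tel S n 0
  | snoc {m : ℕ} (Δ : Tel S n m) (A : Expr S (n + m)) : Tel S n (m + 1)

/-- The context `[Γ, Δ]`. -/
def Ctx.append {n : ℕ} (Γ : Ctx S n) : ∀ {m : ℕ}, Tel S n m → Ctx S (n + m)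
  | _, .nil => Γ
  | _, .snoc Δ A => (Γ.append Δ).snoc A

/-- Substitution in a telescope. -/
def Tel.subst {n k : ℕ} : ∀ {m : ℕ}, Tel S n m → Sub S n k → Tel S k m
  | _, .nil, _ => .nil
  | m + 1, .snoc Δ A, σ => (Δ.subst σ).snoc (A.subst (Sub.lift m σ))

/-- The four forms of judgement: `A ∈ Type`, `a ∈ A`, `A = B ∈ Type` and `a = b ∈ A`. -/
inductive Judgement (S : Signature.{u}) (n : ℕ) : Type u
  | isType (A : Expr S n)
  | hasType (a A : Expr S n)
  | eqType (A B : Expr S n)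
  | eqTerm (a b A : Expr S n)

/-- Substitution in a judgement. -/
def Judgement.subst {n m : ℕ} : Judgement S n → Sub S n m → Judgement S m
  | isType A, σ => isType (A.subst σ)
  | hasType a A, σ => hasType (a.subst σ) (A.subst σ)
  | eqType A B, σ => eqType (A.subst σ) (B.subst σ)
  | eqTerm a b A, σ => eqTerm (a.subst σ) (b.subst σ) (A.subst σ)

open Judgement

/-! ### Type theories -/

/-- A dependent type theory over the signature `S`, given by its derivable statements `J [Γ]`. These
are closed under the basic rules of type theory, and they may contain anything besides. -/
structure TypeTheory (S : Signature.{u}) where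
  /-- The statement `J [Γ]` is derivable. -/
  Derivable : ∀ {n : ℕ}, Ctx S n → Judgement S n → Prop
  -- A statement is derivable only if its context and the constituents of the judgement are well-formed.
  ctx_wf : ∀ {n : ℕ} {Γ : Ctx S n} {A : Expr S n} {𝓙 : Judgement S (n + 1)},
    Derivable (Γ.snoc A) 𝓙 → Derivable Γ (isType A)
  hasType_wf : ∀ {n : ℕ} {Γ : Ctx S n} {a A : Expr S n},
    Derivable Γ (hasType a A) → Derivable Γ (isType A)
  eqType_wf : ∀ {n : ℕ} {Γ : Ctx S n} {A B : Expr S n},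
    Derivable Γ (eqType A B) → Derivable Γ (isType A) ∧ Derivable Γ (isType B)
  eqTerm_wf : ∀ {n : ℕ} {Γ : Ctx S n} {a b A : Expr S n},
    Derivable Γ (eqTerm a b A) → Derivable Γ (hasType a A) ∧ Derivable Γ (hasType b A)
  -- Axiom, weakening and substitution.
  var_mem : ∀ {n : ℕ} {Γ : Ctx S n} {A : Expr S n},
    Derivable Γ (isType A) → Derivable (Γ.snoc A) (hasType (Expr.last S n) A.wk)
  weakening : ∀ {n m : ℕ} {Γ : Ctx S n} {Δ : Tel S n m} {𝓙 : Judgement S (n + m)} {A : Expr S n},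
    Derivable (Γ.append Δ) 𝓙 → Derivable Γ (isType A) →
      Derivable ((Γ.snoc A).append (Δ.subst (Sub.wk S n))) (𝓙.subst (Sub.lift m (Sub.wk S n)))
  substitution : ∀ {n m : ℕ} {Γ : Ctx S n} {A : Expr S n} {Δ : Tel S (n + 1) m}
    {𝓙 : Judgement S (n + 1 + m)} {a : Expr S n},
    Derivable ((Γ.snoc A).append Δ) 𝓙 → Derivable Γ (hasType a A) →
      Derivable (Γ.append (Δ.subst (Sub.inst a))) (𝓙.subst (Sub.lift m (Sub.inst a)))
  -- Definitional equality is an equivalence relation.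
  type_refl : ∀ {n : ℕ} {Γ : Ctx S n} {A : Expr S n},
    Derivable Γ (isType A) → Derivable Γ (eqType A A)
  type_symm : ∀ {n : ℕ} {Γ : Ctx S n} {A B : Expr S n},
    Derivable Γ (eqType A B) → Derivable Γ (eqType B A)
  type_trans : ∀ {n : ℕ} {Γ : Ctx S n} {A B C : Expr S n},
    Derivable Γ (eqType A B) → Derivable Γ (eqType B C) → Derivable Γ (eqType A C)
  term_refl : ∀ {n : ℕ} {Γ : Ctx S n} {a A : Expr S n},
    Derivable Γ (hasType a A) → Derivable Γ (eqTerm a a A)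
  term_symm : ∀ {n : ℕ} {Γ : Ctx S n} {a b A : Expr S n},
    Derivable Γ (eqTerm a b A) → Derivable Γ (eqTerm b a A)
  term_trans : ∀ {n : ℕ} {Γ : Ctx S n} {a b c A : Expr S n},
    Derivable Γ (eqTerm a b A) → Derivable Γ (eqTerm b c A) → Derivable Γ (eqTerm a c A)
  -- Compatibility rules for definitional equality.
  hasType_conv : ∀ {n : ℕ} {Γ : Ctx S n} {a A B : Expr S n},
    Derivable Γ (hasType a A) → Derivable Γ (eqType A B) → Derivable Γ (hasType a B)
  eqTerm_conv : ∀ {n : ℕ} {Γ : Ctx S n} {a b A B : Expr S n},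
    Derivable Γ (eqTerm a b A) → Derivable Γ (eqType A B) → Derivable Γ (eqTerm a b B)
  -- Congruence: substituting definitionally equal terms gives definitionally equal results. For a
  -- theory in which every constructor has its congruence rules this follows from those rules.
  subst_congr_type : ∀ {n m : ℕ} {Γ : Ctx S n} {A : Expr S n} {Δ : Tel S (n + 1) m}
    {B : Expr S (n + 1 + m)} {a a' : Expr S n},
    Derivable ((Γ.snoc A).append Δ) (isType B) → Derivable Γ (eqTerm a a' A) →
      Derivable (Γ.append (Δ.subst (Sub.inst a)))
        (eqType (B.subst (Sub.lift m (Sub.inst a))) (B.subst (Sub.lift m (Sub.inst a'))))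
  subst_congr_term : ∀ {n m : ℕ} {Γ : Ctx S n} {A : Expr S n} {Δ : Tel S (n + 1) m}
    {b B : Expr S (n + 1 + m)} {a a' : Expr S n},
    Derivable ((Γ.snoc A).append Δ) (hasType b B) → Derivable Γ (eqTerm a a' A) →
      Derivable (Γ.append (Δ.subst (Sub.inst a)))
        (eqTerm (b.subst (Sub.lift m (Sub.inst a))) (b.subst (Sub.lift m (Sub.inst a')))
          (B.subst (Sub.lift m (Sub.inst a))))

namespace TypeTheory

variable (T : TypeTheory S)

/-- Well-formed contexts. -/
def Valid : ∀ {n : ℕ}, Ctx S n → Prop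
  | _, .nil => True
  | _, .snoc Γ A => Valid Γ ∧ T.Derivable Γ (isType A)

/-- Definitional equality of contexts of the same length. -/
def CtxEq : ∀ {n : ℕ}, Ctx S n → Ctx S n → Prop
  | _, .nil, .nil => True
  | _, .snoc Γ A, .snoc Γ' A' => CtxEq Γ Γ' ∧ T.Derivable Γ (eqType A A')

/-- `IsCtxMor T Δ Γ t` says that `t_i ∈ A_i(t_0, …, t_{i-1}) [Δ]` is derivable for every `i`, where
`Γ = [x_0 ∈ A_0, x_1 ∈ A_1(x_0), …]`. -/
def IsCtxMor {k : ℕ} (Δ : Ctx S k) : ∀ {n : ℕ}, Ctx S n → Sub S n k → Prop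
  | _, .nil, _ => True
  | n + 1, .snoc Γ A, t => IsCtxMor Δ Γ t.init ∧
      T.Derivable Δ (hasType (t (Fin.last n)) (A.subst t.init))

/-- `CtxMorEq T Δ Γ s t` says that `s_i = t_i ∈ A_i(t_0, …, t_{i-1}) [Δ]` is derivable for every `i`,
where `Γ = [x_0 ∈ A_0, x_1 ∈ A_1(x_0), …]`. -/
def CtxMorEq {k : ℕ} (Δ : Ctx S k) : ∀ {n : ℕ}, Ctx S n → Sub S n k → Sub S n k → Prop
  | _, .nil, _, _ => True
  | n + 1, .snoc Γ A, s, t => CtxMorEq Δ Γ s.init t.init ∧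
      T.Derivable Δ (eqTerm (s (Fin.last n)) (t (Fin.last n)) (A.subst t.init))

end TypeTheory

/-! ### Admissibility of simultaneous substitution

These facts are what the definition of the classifying category needs. -/

section Admissible

theorem Judgement.subst_subst {n m k : ℕ} (𝓙 : Judgement S n) (σ : Sub S n m) (τ : Sub S m k) :
    (𝓙.subst σ).subst τ = 𝓙.subst (σ.comp τ) := by
  cases 𝓙 <;> simp [Judgement.subst, Expr.subst_subst]

theorem Judgement.subst_id {n : ℕ} (𝓙 : Judgement S n) : 𝓙.subst (Sub.id S n) = 𝓙 := by
  cases 𝓙 <;> simp [Judgement.subst, Expr.subst_id]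

theorem Tel.subst_subst {n k l : ℕ} (σ : Sub S n k) (τ : Sub S k l) {m : ℕ} (Δ : Tel S n m) :
    (Δ.subst σ).subst τ = Δ.subst (σ.comp τ) := by
  induction Δ with
  | nil => rfl
  | snoc Δ A ih => simp [Tel.subst, ih, Expr.subst_subst, Sub.lift_comp]

theorem Tel.subst_id {n m : ℕ} (Δ : Tel S n m) : Δ.subst (Sub.id S n) = Δ := by
  induction Δ with
  | nil => rfl
  | snoc Δ A ih => simp [Tel.subst, ih, Expr.subst_id, Sub.lift_id]

/-- The change of indices along an equality of numbers of variables. -/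
def Sub.ofEq (S : Signature.{u}) {n m : ℕ} (h : n = m) : Sub S n m := fun i => Expr.var (Fin.cast h i)

theorem Sub.ofEq_rfl (n : ℕ) (h : n = n) : Sub.ofEq S h = Sub.id S n := rfl

/-- A context, with its length replaced by an equal number. -/
def Ctx.cast {n m : ℕ} (h : n = m) (Γ : Ctx S n) : Ctx S m := h ▸ Γ

/-- The telescope `[x ∈ A, Θ]`. -/
def Tel.cons {n : ℕ} (A : Expr S n) : ∀ {m : ℕ}, Tel S (n + 1) m → Tel S n (m + 1)
  | _, .nil => Tel.snoc .nil A
  | m + 1, .snoc Θ B => (Tel.cons A Θ).snoc (B.subst (Sub.ofEq S (Nat.add_right_comm n 1 m)))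

theorem Ctx.cast_snoc {n m : ℕ} (h : n = m) (h' : n + 1 = m + 1) (Γ : Ctx S n) (A : Expr S n) :
    (Γ.snoc A).cast h' = (Γ.cast h).snoc (A.subst (Sub.ofEq S h)) := by
  subst h
  rw [Sub.ofEq_rfl, Expr.subst_id]
  rfl

theorem Ctx.append_cons {n m : ℕ} (Γ : Ctx S n) (A : Expr S n) (Θ : Tel S (n + 1) m)
    (h : n + 1 + m = n + (m + 1)) : ((Γ.snoc A).append Θ).cast h = Γ.append (Tel.cons A Θ) := by
  induction Θ with
  | nil => rfl
  | @snoc m Θ B ih =>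
    have h' : n + 1 + m = n + (m + 1) := by omega
    exact (Ctx.cast_snoc h' h _ _).trans (by rw [ih h']; rfl)

theorem Sub.lift_ofEq {n k : ℕ} (m : ℕ) (σ : Sub S n k) (h : n + 1 + m = n + (m + 1))
    (h' : k + 1 + m = k + (m + 1)) :
    (Sub.ofEq S h).comp (Sub.lift (m + 1) σ) = (Sub.lift m (Sub.lift 1 σ)).comp (Sub.ofEq S h') := by
  have key : ∀ (e : Expr S k), (e.rename (Fin.castAdd (m + 1))) =
      ((e.rename (Fin.castAdd 1)).rename (Fin.castAdd m)).subst (Sub.ofEq S h') := by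
    intro e
    rw [Expr.rename_rename, Expr.subst_rename]
    have := Expr.subst_rename e (Fin.castAdd (m + 1)) (Sub.id S (k + (m + 1)))
    rw [Expr.subst_id] at this
    rw [this]
    rfl
  funext j
  refine Fin.addCases (fun a => ?_) (fun b => ?_) j
  · refine Fin.addCases (fun a => ?_) (fun b => ?_) a
    · have e1 : Fin.cast h (Fin.castAdd m (Fin.castAdd 1 a)) = Fin.castAdd (m + 1) a := rfl
      simp [Sub.comp, Sub.ofEq, Expr.subst_var, e1, Sub.lift]
      exact key _
    · have e1 : Fin.cast h (Fin.castAdd m (Fin.natAdd n b)) = Fin.natAdd n ⟨b, by omega⟩ := rfl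
      simp only [Sub.comp, Sub.ofEq, Expr.subst_var, e1, Sub.lift, Fin.addCases_left,
        Fin.addCases_right, Expr.rename_var]
      rfl
  · have e1 : Fin.cast h (Fin.natAdd (n + 1) b) = Fin.natAdd n ⟨1 + b, by omega⟩ := by
      ext; simp; omega
    simp only [Sub.comp, Sub.ofEq, Expr.subst_var, e1, Sub.lift, Fin.addCases_right]
    congr 1
    ext; simp; omega

theorem Sub.lift_zero {n k : ℕ} (σ : Sub S n k) : Sub.lift 0 σ = σ := by
  funext j
  refine (Fin.addCases_left (n := 0) j).trans ?_
  have h := Expr.subst_rename (σ j) (Fin.castAdd 0) (Sub.id S _)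
  rw [Expr.subst_id] at h
  exact h.trans (Expr.subst_id _)

theorem Tel.cons_subst {n k : ℕ} (σ : Sub S n k) (A : Expr S n) {m : ℕ} (Θ : Tel S (n + 1) m) :
    (Tel.cons A Θ).subst σ = Tel.cons (A.subst σ) (Θ.subst (Sub.lift 1 σ)) := by
  induction Θ with
  | nil =>
    simp only [Tel.cons, Tel.subst]
    exact congrArg (fun s => Tel.snoc Tel.nil (A.subst s)) (Sub.lift_zero σ)
  | snoc Θ B ih =>
    simp only [Tel.cons, Tel.subst, ih, Expr.subst_subst]
    rw [Sub.lift_ofEq]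

namespace TypeTheory

variable {T : TypeTheory S}

theorem derivable_cast {n m : ℕ} (h : n = m) (Γ : Ctx S n) (𝓙 : Judgement S n) :
    T.Derivable (Γ.cast h) (𝓙.subst (Sub.ofEq S h)) ↔ T.Derivable Γ 𝓙 := by
  subst h
  rw [Sub.ofEq_rfl, Judgement.subst_id]
  rfl

theorem derivable_cons {n m : ℕ} (Γ : Ctx S n) (A : Expr S n) (Θ : Tel S (n + 1) m)
    (𝓙 : Judgement S (n + 1 + m)) (h : n + 1 + m = n + (m + 1)) :
    T.Derivable (Γ.append (Tel.cons A Θ)) (𝓙.subst (Sub.ofEq S h)) ↔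
      T.Derivable ((Γ.snoc A).append Θ) 𝓙 := by
  rw [← Ctx.append_cons Γ A Θ h, derivable_cast]

theorem valid_of_derivable : ∀ {n : ℕ} {Γ : Ctx S n} {𝓙 : Judgement S n},
    T.Derivable Γ 𝓙 → T.Valid Γ
  | _, .nil, _, _ => trivial
  | _, .snoc _ _, _, h => ⟨valid_of_derivable (T.ctx_wf h), T.ctx_wf h⟩

theorem derivable_of_front {m : ℕ} {Θ : Tel S 0 m} {𝓙 : Judgement S (0 + m)}
    (h : T.Derivable (Ctx.nil.append Θ) 𝓙) : ∀ {k : ℕ} (Δ : Ctx S k), T.Valid Δ →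
      ∀ t : Sub S 0 k, T.Derivable (Δ.append (Θ.subst t)) (𝓙.subst (Sub.lift m t))
  | _, .nil, _, t => by
    have ht : t = Sub.id S 0 := funext fun i => i.elim0
    rwa [ht, Tel.subst_id, Sub.lift_id, Judgement.subst_id]
  | k + 1, .snoc Δ A, hv, t => by
    have := T.weakening (derivable_of_front h Δ hv.1 (fun i => i.elim0)) hv.2
    rw [Tel.subst_subst, Judgement.subst_subst, Sub.lift_comp] at this
    have ht : t = Sub.comp (fun i => i.elim0) (Sub.wk S k) := funext fun i => i.elim0
    rwa [← ht] at this

/-- Simultaneous substitution, under a telescope. -/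
theorem derivable_subst_tel {k : ℕ} {Δ : Ctx S k} (hΔ : T.Valid Δ) :
    ∀ {n : ℕ} {Γ : Ctx S n} {t : Sub S n k}, T.IsCtxMor Δ Γ t →
      ∀ {m : ℕ} (Θ : Tel S n m) {𝓙 : Judgement S (n + m)}, T.Derivable (Γ.append Θ) 𝓙 →
        T.Derivable (Δ.append (Θ.subst t)) (𝓙.subst (Sub.lift m t))
  | _, .nil, t, _, _, _, _, h => derivable_of_front h Δ hΔ t
  | n + 1, .snoc Γ A, t, ht, m, Θ, 𝓙, h => by
    have e : n + 1 + m = n + (m + 1) := by omega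
    have e' : k + 1 + m = k + (m + 1) := by omega
    have h1 := derivable_subst_tel hΔ ht.1 (Tel.cons A Θ) ((derivable_cons Γ A Θ 𝓙 e).2 h)
    rw [Tel.cons_subst, Judgement.subst_subst, Sub.lift_ofEq _ _ e e', ← Judgement.subst_subst,
      derivable_cons] at h1
    have h2 := T.substitution h1 ht.2
    rwa [Tel.subst_subst, Judgement.subst_subst, Sub.lift_comp, Sub.lift_one_inst,
      Sub.snoc_init] at h2

/-- Simultaneous substitution. -/
theorem derivable_subst {k n : ℕ} {Δ : Ctx S k} (hΔ : T.Valid Δ) {Γ : Ctx S n} {t : Sub S n k}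
    (ht : T.IsCtxMor Δ Γ t) {𝓙 : Judgement S n} (h : T.Derivable Γ 𝓙) :
    T.Derivable Δ (𝓙.subst t) := by
  have := derivable_subst_tel hΔ ht .nil (𝓙 := 𝓙) h
  exact (Sub.lift_zero t ▸ this :)

theorem derivable_wk {n : ℕ} {Γ : Ctx S n} {A : Expr S n} {𝓙 : Judgement S n}
    (h : T.Derivable Γ 𝓙) (hA : T.Derivable Γ (isType A)) :
    T.Derivable (Γ.snoc A) (𝓙.subst (Sub.wk S n)) := by
  have := T.weakening (Δ := .nil) (𝓙 := 𝓙) h hA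
  exact (Sub.lift_zero (Sub.wk S n) ▸ this :)

theorem IsCtxMor.wk {k : ℕ} {Δ : Ctx S k} {B : Expr S k} (hB : T.Derivable Δ (isType B)) :
    ∀ {n : ℕ} {Γ : Ctx S n} {t : Sub S n k}, T.IsCtxMor Δ Γ t →
      T.IsCtxMor (Δ.snoc B) Γ (t.comp (Sub.wk S k))
  | _, .nil, _, _ => trivial
  | _, .snoc Γ A, t, ht => by
    refine ⟨IsCtxMor.wk hB ht.1, ?_⟩
    have := derivable_wk ht.2 hB
    simp only [Judgement.subst, Expr.subst_subst] at this
    exact this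

/-- Definitionally equal contexts are related by the identity substitution. -/
theorem CtxEq.isCtxMor : ∀ {n : ℕ} {Γ Γ' : Ctx S n}, T.Valid Γ' → T.CtxEq Γ Γ' →
    T.IsCtxMor Γ' Γ (Sub.id S n)
  | _, .nil, .nil, _, _ => trivial
  | n + 1, .snoc Γ A, .snoc Γ' A', hv, h => by
    have ih := CtxEq.isCtxMor hv.1 h.1
    refine ⟨IsCtxMor.wk hv.2 ih, ?_⟩
    have h1 := derivable_subst hv.1 ih h.2
    rw [Judgement.subst_id] at h1
    exact T.hasType_conv (T.var_mem hv.2) (T.type_symm (derivable_wk h1 hv.2))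

theorem CtxEq.derivable {n : ℕ} {Γ Γ' : Ctx S n} (hv : T.Valid Γ') (h : T.CtxEq Γ Γ')
    {𝓙 : Judgement S n} (hJ : T.Derivable Γ 𝓙) : T.Derivable Γ' 𝓙 := by
  have := derivable_subst hv (CtxEq.isCtxMor hv h) hJ
  rwa [Judgement.subst_id] at this

theorem CtxEq.refl : ∀ {n : ℕ} {Γ : Ctx S n}, T.Valid Γ → T.CtxEq Γ Γ
  | _, .nil, _ => trivial
  | _, .snoc _ _, h => ⟨CtxEq.refl h.1, T.type_refl h.2⟩

theorem isCtxMor_id {n : ℕ} {Γ : Ctx S n} (h : T.Valid Γ) : T.IsCtxMor Γ Γ (Sub.id S n) :=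
  CtxEq.isCtxMor h (CtxEq.refl h)

theorem CtxEq.symm : ∀ {n : ℕ} {Γ Γ' : Ctx S n}, T.Valid Γ' → T.CtxEq Γ Γ' → T.CtxEq Γ' Γ
  | _, .nil, .nil, _, _ => trivial
  | _, .snoc _ _, .snoc _ _, hv, h =>
    ⟨CtxEq.symm hv.1 h.1, T.type_symm (h.1.derivable hv.1 h.2)⟩

theorem CtxEq.trans : ∀ {n : ℕ} {Γ Γ' Γ'' : Ctx S n}, T.Valid Γ → T.Valid Γ' →
    T.CtxEq Γ Γ' → T.CtxEq Γ' Γ'' → T.CtxEq Γ Γ''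
  | _, .nil, .nil, .nil, _, _, _, _ => trivial
  | _, .snoc _ _, .snoc _ _, .snoc _ _, hv, hv', h, h' =>
    ⟨CtxEq.trans hv.1 hv'.1 h.1 h'.1,
      T.type_trans h.2 (CtxEq.derivable hv.1 (CtxEq.symm hv'.1 h.1) h'.2)⟩

/-- Simultaneous substitution of definitionally equal terms, under a telescope. -/
theorem subst_congr_tel {k : ℕ} {Δ : Ctx S k} (hΔ : T.Valid Δ) :
    ∀ {n : ℕ} {Γ : Ctx S n} {s t : Sub S n k}, T.IsCtxMor Δ Γ s → T.IsCtxMor Δ Γ t →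
      T.CtxMorEq Δ Γ s t → ∀ {m : ℕ} (Θ : Tel S n m),
      (∀ {B : Expr S (n + m)}, T.Derivable (Γ.append Θ) (isType B) →
        T.Derivable (Δ.append (Θ.subst s))
          (eqType (B.subst (Sub.lift m s)) (B.subst (Sub.lift m t)))) ∧
      (∀ {b B : Expr S (n + m)}, T.Derivable (Γ.append Θ) (hasType b B) →
        T.Derivable (Δ.append (Θ.subst s))
          (eqTerm (b.subst (Sub.lift m s)) (b.subst (Sub.lift m t)) (B.subst (Sub.lift m s))))
  | _, .nil, s, t, _, _, _, m, Θ => by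
    have ht : t = s := funext fun i => i.elim0
    subst ht
    exact ⟨fun h => T.type_refl (derivable_of_front h Δ hΔ t),
      fun h => T.term_refl (derivable_of_front h Δ hΔ t)⟩
  | n + 1, .snoc Γ A, s, t, hs, ht, hst, m, Θ => by
    have step : ∀ {m : ℕ} (Θ : Tel S (n + 1) m),
      (∀ {B : Expr S (n + 1 + m)}, T.Derivable ((Γ.snoc A).append Θ) (isType B) →
        T.Derivable (Δ.append (Θ.subst s)) (eqType (B.subst (Sub.lift m s))
          (B.subst (Sub.lift m (t.init.snoc (s (Fin.last n))))))) ∧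
      (∀ {b B : Expr S (n + 1 + m)}, T.Derivable ((Γ.snoc A).append Θ) (hasType b B) →
        T.Derivable (Δ.append (Θ.subst s)) (eqTerm (b.subst (Sub.lift m s))
          (b.subst (Sub.lift m (t.init.snoc (s (Fin.last n))))) (B.subst (Sub.lift m s)))) := by
      intro m Θ
      have e : n + 1 + m = n + (m + 1) := by omega
      have e' : k + 1 + m = k + (m + 1) := by omega
      have ih := subst_congr_tel hΔ hs.1 ht.1 hst.1 (Tel.cons A Θ)
      have fix : ∀ 𝓙 : Judgement S (k + 1 + m),
          T.Derivable (Δ.append ((Tel.cons A Θ).subst s.init)) (𝓙.subst (Sub.ofEq S e')) →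
          T.Derivable (Δ.append (Θ.subst s)) (𝓙.subst (Sub.lift m (Sub.inst (s (Fin.last n))))) := by
        intro 𝓙 h
        rw [Tel.cons_subst, derivable_cons] at h
        have := T.substitution h hs.2
        rwa [Tel.subst_subst, Sub.lift_one_inst, Sub.snoc_init] at this
      have swap : ∀ (e0 : Expr S (n + 1 + m)) (r : Sub S n k),
          (e0.subst (Sub.ofEq S e)).subst (Sub.lift (m + 1) r) =
            (e0.subst (Sub.lift m (Sub.lift 1 r))).subst (Sub.ofEq S e') := by
        intro e0 r
        rw [Expr.subst_subst, Expr.subst_subst, Sub.lift_ofEq]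
      have done : ∀ (e0 : Expr S (n + 1 + m)) (r : Sub S n k) (a : Expr S k),
          (e0.subst (Sub.lift m (Sub.lift 1 r))).subst (Sub.lift m (Sub.inst a)) =
            e0.subst (Sub.lift m (r.snoc a)) := by
        intro e0 r a
        rw [Expr.subst_subst, Sub.lift_comp, Sub.lift_one_inst]
      constructor
      · intro B hB
        have h := ih.1 ((derivable_cons Γ A Θ _ e).2 hB)
        rw [swap, swap] at h
        have h' := fix (eqType _ _) h
        simp only [Judgement.subst] at h'
        rwa [done, done, Sub.snoc_init] at h'
      · intro b B hB
        have h := ih.2 ((derivable_cons Γ A Θ _ e).2 hB)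
        rw [swap, swap, swap] at h
        have h' := fix (eqTerm _ _ _) h
        simp only [Judgement.subst] at h'
        rwa [done, done, done, Sub.snoc_init] at h'
    have under : ∀ {𝓙 : Judgement S (n + 1 + m)}, T.Derivable ((Γ.snoc A).append Θ) 𝓙 →
        T.Derivable ((Δ.snoc (A.subst t.init)).append (Θ.subst (Sub.lift 1 t.init)))
          (𝓙.subst (Sub.lift m (Sub.lift 1 t.init))) := by
      intro 𝓙 h
      have e : n + 1 + m = n + (m + 1) := by omega
      have e' : k + 1 + m = k + (m + 1) := by omega
      have h1 := derivable_subst_tel hΔ ht.1 (Tel.cons A Θ) ((derivable_cons Γ A Θ 𝓙 e).2 h)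
      rwa [Tel.cons_subst, Judgement.subst_subst, Sub.lift_ofEq _ _ e e', ← Judgement.subst_subst,
        derivable_cons] at h1
    have tel : ∀ {m : ℕ} (Θ : Tel S (n + 1) m), T.Valid ((Γ.snoc A).append Θ) →
        T.CtxEq (Δ.append (Θ.subst s)) (Δ.append (Θ.subst (t.init.snoc (s (Fin.last n))))) := by
      intro m Θ
      induction Θ with
      | nil => intro _; exact CtxEq.refl hΔ
      | snoc Θ B ih => intro h; exact ⟨ih h.1, (step Θ).1 h.2⟩
    have conv : ∀ {𝓙 : Judgement S (k + m)}, T.Valid ((Γ.snoc A).append Θ) →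
        T.Valid (Δ.append (Θ.subst s)) →
        T.Derivable (Δ.append (Θ.subst (t.init.snoc (s (Fin.last n))))) 𝓙 →
        T.Derivable (Δ.append (Θ.subst s)) 𝓙 := by
      intro 𝓙 h1 h2 h3
      exact CtxEq.derivable h2 (CtxEq.symm (valid_of_derivable h3) (tel Θ h1)) h3
    have done : ∀ (e0 : Expr S (n + 1 + m)) (r : Sub S n k) (a : Expr S k),
        (e0.subst (Sub.lift m (Sub.lift 1 r))).subst (Sub.lift m (Sub.inst a)) =
          e0.subst (Sub.lift m (r.snoc a)) := by
      intro e0 r a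
      rw [Expr.subst_subst, Sub.lift_comp, Sub.lift_one_inst]
    constructor
    · intro B hB
      have h1 := (step Θ).1 hB
      have h2 := T.subst_congr_type (under hB) hst.2
      rw [Tel.subst_subst, Sub.lift_one_inst, done, done, Sub.snoc_init] at h2
      exact T.type_trans h1 (conv (valid_of_derivable hB) (valid_of_derivable h1) h2)
    · intro b B hb
      have h0 := (step Θ).1 (T.hasType_wf hb)
      have h1 := (step Θ).2 hb
      have h2 := T.subst_congr_term (under hb) hst.2
      rw [Tel.subst_subst, Sub.lift_one_inst, done, done, done, Sub.snoc_init] at h2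
      exact T.term_trans h1 (T.eqTerm_conv
        (conv (valid_of_derivable hb) (valid_of_derivable h1) h2) (T.type_symm h0))

/-- Simultaneous substitution of definitionally equal terms in a type. -/
theorem subst_congr_isType {k n : ℕ} {Δ : Ctx S k} (hΔ : T.Valid Δ) {Γ : Ctx S n} {s t : Sub S n k}
    (hs : T.IsCtxMor Δ Γ s) (ht : T.IsCtxMor Δ Γ t) (hst : T.CtxMorEq Δ Γ s t) {B : Expr S n}
    (hB : T.Derivable Γ (isType B)) : T.Derivable Δ (eqType (B.subst s) (B.subst t)) := by
  have h := subst_congr_tel hΔ hs ht hst .nil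
  have := h.1 (B := B) hB
  rw [Sub.lift_zero, Sub.lift_zero] at this
  exact this

/-- Simultaneous substitution of definitionally equal terms in a term. -/
theorem subst_congr_hasType {k n : ℕ} {Δ : Ctx S k} (hΔ : T.Valid Δ) {Γ : Ctx S n}
    {s t : Sub S n k} (hs : T.IsCtxMor Δ Γ s) (ht : T.IsCtxMor Δ Γ t) (hst : T.CtxMorEq Δ Γ s t)
    {b B : Expr S n} (hb : T.Derivable Γ (hasType b B)) :
    T.Derivable Δ (eqTerm (b.subst s) (b.subst t) (B.subst s)) := by
  obtain ⟨-, h⟩ := subst_congr_tel hΔ hs ht hst .nil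
  have := @h b B hb
  rw [Sub.lift_zero, Sub.lift_zero] at this
  exact this

theorem IsCtxMor.comp {k n : ℕ} {Δ : Ctx S k} (hΔ : T.Valid Δ) {Γ : Ctx S n} {t : Sub S n k}
    (ht : T.IsCtxMor Δ Γ t) : ∀ {l : ℕ} {Θ : Ctx S l} {r : Sub S l n}, T.IsCtxMor Γ Θ r →
      T.IsCtxMor Δ Θ (r.comp t)
  | _, .nil, _, _ => trivial
  | _, .snoc Θ A, r, hr => by
    refine ⟨IsCtxMor.comp hΔ ht hr.1, ?_⟩
    have := derivable_subst hΔ ht hr.2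
    simp only [Judgement.subst, Expr.subst_subst] at this
    exact this

/-- Morphisms do not depend on the representatives of source and target. -/
theorem IsCtxMor.congr {k n : ℕ} {Δ Δ' : Ctx S k} {Γ Γ' : Ctx S n}
    (hΔ' : T.Valid Δ') (hΓ : T.Valid Γ) (hΓ' : T.Valid Γ') (eΔ : T.CtxEq Δ Δ') (eΓ : T.CtxEq Γ Γ')
    {t : Sub S n k} (ht : T.IsCtxMor Δ Γ t) : T.IsCtxMor Δ' Γ' t := by
  have h1 := IsCtxMor.comp hΔ' (CtxEq.isCtxMor hΔ' eΔ) ht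
  rw [Sub.comp_id] at h1
  exact IsCtxMor.comp hΔ' h1 (CtxEq.isCtxMor hΓ (CtxEq.symm hΓ' eΓ))

theorem CtxMorEq.right {k : ℕ} {Δ : Ctx S k} : ∀ {n : ℕ} {Γ : Ctx S n} {s t : Sub S n k},
    T.CtxMorEq Δ Γ s t → T.IsCtxMor Δ Γ t
  | _, .nil, _, _, _ => trivial
  | _, .snoc _ _, _, _, h => ⟨CtxMorEq.right h.1, (T.eqTerm_wf h.2).2⟩

theorem CtxMorEq.congr {k : ℕ} {Δ Δ' : Ctx S k} (hΔ : T.Valid Δ) (hΔ' : T.Valid Δ')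
    (eΔ : T.CtxEq Δ Δ') : ∀ {n : ℕ} {Γ Γ' : Ctx S n}, T.CtxEq Γ Γ' →
      ∀ {s t : Sub S n k}, T.CtxMorEq Δ Γ s t → T.CtxMorEq Δ' Γ' s t
  | _, .nil, .nil, _, _, _, _ => trivial
  | _, .snoc _ _, .snoc _ _, eΓ, _, _, h =>
    ⟨CtxMorEq.congr hΔ hΔ' eΔ eΓ.1 h.1, CtxEq.derivable hΔ' eΔ
      (T.eqTerm_conv h.2 (derivable_subst hΔ (CtxMorEq.right h.1) eΓ.2))⟩

theorem CtxMorEq.refl {k : ℕ} {Δ : Ctx S k} : ∀ {n : ℕ} {Γ : Ctx S n} {t : Sub S n k},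
    T.IsCtxMor Δ Γ t → T.CtxMorEq Δ Γ t t
  | _, .nil, _, _ => trivial
  | _, .snoc _ _, _, ht => ⟨CtxMorEq.refl ht.1, T.term_refl ht.2⟩

theorem CtxMorEq.symm {k : ℕ} {Δ : Ctx S k} (hΔ : T.Valid Δ) : ∀ {n : ℕ} {Γ : Ctx S n}
    {s t : Sub S n k}, T.Valid Γ → T.IsCtxMor Δ Γ s → T.IsCtxMor Δ Γ t →
      T.CtxMorEq Δ Γ s t → T.CtxMorEq Δ Γ t s
  | _, .nil, _, _, _, _, _, _ => trivial
  | _, .snoc _ _, _, _, hΓ, hs, ht, h =>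
    have h1 := CtxMorEq.symm hΔ hΓ.1 hs.1 ht.1 h.1
    ⟨h1, T.eqTerm_conv (T.term_symm h.2) (subst_congr_isType hΔ ht.1 hs.1 h1 hΓ.2)⟩

theorem CtxMorEq.trans {k : ℕ} {Δ : Ctx S k} (hΔ : T.Valid Δ) : ∀ {n : ℕ} {Γ : Ctx S n}
    {r s t : Sub S n k}, T.Valid Γ → T.IsCtxMor Δ Γ s → T.IsCtxMor Δ Γ t →
      T.CtxMorEq Δ Γ r s → T.CtxMorEq Δ Γ s t → T.CtxMorEq Δ Γ r t
  | _, .nil, _, _, _, _, _, _, _, _ => trivial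
  | _, .snoc _ _, _, _, _, hΓ, hs, ht, h, h' =>
    ⟨CtxMorEq.trans hΔ hΓ.1 hs.1 ht.1 h.1 h'.1, T.term_trans
      (T.eqTerm_conv h.2 (subst_congr_isType hΔ hs.1 ht.1 h'.1 hΓ.2)) h'.2⟩

/-- Composition respects definitional equality in its first argument. -/
theorem CtxMorEq.comp_left {k n : ℕ} {Δ : Ctx S k} (hΔ : T.Valid Δ) {Γ : Ctx S n}
    {s t : Sub S n k} (hs : T.IsCtxMor Δ Γ s) (ht : T.IsCtxMor Δ Γ t) (hst : T.CtxMorEq Δ Γ s t) :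
    ∀ {l : ℕ} {Θ : Ctx S l} {r : Sub S l n}, T.IsCtxMor Γ Θ r →
      T.CtxMorEq Δ Θ (r.comp s) (r.comp t)
  | _, .nil, _, _ => trivial
  | l + 1, .snoc Θ A, r, hr => by
    refine ⟨CtxMorEq.comp_left hΔ hs ht hst hr.1, ?_⟩
    have h1 := subst_congr_hasType hΔ hs ht hst hr.2
    have h2 := subst_congr_isType hΔ hs ht hst (T.hasType_wf hr.2)
    have h3 := T.eqTerm_conv h1 h2
    rw [Expr.subst_subst] at h3
    exact h3

/-- Composition respects definitional equality in its second argument. -/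
theorem CtxMorEq.comp_right {k n : ℕ} {Δ : Ctx S k} (hΔ : T.Valid Δ) {Γ : Ctx S n}
    {t : Sub S n k} (ht : T.IsCtxMor Δ Γ t) :
    ∀ {l : ℕ} {Θ : Ctx S l} {r r' : Sub S l n}, T.CtxMorEq Γ Θ r r' →
      T.CtxMorEq Δ Θ (r.comp t) (r'.comp t)
  | _, .nil, _, _, _ => trivial
  | l + 1, .snoc Θ A, r, r', hr => by
    refine ⟨CtxMorEq.comp_right hΔ ht hr.1, ?_⟩
    have := derivable_subst hΔ ht hr.2
    simp only [Judgement.subst, Expr.subst_subst] at this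
    exact this

/-- The projection `(x_0, …, x_{n-1}) : [Γ, Δ] → [Γ]`. -/
theorem isCtxMor_proj {n : ℕ} {Γ : Ctx S n} : ∀ {m : ℕ} (Δ : Tel S n m), T.Valid (Γ.append Δ) →
    T.IsCtxMor (Γ.append Δ) Γ (fun i => Expr.var (Fin.castAdd m i))
  | _, .nil, h => isCtxMor_id h
  | _, .snoc Δ _, h => IsCtxMor.wk h.2 (isCtxMor_proj Δ h.1)

theorem valid_of_append {n : ℕ} {Γ : Ctx S n} : ∀ {m : ℕ} (Δ : Tel S n m), T.Valid (Γ.append Δ) →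
    T.Valid Γ
  | _, .nil, h => h
  | _, .snoc Δ _, h => valid_of_append Δ h.1

end TypeTheory

end Admissible

/-! ### Propositional identity types -/

set_option linter.unusedVariables false in
/-- Constructors `Id_A(a, b)`, `r(a)`, `J(a, b, p, d)` and `H(a, d)`, as operations on raw expressions
that commute with substitution. They receive all the data of the rules below as arguments (the type
`A`, the parameter context `Δ` and the type `C`), but need not make use of all of them. -/
structure IdFormers (S : Signature.{u}) where
  Id : ∀ {n : ℕ} (A a b : Expr S n), Expr S n
  r : ∀ {n : ℕ} (A a : Expr S n), Expr S n
  J : ∀ {n m : ℕ} (A : Expr S n) (Δ : Tel S (n + 3) m) (C : Expr S (n + 3 + m))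
    (d : Expr S (n + 1 + m)) (a b p : Expr S n), Expr S (n + m)
  H : ∀ {n m : ℕ} (A : Expr S n) (Δ : Tel S (n + 3) m) (C : Expr S (n + 3 + m))
    (d : Expr S (n + 1 + m)) (a : Expr S n), Expr S (n + m)
  Id_subst : ∀ {n k : ℕ} (A a b : Expr S n) (σ : Sub S n k),
    (Id A a b).subst σ = Id (A.subst σ) (a.subst σ) (b.subst σ)
  r_subst : ∀ {n k : ℕ} (A a : Expr S n) (σ : Sub S n k),
    (r A a).subst σ = r (A.subst σ) (a.subst σ)
  J_subst : ∀ {n m k : ℕ} (A : Expr S n) (Δ : Tel S (n + 3) m) (C : Expr S (n + 3 + m))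
    (d : Expr S (n + 1 + m)) (a b p : Expr S n) (σ : Sub S n k),
    (J A Δ C d a b p).subst (Sub.lift m σ) =
      J (A.subst σ) (Δ.subst (Sub.lift 3 σ)) (C.subst (Sub.lift m (Sub.lift 3 σ)))
        (d.subst (Sub.lift m (Sub.lift 1 σ))) (a.subst σ) (b.subst σ) (p.subst σ)
  H_subst : ∀ {n m k : ℕ} (A : Expr S n) (Δ : Tel S (n + 3) m) (C : Expr S (n + 3 + m))
    (d : Expr S (n + 1 + m)) (a : Expr S n) (σ : Sub S n k),
    (H A Δ C d a).subst (Sub.lift m σ) =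
      H (A.subst σ) (Δ.subst (Sub.lift 3 σ)) (C.subst (Sub.lift m (Sub.lift 3 σ)))
        (d.subst (Sub.lift m (Sub.lift 1 σ))) (a.subst σ)

/-- The substitution `[a/x, b/y, p/u]` for the last three variables `x, y, u`. -/
def Sub.inst₃ {n : ℕ} (a b p : Expr S n) : Sub S (n + 3) n :=
  (((Sub.id S n).snoc a).snoc b).snoc p

namespace IdFormers

/-- The context `[Γ, x ∈ A, y ∈ A, u ∈ Id_A(x, y)]`. -/
def idCtx (F : IdFormers S) {n : ℕ} (Γ : Ctx S n) (A : Expr S n) : Ctx S (n + 3) :=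
  ((Γ.snoc A).snoc A.wk).snoc (F.Id A.wk.wk (Expr.last S n).wk (Expr.last S (n + 1)))

/-- The substitution `[x/x, x/y, r(x)/u]` from the variables `x, y, u` to the variable `x`. -/
def diag (F : IdFormers S) {n : ℕ} (A : Expr S n) : Sub S (n + 3) (n + 1) :=
  (((Sub.wk S n).snoc (Expr.last S n)).snoc (Expr.last S n)).snoc (F.r A.wk (Expr.last S n))

end IdFormers

/-- Propositional identity types in a type theory: formation, introduction, elimination and
(propositional) computation rule, and the congruence rules for the four constructors. -/
structure PropIdTypes (T : TypeTheory S) extends IdFormers S where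
  formation : ∀ {n : ℕ} {Γ : Ctx S n} {A a b : Expr S n},
    T.Derivable Γ (hasType a A) → T.Derivable Γ (hasType b A) → T.Derivable Γ (isType (Id A a b))
  introduction : ∀ {n : ℕ} {Γ : Ctx S n} {A a : Expr S n},
    T.Derivable Γ (hasType a A) → T.Derivable Γ (hasType (r A a) (Id A a a))
  elimination : ∀ {n m : ℕ} {Γ : Ctx S n} {A : Expr S n} {Δ : Tel S (n + 3) m}
    {C : Expr S (n + 3 + m)} {d : Expr S (n + 1 + m)} {a b p : Expr S n},
    T.Derivable ((toIdFormers.idCtx Γ A).append Δ) (isType C) →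
    T.Derivable Γ (hasType a A) → T.Derivable Γ (hasType b A) →
    T.Derivable Γ (hasType p (Id A a b)) →
    T.Derivable ((Γ.snoc A).append (Δ.subst (toIdFormers.diag A)))
      (hasType d (C.subst (Sub.lift m (toIdFormers.diag A)))) →
    T.Derivable (Γ.append (Δ.subst (Sub.inst₃ a b p)))
      (hasType (J A Δ C d a b p) (C.subst (Sub.lift m (Sub.inst₃ a b p))))
  computation : ∀ {n m : ℕ} {Γ : Ctx S n} {A : Expr S n} {Δ : Tel S (n + 3) m}
    {C : Expr S (n + 3 + m)} {d : Expr S (n + 1 + m)} {a : Expr S n},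
    T.Derivable ((toIdFormers.idCtx Γ A).append Δ) (isType C) →
    T.Derivable Γ (hasType a A) →
    T.Derivable ((Γ.snoc A).append (Δ.subst (toIdFormers.diag A)))
      (hasType d (C.subst (Sub.lift m (toIdFormers.diag A)))) →
    T.Derivable (Γ.append (Δ.subst (Sub.inst₃ a a (r A a))))
      (hasType (H A Δ C d a)
        (Id (C.subst (Sub.lift m (Sub.inst₃ a a (r A a)))) (J A Δ C d a a (r A a))
          (d.subst (Sub.lift m (Sub.inst a)))))
  Id_congr : ∀ {n : ℕ} {Γ : Ctx S n} {A A' a a' b b' : Expr S n},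
    T.Derivable Γ (eqType A A') → T.Derivable Γ (eqTerm a a' A) → T.Derivable Γ (eqTerm b b' A) →
    T.Derivable Γ (eqType (Id A a b) (Id A' a' b'))
  r_congr : ∀ {n : ℕ} {Γ : Ctx S n} {A A' a a' : Expr S n},
    T.Derivable Γ (eqType A A') → T.Derivable Γ (eqTerm a a' A) →
    T.Derivable Γ (eqTerm (r A a) (r A' a') (Id A a a))
  J_congr : ∀ {n m : ℕ} {Γ : Ctx S n} {A A' : Expr S n} {Δ Δ' : Tel S (n + 3) m}
    {C C' : Expr S (n + 3 + m)} {d d' : Expr S (n + 1 + m)} {a a' b b' p p' : Expr S n},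
    T.CtxEq ((toIdFormers.idCtx Γ A).append Δ) ((toIdFormers.idCtx Γ A').append Δ') →
    T.Derivable ((toIdFormers.idCtx Γ A).append Δ) (eqType C C') →
    T.Derivable Γ (eqTerm a a' A) → T.Derivable Γ (eqTerm b b' A) →
    T.Derivable Γ (eqTerm p p' (Id A a b)) →
    T.Derivable ((Γ.snoc A).append (Δ.subst (toIdFormers.diag A)))
      (eqTerm d d' (C.subst (Sub.lift m (toIdFormers.diag A)))) →
    T.Derivable (Γ.append (Δ.subst (Sub.inst₃ a b p)))
      (eqTerm (J A Δ C d a b p) (J A' Δ' C' d' a' b' p')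
        (C.subst (Sub.lift m (Sub.inst₃ a b p))))
  H_congr : ∀ {n m : ℕ} {Γ : Ctx S n} {A A' : Expr S n} {Δ Δ' : Tel S (n + 3) m}
    {C C' : Expr S (n + 3 + m)} {d d' : Expr S (n + 1 + m)} {a a' : Expr S n},
    T.CtxEq ((toIdFormers.idCtx Γ A).append Δ) ((toIdFormers.idCtx Γ A').append Δ') →
    T.Derivable ((toIdFormers.idCtx Γ A).append Δ) (eqType C C') →
    T.Derivable Γ (eqTerm a a' A) →
    T.Derivable ((Γ.snoc A).append (Δ.subst (toIdFormers.diag A)))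
      (eqTerm d d' (C.subst (Sub.lift m (toIdFormers.diag A)))) →
    T.Derivable (Γ.append (Δ.subst (Sub.inst₃ a a (r A a))))
      (eqTerm (H A Δ C d a) (H A' Δ' C' d' a')
        (Id (C.subst (Sub.lift m (Sub.inst₃ a a (r A a)))) (J A Δ C d a a (r A a))
          (d.subst (Sub.lift m (Sub.inst a)))))

/-! ### The classifying category -/

open TypeTheory

/-- Well-formed contexts of length `n`, up to definitional equality. -/
def ctxSetoid (T : TypeTheory S) (n : ℕ) : Setoid {Γ : Ctx S n // T.Valid Γ} where
  r Γ Γ' := T.CtxEq Γ.1 Γ'.1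
  iseqv :=
    { refl := fun Γ => CtxEq.refl Γ.2
      symm := fun {_ Γ'} h => CtxEq.symm Γ'.2 h
      trans := fun {Γ Γ' _} h h' => CtxEq.trans Γ.2 Γ'.2 h h' }

/-- The objects of the classifying category: equivalence classes of well-formed contexts. -/
structure ClassifyingCategory (T : TypeTheory S) : Type u where
  len : ℕ
  cls : Quotient (ctxSetoid T len)

namespace ClassifyingCategory

variable {T : TypeTheory S}

/-- The object given by a well-formed context. -/
def of {n : ℕ} (Γ : Ctx S n) (h : T.Valid Γ) : ClassifyingCategory T :=
  ⟨n, Quotient.mk (ctxSetoid T n) ⟨Γ, h⟩⟩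

theorem ind {P : ClassifyingCategory T → Prop}
    (h : ∀ {n : ℕ} (Γ : Ctx S n) (hΓ : T.Valid Γ), P (of Γ hΓ)) (X : ClassifyingCategory T) :
    P X := by
  obtain ⟨n, q⟩ := X
  induction q using Quotient.inductionOn with
  | h Γ => exact h Γ.1 Γ.2

/-- `t` is a sequence of terms of the types of `Y` in the context `X`. -/
def IsMor (X Y : ClassifyingCategory T) (t : Sub S Y.len X.len) : Prop :=
  Quotient.lift₂ (fun Δ Γ => T.IsCtxMor Δ.1 Γ.1 t)
    (fun Δ Γ Δ' Γ' eΔ eΓ => propext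
      ⟨IsCtxMor.congr Δ'.2 Γ.2 Γ'.2 eΔ eΓ,
        IsCtxMor.congr Δ.2 Γ'.2 Γ.2 (CtxEq.symm Δ'.2 eΔ) (CtxEq.symm Γ'.2 eΓ)⟩) X.cls Y.cls

/-- Definitional equality of sequences of terms of the types of `Y` in the context `X`. -/
def MorEq (X Y : ClassifyingCategory T) (s t : {t : Sub S Y.len X.len // IsMor X Y t}) : Prop :=
  Quotient.lift₂ (fun Δ Γ => T.CtxMorEq Δ.1 Γ.1 s.1 t.1)
    (fun Δ _ Δ' Γ' eΔ eΓ => propext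
      ⟨CtxMorEq.congr Δ.2 Δ'.2 eΔ eΓ,
        CtxMorEq.congr Δ'.2 Δ.2 (CtxEq.symm Δ'.2 eΔ) (CtxEq.symm Γ'.2 eΓ)⟩) X.cls Y.cls

theorem morEq_equivalence (X Y : ClassifyingCategory T) : Equivalence (MorEq X Y) := by
  induction X using ind with
  | h Δ hΔ =>
  induction Y using ind with
  | h Γ hΓ =>
  refine ⟨fun t => ?_, fun {s t} h => ?_, fun {r s t} h h' => ?_⟩
  · exact CtxMorEq.refl t.2
  · exact CtxMorEq.symm hΔ hΓ s.2 t.2 h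
  · exact CtxMorEq.trans hΔ hΓ s.2 t.2 h h'

/-- Sequences of terms up to definitional equality. -/
def morSetoid (X Y : ClassifyingCategory T) : Setoid {t : Sub S Y.len X.len // IsMor X Y t} :=
  ⟨MorEq X Y, morEq_equivalence X Y⟩

/-- The morphisms of the classifying category. -/
def Hom (X Y : ClassifyingCategory T) : Type u := Quotient (morSetoid X Y)

theorem isMor_id (X : ClassifyingCategory T) : IsMor X X (Sub.id S X.len) := by
  induction X using ind with
  | h Γ hΓ => exact isCtxMor_id hΓ

theorem isMor_comp {X Y Z : ClassifyingCategory T} {t : Sub S Y.len X.len} {r : Sub S Z.len Y.len}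
    (ht : IsMor X Y t) (hr : IsMor Y Z r) : IsMor X Z (r.comp t) := by
  induction X using ind with
  | h Δ hΔ =>
  induction Y using ind with
  | h Γ hΓ =>
  induction Z using ind with
  | h Θ hΘ => exact IsCtxMor.comp hΔ ht hr

theorem morEq_comp {X Y Z : ClassifyingCategory T} (t t' : {t : Sub S Y.len X.len // IsMor X Y t})
    (h : MorEq X Y t t') (r r' : {r : Sub S Z.len Y.len // IsMor Y Z r}) (h' : MorEq Y Z r r') :
    MorEq X Z ⟨r.1.comp t.1, isMor_comp t.2 r.2⟩ ⟨r'.1.comp t'.1, isMor_comp t'.2 r'.2⟩ := by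
  induction X using ind with
  | h Δ hΔ =>
  induction Y using ind with
  | h Γ hΓ =>
  induction Z using ind with
  | h Θ hΘ =>
  exact CtxMorEq.trans hΔ hΘ (IsCtxMor.comp hΔ t'.2 r.2) (IsCtxMor.comp hΔ t'.2 r'.2)
    (CtxMorEq.comp_left hΔ t.2 t'.2 h r.2) (CtxMorEq.comp_right hΔ t'.2 h')

/-- The morphism given by a sequence of terms. -/
def Hom.mk {X Y : ClassifyingCategory T} (t : Sub S Y.len X.len) (ht : IsMor X Y t) : Hom X Y :=
  Quotient.mk (morSetoid X Y) ⟨t, ht⟩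

/-- Composition is substitution. -/
def Hom.comp {X Y Z : ClassifyingCategory T} (f : Hom X Y) (g : Hom Y Z) : Hom X Z :=
  Quotient.map₂ (sa := morSetoid X Y) (sb := morSetoid Y Z) (sc := morSetoid X Z)
    (fun t r => ⟨r.1.comp t.1, isMor_comp t.2 r.2⟩)
    (fun t t' h r r' h' => morEq_comp t t' h r r' h') f g

instance : Category.{u} (ClassifyingCategory T) where
  Hom := Hom
  id X := Hom.mk (Sub.id S X.len) (isMor_id X)
  comp f g := Hom.comp f g
  id_comp f := by
    induction f using Quotient.inductionOn with
    | h t => exact congrArg (Quotient.mk _) (Subtype.ext (Sub.comp_id t.1))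
  comp_id f := by
    induction f using Quotient.inductionOn with
    | h t => rfl
  assoc f g h := by
    induction f using Quotient.inductionOn with
    | h t =>
    induction g using Quotient.inductionOn with
    | h r =>
    induction h using Quotient.inductionOn with
    | h q => exact congrArg (Quotient.mk _) (Subtype.ext (Sub.comp_assoc q.1 r.1 t.1).symm)

/-- The dependent projection `[Γ, Δ] ⟶ [Γ]`, dropping the final segment `Δ` of a context. -/
def proj {n m : ℕ} (Γ : Ctx S n) (Δ : Tel S n m) (h : T.Valid (Γ.append Δ)) :
    of (Γ.append Δ) h ⟶ of Γ (valid_of_append Δ h) :=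
  Hom.mk (X := of (Γ.append Δ) h) (Y := of Γ (valid_of_append Δ h))
    (fun i => Expr.var (Fin.castAdd m i)) (isCtxMor_proj Δ h)

/-- The class of dependent projections. -/
inductive IsDependentProjection : MorphismProperty (ClassifyingCategory T)
  | proj {n m : ℕ} (Γ : Ctx S n) (Δ : Tel S n m) (h : T.Valid (Γ.append Δ)) :
      IsDependentProjection (proj Γ Δ h)

variable (T) in
/-- Fibrations are the morphisms that are isomorphic to dependent projections. -/
def fibrations : MorphismProperty (ClassifyingCategory T) :=
  (IsDependentProjection (T := T)).isoClosure

end ClassifyingCategory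

/-! ### Path categories -/

section PathCategory

variable {C : Type u} [Category.{v} C]

/-- A path object on `B`: a factorisation of the diagonal `B ⟶ B × B` as a weak equivalence `r`
followed by a fibration `st`. -/
structure PathObject (Fib W : MorphismProperty C) (B : C) where
  prod : BinaryFan B B
  isLimit : IsLimit prod
  P : C
  r : B ⟶ P
  st : P ⟶ prod.pt
  weq : W r
  fib : Fib st
  fst_fac : r ≫ st ≫ prod.fst = 𝟙 B
  snd_fac : r ≫ st ≫ prod.snd = 𝟙 B

/-- The category `C` is a path category with the class `Fib` of fibrations and the class `W` of weak
equivalences. -/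
structure IsPathCategory (Fib W : MorphismProperty C) : Prop where
  fib_of_isIso : ∀ {X Y : C} (f : X ⟶ Y), IsIso f → Fib f
  fib_comp : ∀ {X Y Z : C} (f : X ⟶ Y) (g : Y ⟶ Z), Fib f → Fib g → Fib (f ≫ g)
  exists_pullback : ∀ {X Y Z : C} (p : X ⟶ Z) (f : Y ⟶ Z), Fib p → HasPullback f p
  fib_pullback : ∀ {P X Y Z : C} {q : P ⟶ Y} {g : P ⟶ X} {f : Y ⟶ Z} {p : X ⟶ Z},
    IsPullback q g f p → Fib p → Fib q
  hasTerminal : HasTerminal C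
  fib_terminal : ∀ {X Y : C} (_ : IsTerminal Y) (f : X ⟶ Y), Fib f
  weq_of_isIso : ∀ {X Y : C} (f : X ⟶ Y), IsIso f → W f
  two_out_of_six : ∀ {X Y Z V : C} (f : X ⟶ Y) (g : Y ⟶ Z) (h : Z ⟶ V),
    W (f ≫ g) → W (g ≫ h) → W f ∧ W g ∧ W h ∧ W (f ≫ g ≫ h)
  exists_pathObject : ∀ B : C, Nonempty (PathObject Fib W B)
  exists_section : ∀ {X Y : C} (p : X ⟶ Y), Fib p → W p → ∃ s : Y ⟶ X, s ≫ p = 𝟙 Y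
  weq_pullback : ∀ {P X Y Z : C} {q : P ⟶ Y} {g : P ⟶ X} {f : Y ⟶ Z} {p : X ⟶ Z},
    IsPullback q g f p → Fib p → W p → W q

end PathCategory

end DepTT

/-! The elimination rule targets a single type and computes only up to an identity proof, whereas a
fibration drops a whole telescope, and without Σ-types a telescope cannot be packed into one type.
The proof separates this difficulty from the syntax. It works with a class `D` of display maps (in
the application, one-variable context extensions) carrying identity objects whose reflexivity map
has the property `WeakExt`, also after base change and with a parameter fibration; the latter
reflects the context Δ in the elimination rule.

Homotopy is defined in the style of Leibniz (`HRel`): two maps into `E` over `B` are homotopic if no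
fibration distinguishes them. This needs no path objects, and it is visibly an equivalence relation
compatible with composition. The weak equivalences are the maps that become invertible modulo
homotopy over the terminal object. Hence two-out-of-six is inherited from isomorphisms, and if `p`
is a fibration with `g ≫ p` homotopic to the identity, transporting `g` along that homotopy gives a
strict section of `p`.

What remains is path objects and the pullback stability of acyclic fibrations. Elimination is
extended to telescopes one type at a time (`WeakExt.exists_section`): after the first type is
treated, the remaining data lie over a point that is only propositionally the right one, and they
are transported there; that transport is itself an elimination into a shorter telescope.
`WeakExt.exists_section_lift` is the matching computation rule, in Leibniz form. From these it
follows that the endpoints of a path are homotopic, that transport moves a point to a homotopic one,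
and that paths with fixed source form a contractible space (`IdObj.hRel_src_r`).

Path objects of a composite `E ⟶ A ⟶ B` are then built by induction (`FibN.exists_pathObject`): a
path is a path in `A` together with a path over `A` from the transported starting point to the end
point. Since they contract onto the source, every acyclic fibration is a fibrewise deformation
retraction (`exists_section_hRel`), a property that survives pullback.

For the classifying category, `weakExt_lift_diag` derives the weak extension property from the
elimination and computation rules, stability of the constructors under substitution gives base
change (`isPullback_idCtx`, `isPullback_diag`), and `fib_display` identifies the two notions of
fibration. -/

namespace DepTT

/-! ### Display maps, weak identity types, and elimination into composites of display maps -/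

section DisplayMaps

variable {C : Type u} [Category.{v} C]

/-- Composites of `n` maps in the class `D`, up to isomorphism. -/
def FibN (D : MorphismProperty C) : ℕ → MorphismProperty C
  | 0 => fun _ _ f => IsIso f
  | n + 1 => fun X Y f => ∃ (Z : C) (p : X ⟶ Z) (d : Z ⟶ Y), FibN D n p ∧ D d ∧ p ≫ d = f

/-- Finite composites of maps in the class `D`, up to isomorphism. -/
def Fib (D : MorphismProperty C) : MorphismProperty C := fun _ _ f => ∃ n, FibN D n f

/-- A weak extension property of `i : U ⟶ V`: for a display map `E ⟶ V`, every section over `U`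
extends to `V`, up to a homotopy in the sense of Leibniz. -/
def WeakExt (D : MorphismProperty C) {U V : C} (i : U ⟶ V) : Prop :=
  ∀ ⦃E : C⦄ (π : E ⟶ V) (c : U ⟶ E), D π → c ≫ π = i →
    ∃ j : V ⟶ E, j ≫ π = 𝟙 V ∧
      ∃ (Q : C) (a : Q ⟶ U) (b : Q ⟶ E) (QQ : C) (q₁ q₂ : QQ ⟶ Q),
        IsPullback a b i π ∧ IsPullback q₁ q₂ a a ∧
        ∀ ⦃F : C⦄ (φ : F ⟶ QQ) (ρ : Q ⟶ F), D φ → ρ ≫ φ ≫ q₁ = 𝟙 Q → ρ ≫ φ ≫ q₂ = 𝟙 Q →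
          ∃ l : U ⟶ F, l ≫ φ ≫ q₁ ≫ a = 𝟙 U ∧ l ≫ φ ≫ q₁ ≫ b = i ≫ j ∧ l ≫ φ ≫ q₂ ≫ b = c

/-- A weak identity type on a display map `d : A ⟶ Γ`, with parameters and stable under base change. -/
structure IdObj (D : MorphismProperty C) {A Γ : C} (d : A ⟶ Γ) where
  AA : C
  I : C
  pr₁ : AA ⟶ A
  pr₂ : AA ⟶ A
  st : I ⟶ AA
  r : A ⟶ I
  isPullback : IsPullback pr₁ pr₂ d d
  disp : D st
  r_fst : r ≫ st ≫ pr₁ = 𝟙 A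
  r_snd : r ≫ st ≫ pr₂ = 𝟙 A
  weakExt : ∀ {X K E U : C} {x : X ⟶ Γ} {k₁ : K ⟶ X} {k₂ : K ⟶ I} {δ : E ⟶ K} {w : U ⟶ A} {i : U ⟶ E},
    IsPullback k₁ k₂ x (st ≫ pr₁ ≫ d) → Fib D δ → IsPullback w i r (δ ≫ k₂) → WeakExt D i

/-- A class of display maps with weak identity types. -/
class IsDisplayClass (D : MorphismProperty C) : Prop where
  respectsIso : D.RespectsIso
  exists_pullback : ∀ {A Γ Δ : C} (d : A ⟶ Γ) (σ : Δ ⟶ Γ), D d →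
    ∃ (A' : C) (d' : A' ⟶ Δ) (σ' : A' ⟶ A), IsPullback d' σ' σ d ∧ D d'
  exists_idObj : ∀ {A Γ : C} (d : A ⟶ Γ), D d → Nonempty (IdObj D d)

attribute [instance] IsDisplayClass.respectsIso

variable {D : MorphismProperty C}

theorem FibN.respectsIso [D.RespectsIso] : ∀ n : ℕ, (FibN D n).RespectsIso
  | 0 => MorphismProperty.RespectsIso.mk _ (fun e f (hf : IsIso f) => (inferInstance : IsIso (e.hom ≫ f)))
      (fun e f (hf : IsIso f) => (inferInstance : IsIso (f ≫ e.hom)))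
  | n + 1 => by
    have := FibN.respectsIso n
    refine MorphismProperty.RespectsIso.mk _ ?_ ?_
    · rintro X Y Z e f ⟨W, p, d, hp, hd, rfl⟩
      exact ⟨W, e.hom ≫ p, d, (FibN D n).cancel_left_of_respectsIso _ _ |>.2 hp, hd, by simp⟩
    · rintro X Y Z e f ⟨W, p, d, hp, hd, rfl⟩
      exact ⟨W, p, d ≫ e.hom, hp, D.cancel_right_of_respectsIso _ _ |>.2 hd, by simp⟩

theorem FibN.comp [D.RespectsIso] {n : ℕ} {X Y : C} {f : X ⟶ Y} (hf : FibN D n f) :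
    ∀ {m : ℕ} {Z : C} {g : Y ⟶ Z}, FibN D m g → FibN D (n + m) (f ≫ g)
  | 0, Z, g, hg => by
    have := FibN.respectsIso (D := D) n
    have : IsIso g := hg
    exact ((FibN D n).cancel_right_of_respectsIso _ _).2 hf
  | m + 1, Z, g, ⟨W, p, d, hp, hd, e⟩ =>
    ⟨W, f ≫ p, d, FibN.comp hf hp, hd, by rw [← e, Category.assoc]⟩

theorem FibN.of_disp {X Y : C} {f : X ⟶ Y} (h : D f) : FibN D 1 f :=
  ⟨X, 𝟙 X, f, (inferInstance : IsIso (𝟙 X)), h, Category.id_comp f⟩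

/-- The definition of `FibN` splits off a display map at the target. Contexts grow at the source of
their projection, so the comparison with telescopes needs the splitting at that end. -/
theorem FibN.exists_fac : ∀ {n : ℕ} {X Y : C} {f : X ⟶ Y}, [D.RespectsIso] → FibN D (n + 1) f →
    ∃ (Z : C) (d : X ⟶ Z) (p : Z ⟶ Y), D d ∧ FibN D n p ∧ d ≫ p = f
  | 0, X, Y, f, _, ⟨Z, p, d, hp, hd, e⟩ => by
    have : IsIso p := hp
    exact ⟨Y, f, 𝟙 Y, e ▸ (D.cancel_left_of_respectsIso p d).2 hd, (inferInstance : IsIso (𝟙 Y)), by simp⟩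
  | n + 1, X, Y, f, _, ⟨Z, p, d, hp, hd, e⟩ => by
    obtain ⟨W, d', p', hd', hp', e'⟩ := FibN.exists_fac hp
    exact ⟨W, d', p' ≫ d, hd', ⟨Z, p', d, hp', hd, rfl⟩, by rw [← e, ← e', Category.assoc]⟩

theorem Fib.of_isIso {X Y : C} (f : X ⟶ Y) [h : IsIso f] : Fib D f := ⟨0, h⟩

theorem Fib.of_disp {X Y : C} {f : X ⟶ Y} (h : D f) : Fib D f := ⟨1, FibN.of_disp h⟩

theorem Fib.comp [D.RespectsIso] {X Y Z : C} {f : X ⟶ Y} {g : Y ⟶ Z} (hf : Fib D f) (hg : Fib D g) :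
    Fib D (f ≫ g) :=
  let ⟨_, hn⟩ := hf
  let ⟨_, hm⟩ := hg
  ⟨_, hn.comp hm⟩


variable [IsDisplayClass D]

theorem disp_of_isPullback {P A Γ Δ : C} {d : A ⟶ Γ} {σ : Δ ⟶ Γ} {d' : P ⟶ Δ} {σ' : P ⟶ A}
    (h : IsPullback d' σ' σ d) (hd : D d) : D d' := by
  obtain ⟨A', e, t, h', he⟩ := IsDisplayClass.exists_pullback d σ hd
  rw [← IsPullback.isoIsPullback_hom_fst _ _ h h']
  exact (D.cancel_left_of_respectsIso _ _).2 he

theorem FibN.exists_pullback : ∀ {n : ℕ} {E B : C} {p : E ⟶ B}, FibN D n p → ∀ {B' : C} (f : B' ⟶ B),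
    ∃ (E' : C) (p' : E' ⟶ B') (f' : E' ⟶ E), IsPullback p' f' f p ∧ FibN D n p'
  | 0, E, B, p, hp, B', f => by
    have : IsIso p := hp
    exact ⟨B', 𝟙 B', f ≫ inv p, IsPullback.of_horiz_isIso ⟨by simp⟩, (inferInstance : IsIso (𝟙 B'))⟩
  | n + 1, E, B, p, ⟨Z, q, d, hq, hd, e⟩, B', f => by
    obtain ⟨Z', d', f', h, hd'⟩ := IsDisplayClass.exists_pullback d f hd
    obtain ⟨E', q', f'', h', hq'⟩ := FibN.exists_pullback hq f'
    exact ⟨E', q' ≫ d', f'', e ▸ h'.paste_horiz h, Z', q', d', hq', hd', rfl⟩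

theorem FibN.of_isPullback {n : ℕ} {P E B B' : C} {p : E ⟶ B} {f : B' ⟶ B} {p' : P ⟶ B'} {f' : P ⟶ E}
    (h : IsPullback p' f' f p) (hp : FibN D n p) : FibN D n p' := by
  have := FibN.respectsIso (D := D) n
  obtain ⟨E', q, g, h', hq⟩ := hp.exists_pullback f
  rw [← IsPullback.isoIsPullback_hom_fst _ _ h h']
  exact ((FibN D n).cancel_left_of_respectsIso _ _).2 hq

theorem Fib.exists_pullback {E B : C} {p : E ⟶ B} (hp : Fib D p) {B' : C} (f : B' ⟶ B) :
    ∃ (E' : C) (p' : E' ⟶ B') (f' : E' ⟶ E), IsPullback p' f' f p ∧ Fib D p' :=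
  let ⟨_, hn⟩ := hp
  let ⟨E', p', f', h, hp'⟩ := hn.exists_pullback f
  ⟨E', p', f', h, _, hp'⟩

theorem Fib.of_isPullback {P E B B' : C} {p : E ⟶ B} {f : B' ⟶ B} {p' : P ⟶ B'} {f' : P ⟶ E}
    (h : IsPullback p' f' f p) (hp : Fib D p) : Fib D p' :=
  let ⟨_, hn⟩ := hp
  ⟨_, hn.of_isPullback h⟩

/-- A map with the weak extension property has it for all fibrations. -/
theorem WeakExt.exists_section {n : ℕ} : ∀ {U V E : C} {i : U ⟶ V} {π : E ⟶ V} {c : U ⟶ E},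
    WeakExt D i → FibN D n π → c ≫ π = i → ∃ j : V ⟶ E, j ≫ π = 𝟙 V := by
  induction n with
  | zero =>
    intro U V E i π c _ hπ _
    have : IsIso π := hπ
    exact ⟨inv π, by simp⟩
  | succ n ih =>
    rintro U V E i π c hi ⟨E₁, p, e, hp, he, rfl⟩ hc
    -- Extend along the display map next to the base only. Then `i ≫ j` and `c ≫ p` agree merely up
    -- to homotopy, so `c` does not yet lie over `j`.
    obtain ⟨j, hj, Q, a, b, QQ, q₁, q₂, hQ, hQQ, hF⟩ := hi e (c ≫ p) he (by simpa using hc)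
    obtain ⟨N⟩ := IsDisplayClass.exists_idObj a (disp_of_isPullback hQ he)
    let w := N.isPullback.isoIsPullback _ _ hQQ
    have w₁ : w.hom ≫ q₁ = N.pr₁ := IsPullback.isoIsPullback_hom_fst _ _ _ _
    have w₂ : w.hom ≫ q₂ = N.pr₂ := IsPullback.isoIsPullback_hom_snd _ _ _ _
    -- The Leibniz clause, applied to the identity object of `Q ⟶ U`, produces an actual path `l`
    -- from `i ≫ j` to `c ≫ p`.
    obtain ⟨l, hl₁, hl₂, hl₃⟩ := hF (N.st ≫ w.hom) N.r ((D.cancel_right_of_respectsIso _ _).2 N.disp)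
      (by simp [w₁, N.r_fst]) (by simp [w₂, N.r_snd])
    simp only [Category.assoc, reassoc_of% w₁, reassoc_of% w₂] at hl₁ hl₂ hl₃
    -- Setting for backward transport: `D₀` consists of a path and a point of `G` over its target,
    -- and `C₀` adds a point of `G` over its source.
    obtain ⟨G, g, g', hG, hg⟩ := hp.exists_pullback b
    obtain ⟨D₀, δ, δ', hD₀, hδ⟩ := hg.exists_pullback (N.st ≫ N.pr₂)
    obtain ⟨C₀, γ, γ', hC₀, hγ⟩ := hg.exists_pullback (δ ≫ N.st ≫ N.pr₁)
    obtain ⟨U₁, k₁, k₂, hU₁, -⟩ := hδ.exists_pullback N.r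
    -- `k₂` is the restriction of `D₀` to constant paths, with the point over the target as
    -- parameter. There source and target coincide, so the point can be copied; the induction
    -- hypothesis for `k₂` extends this to a transport map `j₀`.
    have hi₁ : WeakExt D k₂ := N.weakExt (x := 𝟙 U) (k₁ := N.st ≫ N.pr₁ ≫ a) (k₂ := 𝟙 _) (δ := δ)
      (IsPullback.id_vert _) ⟨n, hδ⟩ (by simpa using hU₁)
    obtain ⟨c₀, hc₀, -⟩ := hC₀.exists_lift k₂ (k₂ ≫ δ') (by
      have := hU₁.w; have := hD₀.w; have := N.r_fst; have := N.r_snd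
      clear ih hi hi₁ hF
      grind)
    obtain ⟨j₀, hj₀⟩ := ih hi₁ hγ hc₀
    -- Transporting `c` along `l` puts it strictly over `i ≫ j`. The induction hypothesis then
    -- applies to `i` and the restriction of `p` along `j`.
    obtain ⟨g₁, hg₁, hg₁'⟩ := hG.exists_lift (l ≫ N.st ≫ N.pr₂) c (by clear ih hi hi₁ hF; grind)
    obtain ⟨l', hl', hl''⟩ := hD₀.exists_lift l g₁ (by clear ih hi hi₁ hF; grind)
    obtain ⟨V', v, v', hV, hv⟩ := hp.exists_pullback j
    obtain ⟨c', hc', -⟩ := hV.exists_lift i (l' ≫ j₀ ≫ γ' ≫ g') (by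
      simp only [Category.assoc, ← hG.w, ← reassoc_of% hC₀.w, reassoc_of% hj₀, reassoc_of% hl', hl₂])
    obtain ⟨j', hj'⟩ := ih hi hv hc'
    refine ⟨j' ≫ v', ?_⟩
    have := hV.w
    clear ih hi hi₁ hF
    grind

end DisplayMaps
end DepTT
namespace DepTT

/-! ### Homotopy in the sense of Leibniz -/

section Homotopy

variable {C : Type u} [Category.{v} C] (D : MorphismProperty C)

/-- The maps `f g : X ⟶ E` over `B` are related if, for every fibration over `X' ×_B E`, sections over
the graph of `f` give sections over the graph of `g`, for all `X' ⟶ X`. -/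
def TransportRel {X E B : C} (q : E ⟶ B) (f g : X ⟶ E) : Prop :=
  f ≫ q = g ≫ q ∧ ∀ ⦃X' Z F : C⦄ (h : X' ⟶ X) (a : Z ⟶ X') (b : Z ⟶ E) (φ : F ⟶ Z),
    IsPullback a b (h ≫ f ≫ q) q → Fib D φ → ∀ σ : X' ⟶ F, σ ≫ φ ≫ a = 𝟙 X' → σ ≫ φ ≫ b = h ≫ f →
      ∃ σ' : X' ⟶ F, σ' ≫ φ ≫ a = 𝟙 X' ∧ σ' ≫ φ ≫ b = h ≫ g

/-- Fibrewise homotopy, in the sense of Leibniz: fibrations do not distinguish `f` and `g`. -/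
def HRel {X E B : C} (q : E ⟶ B) (f g : X ⟶ E) : Prop := TransportRel D q f g ∧ TransportRel D q g f

variable {D}

theorem TransportRel.refl {X E B : C} (q : E ⟶ B) (f : X ⟶ E) : TransportRel D q f f :=
  ⟨rfl, fun _ _ _ _ _ _ _ _ _ σ h₁ h₂ => ⟨σ, h₁, h₂⟩⟩

theorem TransportRel.trans {X E B : C} {q : E ⟶ B} {f g h : X ⟶ E} (H : TransportRel D q f g)
    (K : TransportRel D q g h) : TransportRel D q f h := by
  refine ⟨H.1.trans K.1, fun X' Z F k a b φ hZ hφ σ h₁ h₂ => ?_⟩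
  obtain ⟨σ', h₁', h₂'⟩ := H.2 k a b φ hZ hφ σ h₁ h₂
  rw [H.1] at hZ
  exact K.2 k a b φ hZ hφ σ' h₁' h₂'

theorem TransportRel.precomp {X Y E B : C} {q : E ⟶ B} {f g : X ⟶ E} (H : TransportRel D q f g)
    (k : Y ⟶ X) : TransportRel D q (k ≫ f) (k ≫ g) := by
  refine ⟨by rw [Category.assoc, H.1, Category.assoc], fun X' Z F h a b φ hZ hφ σ h₁ h₂ => ?_⟩
  obtain ⟨σ', h₁', h₂'⟩ := H.2 (h ≫ k) a b φ (by simpa using hZ) hφ σ h₁ (by simpa using h₂)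
  exact ⟨σ', h₁', by simpa using h₂'⟩

/-- `X' ×_{B'} E'` is also `X' ×_B E`, so both relations quantify over the same fibrations. Testing
only against fibrations over `E` itself would not allow this argument. -/
theorem TransportRel.of_isPullback {X E B E' B' : C} {q : E ⟶ B} {q' : E' ⟶ B'} {e : E' ⟶ E}
    {β : B' ⟶ B} (hE : IsPullback q' e β q) {f g : X ⟶ E'} (hfg : f ≫ q' = g ≫ q')
    (H : TransportRel D q (f ≫ e) (g ≫ e)) : TransportRel D q' f g := by
  refine ⟨hfg, fun X' Z F h a b φ hZ hφ σ h₁ h₂ => ?_⟩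
  have hZ' : IsPullback a (b ≫ e) (h ≫ (f ≫ e) ≫ q) q := by
    have := hZ.paste_vert hE
    simpa [hE.w] using this
  obtain ⟨σ', h₁', h₂'⟩ := H.2 h a (b ≫ e) φ hZ' hφ σ h₁ (by simpa using h₂ =≫ e)
  refine ⟨σ', h₁', hE.hom_ext ?_ (by simpa using h₂')⟩
  simp only [Category.assoc, ← hZ.w, ← hfg, reassoc_of% h₁']

theorem HRel.refl {X E B : C} (q : E ⟶ B) (f : X ⟶ E) : HRel D q f f :=
  ⟨TransportRel.refl q f, TransportRel.refl q f⟩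

theorem HRel.symm {X E B : C} {q : E ⟶ B} {f g : X ⟶ E} (H : HRel D q f g) : HRel D q g f :=
  ⟨H.2, H.1⟩

theorem HRel.trans {X E B : C} {q : E ⟶ B} {f g h : X ⟶ E} (H : HRel D q f g) (K : HRel D q g h) :
    HRel D q f h :=
  ⟨H.1.trans K.1, K.2.trans H.2⟩

theorem HRel.precomp {X Y E B : C} {q : E ⟶ B} {f g : X ⟶ E} (H : HRel D q f g) (k : Y ⟶ X) :
    HRel D q (k ≫ f) (k ≫ g) :=
  ⟨H.1.precomp k, H.2.precomp k⟩

theorem HRel.of_isPullback {X E B E' B' : C} {q : E ⟶ B} {q' : E' ⟶ B'} {e : E' ⟶ E} {β : B' ⟶ B}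
    (hE : IsPullback q' e β q) {f g : X ⟶ E'} (hfg : f ≫ q' = g ≫ q')
    (H : HRel D q (f ≫ e) (g ≫ e)) : HRel D q' f g :=
  ⟨H.1.of_isPullback hE hfg, H.2.of_isPullback hE hfg.symm⟩

variable [IsDisplayClass D]

/-- A fibration over `X' ×_{B'} E'` is pulled back to `X' ×_B E` along the map induced by `m`. That
`q` is a fibration guarantees that the second fibre product exists. -/
theorem TransportRel.map {X E B E' B' : C} {q : E ⟶ B} {f g : X ⟶ E} (H : TransportRel D q f g)
    (hq : Fib D q) {q' : E' ⟶ B'} (m : E ⟶ E') (β : B ⟶ B') (hm : m ≫ q' = q ≫ β) :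
    TransportRel D q' (f ≫ m) (g ≫ m) := by
  refine ⟨by simp only [Category.assoc, hm, reassoc_of% H.1], fun X' Z F h a b φ hZ hφ σ h₁ h₂ => ?_⟩
  obtain ⟨Z₀, a₀, b₀, hZ₀, -⟩ := hq.exists_pullback (h ≫ f ≫ q)
  obtain ⟨z, hz, hz'⟩ := hZ.exists_lift a₀ (b₀ ≫ m) (by
    simp only [Category.assoc, hm, ← reassoc_of% hZ₀.w])
  obtain ⟨F₀, φ₀, z', hF₀, hφ₀⟩ := hφ.exists_pullback z
  obtain ⟨x, hx, hx'⟩ := hZ₀.exists_lift (𝟙 X') (h ≫ f) (by simp)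
  obtain ⟨σ₀, hσ₀, hσ₀'⟩ := hF₀.exists_lift x σ (hZ.hom_ext (by simp [hz, hx, h₁])
    (by simp [hz', reassoc_of% hx', h₂]))
  obtain ⟨σ', h₁', h₂'⟩ := H.2 h a₀ b₀ φ₀ hZ₀ hφ₀ σ₀ (by simp [reassoc_of% hσ₀, hx])
    (by simp [reassoc_of% hσ₀, hx'])
  exact ⟨σ' ≫ z', by simp [← reassoc_of% hF₀.w, hz, h₁'], by
    simp [reassoc_of% h₂', hz', ← reassoc_of% hF₀.w]⟩

/-- Transport in a fibration over `W ×_B E`. -/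
theorem TransportRel.exists_lift {X E B : C} {q : E ⟶ B} {f g : X ⟶ E} (H : TransportRel D q f g)
    (hq : Fib D q) {W Z F : C} {w : W ⟶ B} {a : Z ⟶ W} {b : Z ⟶ E} (hZ : IsPullback a b w q)
    {φ : F ⟶ Z} (hφ : Fib D φ) (σ : X ⟶ F) (hσ : σ ≫ φ ≫ b = f) :
    ∃ σ' : X ⟶ F, σ' ≫ φ ≫ a = σ ≫ φ ≫ a ∧ σ' ≫ φ ≫ b = g := by
  have e : f ≫ q = (σ ≫ φ ≫ a) ≫ w := by simp only [Category.assoc, hZ.w, ← hσ]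
  obtain ⟨Z₀, a₀, b₀, hZ₀, -⟩ := hq.exists_pullback (f ≫ q)
  -- Freeze the component in `W` at its value on `σ` and let only the component in `E` vary.
  obtain ⟨z, hz, hz'⟩ := hZ.exists_lift (a₀ ≫ σ ≫ φ ≫ a) b₀ (by
    rw [← hZ₀.w, e, Category.assoc])
  obtain ⟨F₀, φ₀, z', hF₀, hφ₀⟩ := hφ.exists_pullback z
  obtain ⟨x, hx, hx'⟩ := hZ₀.exists_lift (𝟙 X) f (by simp)
  obtain ⟨σ₀, hσ₀, hσ₀'⟩ := hF₀.exists_lift x σ (hZ.hom_ext (by simp [hz, reassoc_of% hx])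
    (by simp [hz', hx', hσ]))
  obtain ⟨σ', h₁', h₂'⟩ := H.2 (𝟙 X) a₀ b₀ φ₀ (by simpa using hZ₀) hφ₀ σ₀
    (by simp [reassoc_of% hσ₀, hx]) (by simp [reassoc_of% hσ₀, hx'])
  exact ⟨σ' ≫ z', by simp [← reassoc_of% hF₀.w, hz, reassoc_of% h₁'], by
    simp [h₂', hz', ← reassoc_of% hF₀.w]⟩

/-- Transport in a fibration over `E`. -/
theorem TransportRel.exists_lift_self {X E B : C} {q : E ⟶ B} {f g : X ⟶ E}
    (H : TransportRel D q f g) (hq : Fib D q) {F : C} {φ : F ⟶ E} (hφ : Fib D φ) (σ : X ⟶ F)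
    (hσ : σ ≫ φ = f) : ∃ σ' : X ⟶ F, σ' ≫ φ = g := by
  obtain ⟨σ', -, h⟩ := H.exists_lift hq (IsPullback.id_vert q) hφ σ (by simpa using hσ)
  exact ⟨σ', by simpa using h⟩

theorem HRel.map {X E B E' B' : C} {q : E ⟶ B} {f g : X ⟶ E} (H : HRel D q f g) (hq : Fib D q)
    {q' : E' ⟶ B'} (m : E ⟶ E') (β : B ⟶ B') (hm : m ≫ q' = q ≫ β) : HRel D q' (f ≫ m) (g ≫ m) :=
  ⟨H.1.map hq m β hm, H.2.map hq m β hm⟩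

theorem HRel.of_comp {X E B B' : C} {q : E ⟶ B} {f g : X ⟶ E} (H : HRel D q f g) (hq : Fib D q)
    (β : B ⟶ B') : HRel D (q ≫ β) f g := by
  simpa using H.map hq (q' := q ≫ β) (𝟙 E) β (by simp)

end Homotopy
end DepTT
namespace DepTT

/-! ### Path induction into fibrations, and paths as homotopies -/

section IdentityTypes

variable {C : Type u} [Category.{v} C] {D : MorphismProperty C}

namespace IdObj

variable {A Γ : C} {d : A ⟶ Γ} (N : IdObj D d)

theorem condition : N.st ≫ N.pr₂ ≫ d = N.st ≫ N.pr₁ ≫ d := by rw [N.isPullback.w]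

theorem weakExt_r : WeakExt D N.r :=
  N.weakExt (x := 𝟙 Γ) (k₁ := N.st ≫ N.pr₁ ≫ d) (k₂ := 𝟙 _) (δ := 𝟙 _) (w := 𝟙 _)
    (IsPullback.id_vert _) (Fib.of_isIso _) (by simpa using IsPullback.of_id_fst)

variable [IsDisplayClass D]

theorem fib_src (hd : D d) : Fib D (N.st ≫ N.pr₁) :=
  (Fib.of_disp N.disp).comp (Fib.of_disp (disp_of_isPullback N.isPullback hd))

/-- Elimination into fibrations, with parameters. -/
theorem elim (hd : D d) {X K E G : C} {x : X ⟶ Γ} {k₁ : K ⟶ X} {k₂ : K ⟶ N.I}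
    (hK : IsPullback k₁ k₂ x (N.st ≫ N.pr₁ ≫ d)) {δ : E ⟶ K} (hδ : Fib D δ) {π : G ⟶ E}
    (hπ : Fib D π) (hc : ∀ {U : C} (w : U ⟶ A) (i : U ⟶ E), i ≫ δ ≫ k₂ = w ≫ N.r →
      ∃ c : U ⟶ G, c ≫ π = i) : ∃ j : E ⟶ G, j ≫ π = 𝟙 E := by
  obtain ⟨Y, y₁, y₂, hY, -⟩ := IsDisplayClass.exists_pullback d x hd
  obtain ⟨ρ, hρ₁, hρ₂⟩ := hK.exists_lift y₁ (y₂ ≫ N.r) (by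
    simp only [Category.assoc, reassoc_of% N.r_fst, hY.w])
  -- The constant paths in `K` form `X ×_Γ A`; their preimage `U` in `E` is therefore a pullback of
  -- `N.r`, as `weakExt` demands.
  have hρ : IsPullback ρ y₂ k₂ N.r := by
    refine IsPullback.of_right (h₁₂ := k₁) (v₁₃ := x) (h₂₂ := N.st ≫ N.pr₁ ≫ d) ?_ hρ₂ hK
    rw [hρ₁, reassoc_of% N.r_fst]
    exact hY
  obtain ⟨U, v, i, hU, -⟩ := hδ.exists_pullback ρ
  have hi := hU.paste_horiz hρ.flip
  obtain ⟨c, hc⟩ := hc _ i hi.w.symm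
  obtain ⟨n, hn⟩ := hπ
  exact (N.weakExt hK hδ hi).exists_section hn hc

/-- `s` and `t` stand for the two endpoint maps in either order, so one path induction serves both
directions of transport. The given point over `s` is a parameter, and over a constant path, where
`s` and `t` agree, it is returned unchanged. -/
theorem transportRel_aux (hd : D d) {s t : N.I ⟶ A} (hs : s ≫ d = N.st ≫ N.pr₁ ≫ d)
    (ht : t ≫ d = N.st ≫ N.pr₁ ≫ d) (hrs : N.r ≫ s = 𝟙 A) (hrt : N.r ≫ t = 𝟙 A) :
    TransportRel D d s t := by
  refine ⟨hs.trans ht.symm, fun X' Z F h a b φ hZ hφ σ h₁ h₂ => ?_⟩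
  obtain ⟨K, k₁, k₂, hK, -⟩ := ((N.fib_src hd).comp (Fib.of_disp hd)).exists_pullback (h ≫ s ≫ d)
  rw [Category.assoc] at hK
  obtain ⟨zs, hzs, hzs'⟩ := hZ.exists_lift k₁ (k₂ ≫ s) (by rw [hK.w, Category.assoc, hs])
  obtain ⟨zt, hzt, hzt'⟩ := hZ.exists_lift k₁ (k₂ ≫ t) (by rw [hK.w, Category.assoc, ht])
  -- `E` consists of a path together with a point of `F` over `s`; `G` adds a point of `F` over `t`.
  obtain ⟨E, δ, δ', hE, hδ⟩ := hφ.exists_pullback zs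
  obtain ⟨G, γ, γ', hG, hγ⟩ := hφ.exists_pullback (δ ≫ zt)
  obtain ⟨j, hj⟩ := N.elim hd hK hδ hγ (fun {U} w i hi => by
    obtain ⟨c, hc, -⟩ := hG.exists_lift i (i ≫ δ') (by
      rw [Category.assoc, ← hE.w]
      refine hZ.hom_ext (by simp [hzs, hzt]) ?_
      simp only [Category.assoc, hzs', hzt', reassoc_of% hi, hrs, hrt])
    exact ⟨c, hc⟩)
  obtain ⟨x, hx, hx'⟩ := hK.exists_lift (𝟙 X') h (by simp [hs])
  obtain ⟨e, he, -⟩ := hE.exists_lift x σ (hZ.hom_ext (by simp [hzs, hx, h₁])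
    (by simp [hzs', reassoc_of% hx', h₂]))
  refine ⟨e ≫ j ≫ γ', ?_, ?_⟩
  · simp only [Category.assoc, ← reassoc_of% hG.w, reassoc_of% hj, reassoc_of% he, hzt, hx]
  · simp only [Category.assoc, ← reassoc_of% hG.w, reassoc_of% hj, reassoc_of% he, hzt',
      reassoc_of% hx']

/-- The endpoints of a path are homotopic. -/
theorem hRel_endpoints (hd : D d) : HRel D d (N.st ≫ N.pr₁) (N.st ≫ N.pr₂) :=
  ⟨N.transportRel_aux hd (by simp) (by simp [N.condition]) N.r_fst N.r_snd,
    N.transportRel_aux hd (by simp [N.condition]) (by simp) N.r_snd N.r_fst⟩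

theorem hRel_of_lift (hd : D d) {X : C} {f g : X ⟶ A} (l : X ⟶ N.I) (hf : l ≫ N.st ≫ N.pr₁ = f)
    (hg : l ≫ N.st ≫ N.pr₂ = g) : HRel D d f g := by
  subst hf hg
  exact (N.hRel_endpoints hd).precomp l

end IdObj

variable [IsDisplayClass D]

/-- The weak extension property for a fibration `E ⟶ V`, together with a lift of the restriction of the
extended section to a fibration over the pullback of `E`. -/
theorem WeakExt.exists_section_lift {n : ℕ} : ∀ {U V E Q F : C} {i : U ⟶ V} {π : E ⟶ V} {a : Q ⟶ U}
    {b : Q ⟶ E} {φ : F ⟶ Q} {σ : U ⟶ F}, WeakExt D i → FibN D n π → IsPullback a b i π → Fib D φ →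
    σ ≫ φ ≫ a = 𝟙 U → ∃ j : V ⟶ E, j ≫ π = 𝟙 V ∧
      ∃ σ' : U ⟶ F, σ' ≫ φ ≫ a = 𝟙 U ∧ σ' ≫ φ ≫ b = i ≫ j := by
  induction n with
  | zero =>
    intro U V E Q F i π a b φ σ _ hπ hQ _ hσ
    have : IsIso π := hπ
    refine ⟨inv π, by simp, σ, hσ, ?_⟩
    rw [← cancel_mono π]
    simp only [Category.assoc, ← hQ.w, reassoc_of% hσ, IsIso.inv_hom_id, Category.comp_id]
  | succ n ih =>
    rintro U V E Q F i π a b φ σ hi ⟨E₁, p, e, hp, he, rfl⟩ hQ hφ hσ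
    obtain ⟨j, hj, Q₁, a₁, b₁, QQ, q₁, q₂, hQ₁, hQQ, hF⟩ := hi e (σ ≫ φ ≫ b ≫ p) he (by
      simp only [Category.assoc, ← hQ.w, reassoc_of% hσ])
    have ha₁ := disp_of_isPullback hQ₁ he
    obtain ⟨N⟩ := IsDisplayClass.exists_idObj a₁ ha₁
    let w := N.isPullback.isoIsPullback _ _ hQQ
    have w₁ : w.hom ≫ q₁ = N.pr₁ := IsPullback.isoIsPullback_hom_fst _ _ _ _
    have w₂ : w.hom ≫ q₂ = N.pr₂ := IsPullback.isoIsPullback_hom_snd _ _ _ _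
    obtain ⟨l, hl₁, hl₂, hl₃⟩ := hF (N.st ≫ w.hom) N.r ((D.cancel_right_of_respectsIso _ _).2 N.disp)
      (by simp [w₁, N.r_fst]) (by simp [w₂, N.r_snd])
    simp only [Category.assoc, reassoc_of% w₁, reassoc_of% w₂] at hl₁ hl₂ hl₃
    obtain ⟨m, hm, hm'⟩ := hQ₁.exists_lift a (b ≫ p) (by simpa using hQ.w)
    have hQm : IsPullback m b b₁ p :=
      IsPullback.of_right (h₁₂ := a₁) (v₁₃ := i) (h₂₂ := e) (by rw [hm]; exact hQ) hm' hQ₁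
    -- Viewed over `Q₁`, a point of `F` carries its component in `E` along. Transport from `c ≫ p`
    -- to `i ≫ j`, where `c` is `σ ≫ φ ≫ b`, thus corrects that component and the lift
    -- simultaneously.
    have hφm : Fib D (φ ≫ m) := hφ.comp ⟨n, hp.of_isPullback hQm⟩
    obtain ⟨σ₀, hσ₀⟩ := (N.hRel_of_lift ha₁ l rfl rfl).2.exists_lift_self (Fib.of_disp ha₁) hφm σ
      (hQ₁.hom_ext (by
        simp only [Category.assoc, hm, hσ, N.condition, hl₁]) (by
        simp only [Category.assoc, hm', hl₃]))
    -- Restrict everything to the section `j`: the remaining fibration is one display map shorter,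
    -- and `σ₀` supplies its starting lift.
    obtain ⟨V', v, v', hV, hv⟩ := hp.exists_pullback j
    obtain ⟨Q', a', b', hQ', -⟩ := hv.exists_pullback i
    obtain ⟨m', hm'₁, hm'₂⟩ := hQ.exists_lift a' (b' ≫ v') (by
      simp only [Category.assoc, ← reassoc_of% hV.w, hj, hQ'.w, Category.comp_id])
    obtain ⟨F', φ', f', hF', hφ'⟩ := hφ.exists_pullback m'
    have e₁ : σ₀ ≫ φ ≫ a = 𝟙 U := by
      rw [← hm]; simpa [hl₁] using hσ₀ =≫ a₁
    have e₂ : σ₀ ≫ φ ≫ b ≫ p = i ≫ j := by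
      rw [← hm']; simpa [hl₂] using hσ₀ =≫ b₁
    obtain ⟨y, hy, hy'⟩ := hV.exists_lift i (σ₀ ≫ φ ≫ b) (by simp [e₂])
    obtain ⟨z, hz, hz'⟩ := hQ'.exists_lift (𝟙 U) y (by simp [hy])
    obtain ⟨σ₁, hσ₁, hσ₁'⟩ := hF'.exists_lift z σ₀ (hQ.hom_ext (by simp [hm'₁, hz, e₁])
      (by simp [hm'₂, reassoc_of% hz', hy']))
    obtain ⟨j', hj', σ', hσ', hσ''⟩ := ih hi hv hQ' hφ' (σ := σ₁) (by simp [reassoc_of% hσ₁, hz])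
    refine ⟨j' ≫ v', ?_, σ' ≫ f', ?_, ?_⟩
    · simp only [Category.assoc, ← reassoc_of% hV.w, hj, hj', Category.comp_id]
    · simp only [Category.assoc, ← reassoc_of% hF'.w, hm'₁, hσ']
    · simp only [Category.assoc, ← reassoc_of% hF'.w, hm'₂, reassoc_of% hσ'']

end IdentityTypes
end DepTT
namespace DepTT

/-! ### Base change of identity types, transport, and contractibility of based path spaces -/

section IdentityTypes

variable {C : Type u} [Category.{v} C] {D : MorphismProperty C}

namespace IdObj

/-- Weak identity types are stable under base change. -/
def baseChange {A Γ A' Γ' : C} {d : A ⟶ Γ} (N : IdObj D d) {d' : A' ⟶ Γ'} {σ' : A' ⟶ A} {σ : Γ' ⟶ Γ}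
    (h : IsPullback d' σ' σ d) {AA I : C} {p₁ p₂ : AA ⟶ A'} (hAA : IsPullback p₁ p₂ d' d')
    {α : AA ⟶ N.AA} (hα₁ : α ≫ N.pr₁ = p₁ ≫ σ') (hα₂ : α ≫ N.pr₂ = p₂ ≫ σ') {s : I ⟶ AA}
    {ι : I ⟶ N.I} (hI : IsPullback s ι α N.st) (hs : D s) (r : A' ⟶ I) (hr₁ : r ≫ s ≫ p₁ = 𝟙 A')
    (hr₂ : r ≫ s ≫ p₂ = 𝟙 A') (hr : r ≫ ι = σ' ≫ N.r) : IdObj D d' where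
  AA := AA
  I := I
  pr₁ := p₁
  pr₂ := p₂
  st := s
  r := r
  isPullback := hAA
  disp := hs
  r_fst := hr₁
  r_snd := hr₂
  weakExt := by
    intro X K E U x k₁ k₂ δ w i hK hδ hU
    have hα : IsPullback p₁ α σ' N.pr₁ := by
      refine IsPullback.of_bot (v₂₁ := N.pr₂) (v₂₂ := d) (h₃₁ := d) ?_ hα₁.symm N.isPullback
      rw [hα₂, ← h.w]
      exact hAA.paste_vert h
    have hI' : IsPullback (s ≫ p₁ ≫ d') ι σ (N.st ≫ N.pr₁ ≫ d) := hI.paste_horiz (hα.paste_horiz h)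
    have hr' : IsPullback r σ' ι N.r := by
      refine IsPullback.of_right (h₁₂ := s ≫ p₁ ≫ d') (v₁₃ := σ) (h₂₂ := N.st ≫ N.pr₁ ≫ d) ?_ hr hI'
      rw [reassoc_of% hr₁, reassoc_of% N.r_fst]
      exact h
    -- By pasting, `K` is a base change of `N.I` along `x ≫ σ` and `i` a pullback of `N.r`, so this
    -- is an instance of the property of `N`.
    refine N.weakExt (hK.paste_vert hI') hδ (w := w ≫ σ') ?_
    simpa using hU.paste_horiz hr'.flip

/-- Existence of pullbacks is the explicit hypothesis `hD` because this lemma is also used to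
establish `IsDisplayClass` for the classifying category. The maps `α` and `ι` let a path of `N` be
read as one of the new object. -/
theorem exists_baseChange (hD : ∀ {X Y Z : C} (f : X ⟶ Y) (g : Z ⟶ Y), D f →
    ∃ (W : C) (f' : W ⟶ Z) (g' : W ⟶ X), IsPullback f' g' g f ∧ D f') {A Γ A' Γ' : C} {d : A ⟶ Γ} (N : IdObj D d) {d' : A' ⟶ Γ'} {σ' : A' ⟶ A}
    {σ : Γ' ⟶ Γ} (h : IsPullback d' σ' σ d) (hd' : D d') :
    ∃ (N' : IdObj D d') (α : N'.AA ⟶ N.AA) (ι : N'.I ⟶ N.I), IsPullback N'.st ι α N.st ∧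
      α ≫ N.pr₁ = N'.pr₁ ≫ σ' ∧ α ≫ N.pr₂ = N'.pr₂ ≫ σ' ∧ N'.r ≫ ι = σ' ≫ N.r := by
  obtain ⟨AA, p₁, p₂, hAA, -⟩ := hD d' d' hd'
  obtain ⟨α, hα₁, hα₂⟩ := N.isPullback.exists_lift (p₁ ≫ σ') (p₂ ≫ σ') (by
    simp only [Category.assoc, ← h.w, reassoc_of% hAA.w])
  obtain ⟨I, s, ι, hI, hs⟩ := hD N.st α N.disp
  obtain ⟨Δ, hΔ₁, hΔ₂⟩ := hAA.exists_lift (𝟙 A') (𝟙 A') rfl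
  obtain ⟨r, hr, hr'⟩ := hI.exists_lift Δ (σ' ≫ N.r) (N.isPullback.hom_ext
    (by simp [hα₁, reassoc_of% hΔ₁, N.r_fst]) (by simp [hα₂, reassoc_of% hΔ₂, N.r_snd]))
  exact ⟨N.baseChange h hAA hα₁ hα₂ hI hs r (by rw [reassoc_of% hr, hΔ₁])
    (by rw [reassoc_of% hr, hΔ₂]) hr', α, ι, hI, hα₁, hα₂, hr'⟩

variable [IsDisplayClass D] {A Γ : C} {d : A ⟶ Γ} (N : IdObj D d)

/-- Path induction for the transport relation. The relation is not itself a fibration, but every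
instance of it asks for a point of a fibration, which `elim` supplies once it is available over
constant paths. -/
theorem transportRel_of_r (hd : D d) {E M : C} {p : E ⟶ A} (hp : Fib D p) {m₁ : M ⟶ N.I} {m₂ : M ⟶ E}
    (hM : IsPullback m₁ m₂ (N.st ≫ N.pr₁) p) {ρ : E ⟶ M} (hρ₁ : ρ ≫ m₁ = p ≫ N.r)
    (hρ₂ : ρ ≫ m₂ = 𝟙 E) {s t : M ⟶ E} (hs : s ≫ p ≫ d = m₁ ≫ N.st ≫ N.pr₁ ≫ d)
    (ht : t ≫ p ≫ d = m₁ ≫ N.st ≫ N.pr₁ ≫ d) (H : TransportRel D (p ≫ d) (ρ ≫ s) (ρ ≫ t)) :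
    TransportRel D (p ≫ d) s t := by
  refine ⟨hs.trans ht.symm, fun X' Z F h a b φ hZ hφ σ h₁ h₂ => ?_⟩
  have hpd : Fib D (p ≫ d) := hp.comp (Fib.of_disp hd)
  obtain ⟨K, k₁, k₂, hK, -⟩ := ((N.fib_src hd).comp (Fib.of_disp hd)).exists_pullback (h ≫ s ≫ p ≫ d)
  rw [Category.assoc] at hK
  obtain ⟨Y, y₁, y₂, hY, hy₁⟩ := (hp.of_isPullback hM).exists_pullback k₂
  have key : y₁ ≫ k₁ ≫ h ≫ s ≫ p ≫ d = y₂ ≫ m₁ ≫ N.st ≫ N.pr₁ ≫ d := by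
    rw [hK.w, reassoc_of% hY.w]
  obtain ⟨zs, hzs, hzs'⟩ := hZ.exists_lift (y₁ ≫ k₁) (y₂ ≫ s) (by rw [Category.assoc, Category.assoc, key, hs])
  obtain ⟨zt, hzt, hzt'⟩ := hZ.exists_lift (y₁ ≫ k₁) (y₂ ≫ t) (by rw [Category.assoc, Category.assoc, key, ht])
  obtain ⟨E₀, δ, δ', hE, hδ⟩ := hφ.exists_pullback zs
  obtain ⟨G, γ, γ', hG, hγ⟩ := hφ.exists_pullback (δ ≫ zt)
  obtain ⟨j, hj⟩ := N.elim hd hK (hδ.comp hy₁) hγ (fun {U} w i hi => by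
    simp only [Category.assoc] at hi
    have e₁ : i ≫ δ ≫ y₂ ≫ m₂ ≫ p = w := by
      rw [← hM.w, ← reassoc_of% hY.w, reassoc_of% hi, N.r_fst, Category.comp_id]
    -- A point of `M` lying over a constant path is in the image of `ρ`, which is what makes `H`
    -- applicable.
    have e₂ : (i ≫ δ ≫ y₂ ≫ m₂) ≫ ρ = i ≫ δ ≫ y₂ := by
      refine hM.hom_ext ?_ ?_
      · simp only [Category.assoc, hρ₁, reassoc_of% e₁, ← hi, hY.w]
      · simp only [Category.assoc, hρ₂, Category.comp_id]
    have H' := H.precomp (i ≫ δ ≫ y₂ ≫ m₂)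
    simp only [Category.assoc, reassoc_of% e₂] at H'
    obtain ⟨σ', hσ', hσ''⟩ := H'.exists_lift hpd hZ hφ (i ≫ δ') (by
      simp only [Category.assoc, ← reassoc_of% hE.w, hzs'])
    obtain ⟨c, hc, -⟩ := hG.exists_lift i σ' (hZ.hom_ext
      (by simp only [Category.assoc, hσ', ← reassoc_of% hE.w, hzs, hzt])
      (by simp only [Category.assoc, hσ'', hzt']))
    exact ⟨c, hc⟩)
  obtain ⟨x, hx, hx'⟩ := hK.exists_lift (𝟙 X') (h ≫ m₁) (by simp [hs])
  obtain ⟨y, hy, hy'⟩ := hY.exists_lift x h hx'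
  obtain ⟨e, he, -⟩ := hE.exists_lift y σ (hZ.hom_ext (by simp [hzs, reassoc_of% hy, hx, h₁])
    (by simp [hzs', reassoc_of% hy', h₂]))
  refine ⟨e ≫ j ≫ γ', ?_, ?_⟩
  · simp only [Category.assoc, ← reassoc_of% hG.w, reassoc_of% hj, reassoc_of% he, hzt,
      reassoc_of% hy, hx]
  · simp only [Category.assoc, ← reassoc_of% hG.w, reassoc_of% hj, reassoc_of% he, hzt',
      reassoc_of% hy']

/-- Transport along a path moves an element of a fibration to a homotopic one. -/
theorem hRel_transport (hd : D d) {E M : C} {p : E ⟶ A} (hp : Fib D p) {m₁ : M ⟶ N.I} {m₂ : M ⟶ E}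
    (hM : IsPullback m₁ m₂ (N.st ≫ N.pr₁) p) {ρ : E ⟶ M} (hρ₁ : ρ ≫ m₁ = p ≫ N.r)
    (hρ₂ : ρ ≫ m₂ = 𝟙 E) {τ : M ⟶ E} (hτ : τ ≫ p = m₁ ≫ N.st ≫ N.pr₂) (H : HRel D p (ρ ≫ τ) (𝟙 E)) :
    HRel D (p ≫ d) m₂ τ := by
  have h₁ : m₂ ≫ p ≫ d = m₁ ≫ N.st ≫ N.pr₁ ≫ d := by rw [← reassoc_of% hM.w]
  have h₂ : τ ≫ p ≫ d = m₁ ≫ N.st ≫ N.pr₁ ≫ d := by rw [reassoc_of% hτ, N.condition]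
  have hR := H.of_comp hp d
  rw [← hρ₂] at hR
  exact ⟨N.transportRel_of_r hd hp hM hρ₁ hρ₂ h₁ h₂ hR.2, N.transportRel_of_r hd hp hM hρ₁ hρ₂ h₂ h₁ hR.1⟩

/-- Transport in a fibration `E ⟶ A`; along constant paths it is related to the identity by a
given fibration over `E ×_A E`. -/
theorem exists_transport {E M EE G : C} {p : E ⟶ A} (hp : Fib D p) {m₁ : M ⟶ N.I}
    {m₂ : M ⟶ E} (hM : IsPullback m₁ m₂ (N.st ≫ N.pr₁) p) {e₁ e₂ : EE ⟶ E} (hEE : IsPullback e₁ e₂ p p)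
    {g : G ⟶ EE} (hg : Fib D g) {r : E ⟶ G} (hr : r ≫ g ≫ e₂ = 𝟙 E) :
    ∃ (τ : M ⟶ E) (ρ : E ⟶ M) (l : E ⟶ G), τ ≫ p = m₁ ≫ N.st ≫ N.pr₂ ∧ ρ ≫ m₁ = p ≫ N.r ∧
      ρ ≫ m₂ = 𝟙 E ∧ l ≫ g ≫ e₁ = ρ ≫ τ ∧ l ≫ g ≫ e₂ = 𝟙 E := by
  obtain ⟨ρ, hρ₁, hρ₂⟩ := hM.exists_lift (p ≫ N.r) (𝟙 E) (by simp [N.r_fst])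
  have hρ : IsPullback p ρ N.r m₁ := by
    refine IsPullback.of_bot (v₂₁ := m₂) (v₂₂ := N.st ≫ N.pr₁) (h₃₁ := p) ?_ hρ₁.symm hM
    rw [hρ₂, N.r_fst]
    exact IsPullback.id_vert p
  have hext : WeakExt D ρ :=
    N.weakExt (x := 𝟙 Γ) (k₁ := N.st ≫ N.pr₁ ≫ d) (k₂ := 𝟙 _) (δ := m₁) (w := p)
      (IsPullback.id_vert _) (hp.of_isPullback hM) (by simpa using hρ)
  obtain ⟨n, hn⟩ := hp
  obtain ⟨B, π, π', hB, hπ⟩ := hn.exists_pullback (m₁ ≫ N.st ≫ N.pr₂)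
  have e : ρ ≫ m₁ ≫ N.st ≫ N.pr₂ = p := by rw [reassoc_of% hρ₁, N.r_snd, Category.comp_id]
  obtain ⟨b, hb, hb'⟩ := hB.exists_lift (e₂ ≫ ρ) e₁ (by rw [Category.assoc, e, hEE.w])
  -- A constant path ends where it starts, so `B` restricted along `ρ` is `E ×_A E`.
  have hQ : IsPullback e₂ b ρ π := by
    refine IsPullback.of_bot (v₂₁ := π') (v₂₂ := m₁ ≫ N.st ≫ N.pr₂) (h₃₁ := p) ?_ hb.symm hB
    rw [hb', e]
    exact hEE.flip
  -- The lift `r` to `G` is carried to a lift over `(ρ ≫ τ, 𝟙 E)`. This replaces the computation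
  -- rule for transport along constant paths.
  obtain ⟨j, hj, l, hl, hl'⟩ := hext.exists_section_lift hπ hQ hg hr
  refine ⟨j ≫ π', ρ, l, ?_, hρ₁, hρ₂, ?_, hl⟩
  · rw [Category.assoc, ← hB.w, reassoc_of% hj]
  · rw [← hb', reassoc_of% hl']

/-- The space of paths with a fixed source is contractible. -/
theorem hRel_src_r (hd : D d) : HRel D (N.st ≫ N.pr₁) ((N.st ≫ N.pr₁) ≫ N.r) (𝟙 N.I) := by
  have hpr := disp_of_isPullback N.isPullback hd
  have hst := Fib.of_disp N.disp
  -- `N₁` describes paths in `A ×_Γ A` that move only the second coordinate; `N₂` describes paths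
  -- between paths with the same endpoints.
  obtain ⟨N₁, α, ι, hI, hα₁, hα₂, hr⟩ := N.exists_baseChange IsDisplayClass.exists_pullback N.isPullback hpr
  obtain ⟨N₂⟩ := IsDisplayClass.exists_idObj N.st N.disp
  obtain ⟨M, m₁, m₂, hM, -⟩ := hst.exists_pullback (N₁.st ≫ N₁.pr₁)
  obtain ⟨τ, ρ, l, hτ, hρ₁, hρ₂, hl₁, hl₂⟩ :=
    N₁.exists_transport hst hM N₂.isPullback (Fib.of_disp N₂.disp) N₂.r_snd
  have H₁ := N₁.hRel_transport hpr hst hM hρ₁ hρ₂ hτ (N₂.hRel_of_lift N.disp l hl₁ hl₂)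
  -- `κ` reads a path `u` from `x` to `y` as a path from `(x, x)` to `(x, y)`. Then `μ` pairs it
  -- with the constant path at `x`, so `μ ≫ τ` transports that constant path along `u`.
  obtain ⟨κ₀, hκ₁, hκ₂⟩ := N₁.isPullback.exists_lift (N.st ≫ N.pr₁ ≫ N.r ≫ N.st) N.st (by
    simp [N.r_fst])
  obtain ⟨κ, hκ, hκ'⟩ := hI.exists_lift κ₀ (𝟙 N.I) (N.isPullback.hom_ext
    (by simp [hα₁, reassoc_of% hκ₁, N.r_snd]) (by simp [hα₂, reassoc_of% hκ₂]))
  obtain ⟨μ, hμ₁, hμ₂⟩ := hM.exists_lift κ (N.st ≫ N.pr₁ ≫ N.r) (by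
    rw [reassoc_of% hκ, hκ₁]; simp)
  have hμ : N.r ≫ μ = N.r ≫ ρ := by
    refine hM.hom_ext ?_ ?_
    · simp only [Category.assoc, hμ₁, hρ₁]
      refine hI.hom_ext ?_ ?_
      · refine N₁.isPullback.hom_ext ?_ ?_
        · simp only [Category.assoc, hκ, hκ₁, N₁.r_fst, reassoc_of% N.r_fst, Category.comp_id]
        · simp only [Category.assoc, hκ, hκ₂, N₁.r_snd, Category.comp_id]
      · simp only [Category.assoc, hκ', hr, reassoc_of% N.r_snd, Category.comp_id]
    · simp only [Category.assoc, hμ₂, hρ₂, reassoc_of% N.r_fst, Category.comp_id]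
  have H₂ := H₁.precomp μ
  rw [hμ₂, ← Category.assoc] at H₂
  refine H₂.trans ?_
  -- It remains to join `μ ≫ τ` to the identity, by induction on the path: on constant paths `μ`
  -- agrees with `ρ`, where `l` is the required path.
  obtain ⟨θ, hθ₁, hθ₂⟩ := N₂.isPullback.exists_lift (μ ≫ τ) (𝟙 N.I) (by
    rw [Category.assoc, hτ, reassoc_of% hμ₁, reassoc_of% hκ, hκ₂, Category.id_comp])
  obtain ⟨G, g, g', hG, hg⟩ := (FibN.of_disp N₂.disp).exists_pullback θ
  obtain ⟨c, hc, -⟩ := hG.exists_lift N.r (N.r ≫ l) (N₂.isPullback.hom_ext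
    (by simp only [Category.assoc, hθ₁, reassoc_of% hμ, hl₁])
    (by simp only [Category.assoc, hθ₂, hl₂]))
  obtain ⟨j, hj⟩ := N.weakExt_r.exists_section hg hc
  refine (N₂.hRel_of_lift N.disp (j ≫ g') ?_ ?_).of_comp hst N.pr₁
  · rw [Category.assoc, ← reassoc_of% hG.w, reassoc_of% hj, hθ₁]
  · rw [Category.assoc, ← reassoc_of% hG.w, reassoc_of% hj, hθ₂]

end IdObj

end IdentityTypes
end DepTT
namespace DepTT

/-! ### Fibrewise path objects -/

section PathObjects

variable {C : Type u} [Category.{v} C] {D : MorphismProperty C} [IsDisplayClass D]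

/-- Fibrewise path objects of fibrations. Paths with a fixed source form a contractible space. -/
theorem FibN.exists_pathObject {n : ℕ} : ∀ {E B : C} {q : E ⟶ B}, FibN D n q →
    ∃ (EE P : C) (e₁ e₂ : EE ⟶ E) (s : P ⟶ EE) (r : E ⟶ P), IsPullback e₁ e₂ q q ∧ Fib D s ∧
      r ≫ s ≫ e₁ = 𝟙 E ∧ r ≫ s ≫ e₂ = 𝟙 E ∧ HRel D (s ≫ e₁) ((s ≫ e₁) ≫ r) (𝟙 P) := by
  induction n with
  | zero =>
    intro E B q hq
    have : IsIso q := hq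
    exact ⟨E, E, 𝟙 E, 𝟙 E, 𝟙 E, 𝟙 E, IsPullback.of_horiz_isIso_mono ⟨rfl⟩, Fib.of_isIso _, by simp,
      by simp, by simpa using HRel.refl _ _⟩
  | succ n ih =>
    rintro E B q hq
    have hq' : Fib D q := ⟨_, hq⟩
    obtain ⟨A, p, d, hpn, hd, rfl⟩ := hq
    have hp : Fib D p := ⟨n, hpn⟩
    obtain ⟨EA, PA, a₁, a₂, sA, rA, hEA, hsA, hr₁, hr₂, H⟩ := ih hpn
    obtain ⟨N⟩ := IsDisplayClass.exists_idObj d hd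
    -- `M`: a path in `A` and a point of `E` over its source. `Y`: in addition a point over its
    -- target. `P`: in addition a path over `A` from the transported first point to the second.
    obtain ⟨M, m₁, m₂, hM, -⟩ := hp.exists_pullback (N.st ≫ N.pr₁)
    obtain ⟨τ, ρ, l, hτ, hρ₁, hρ₂, hl₁, hl₂⟩ := N.exists_transport hp hM hEA hsA hr₂
    obtain ⟨Y, y₁, y₂, hY, -⟩ := hp.exists_pullback (m₁ ≫ N.st ≫ N.pr₂)
    obtain ⟨y, hy₁, hy₂⟩ := hEA.exists_lift (y₁ ≫ τ) y₂ (by rw [Category.assoc, hτ, hY.w])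
    have hy : IsPullback y₁ y τ a₁ := by
      refine IsPullback.of_bot (v₂₁ := a₂) (v₂₂ := p) (h₃₁ := p) ?_ hy₁.symm hEA
      rw [hy₂, hτ]
      exact hY
    obtain ⟨P, k, k', hk, hk'⟩ := hsA.exists_pullback y
    have hP : IsPullback (k ≫ y₁) k' τ (sA ≫ a₁) := hk.paste_horiz hy
    obtain ⟨EE, e₁, e₂, hEE, -⟩ := hq'.exists_pullback (p ≫ d)
    obtain ⟨z, hz₁, hz₂⟩ := hEE.exists_lift (y₁ ≫ m₂) y₂ (by
      rw [← reassoc_of% hY.w, N.condition, Category.assoc, ← reassoc_of% hM.w])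
    obtain ⟨ζ, hζ₁, hζ₂⟩ := N.isPullback.exists_lift (e₁ ≫ p) (e₂ ≫ p) (by simpa using hEE.w)
    -- `Y` is the restriction of `N.st` to `E ×_B E`, which makes `P ⟶ E ×_B E` a composite of
    -- fibrations.
    have hz : IsPullback z (y₁ ≫ m₁) ζ N.st := by
      refine IsPullback.mk' (N.isPullback.hom_ext ?_ ?_) (fun T f g h₁ h₂ => ?_) (fun T f g h => ?_)
      · simp only [Category.assoc, hζ₁, reassoc_of% hz₁, hM.w]
      · simp only [Category.assoc, hζ₂, reassoc_of% hz₂, hY.w]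
      · refine hY.hom_ext (hM.hom_ext (by simpa using h₂) ?_) ?_
        · simpa [hz₁] using h₁ =≫ e₁
        · simpa [hz₂] using h₁ =≫ e₂
      · obtain ⟨x, hx, hx'⟩ := hM.exists_lift g (f ≫ e₁) (by
          rw [← reassoc_of% h, hζ₁, Category.assoc])
        obtain ⟨x', hx₁, hx₂⟩ := hY.exists_lift x (f ≫ e₂) (by
          rw [reassoc_of% hx, ← reassoc_of% h, hζ₂, Category.assoc])
        exact ⟨x', hEE.hom_ext (by simp [hz₁, reassoc_of% hx₁, hx']) (by simp [hz₂, hx₂]),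
          by rw [reassoc_of% hx₁, hx]⟩
    obtain ⟨ρY, hρY₁, hρY₂⟩ := hY.exists_lift ρ (𝟙 E) (by
      rw [reassoc_of% hρ₁, N.r_snd, Category.comp_id, Category.id_comp])
    -- Transport along a constant path is not strictly the identity, so the last component of
    -- reflexivity is `l`.
    obtain ⟨r, hr, hr'⟩ := hk.exists_lift ρY l (hEA.hom_ext
      (by rw [Category.assoc, hy₁, reassoc_of% hρY₁, Category.assoc, hl₁])
      (by rw [Category.assoc, hy₂, hρY₂, Category.assoc, hl₂]))
    -- `t : M ⟶ P` completes a point of `M` by its transport and the constant path there.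
    obtain ⟨υ, hυ₁, hυ₂⟩ := hY.exists_lift (𝟙 M) τ (by rw [hτ, Category.id_comp])
    obtain ⟨t, ht, ht'⟩ := hk.exists_lift υ (τ ≫ rA) (hEA.hom_ext
      (by rw [Category.assoc, hy₁, reassoc_of% hυ₁, Category.assoc, Category.assoc, hr₁,
        Category.comp_id])
      (by rw [Category.assoc, hy₂, hυ₂, Category.assoc, Category.assoc, hr₂, Category.comp_id]))
    have hsrc : (k ≫ z) ≫ e₁ = (k ≫ y₁) ≫ m₂ := by simp [hz₁]
    have hn : Fib D (k ≫ y₁) := (hsA.comp (hp.of_isPullback hEA)).of_isPullback hP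
    have ht₁ : t ≫ k ≫ y₁ = 𝟙 M := by rw [reassoc_of% ht, hυ₁]
    have hr₁ : r ≫ k ≫ y₁ = ρ := by rw [reassoc_of% hr, hρY₁]
    -- Contract in two stages: `P` onto `M` by the induction hypothesis, then `M` onto `E` by
    -- contractibility of paths with fixed source.
    have H₁ : HRel D (k ≫ y₁) ((k ≫ y₁) ≫ t) (𝟙 P) := by
      refine HRel.of_isPullback hP (by simp [ht₁]) ?_
      have := H.precomp k'
      rw [← Category.assoc k', ← hP.w] at this
      simpa [ht'] using this
    have H₂ : HRel D m₂ (m₂ ≫ ρ) (𝟙 M) := by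
      refine HRel.of_isPullback hM.flip (by simp [hρ₂]) ?_
      have := (N.hRel_src_r hd).precomp m₁
      rw [← Category.assoc m₁, hM.w] at this
      simpa [hρ₁] using this
    have H₃ := (H₂.precomp (k ≫ y₁)).map ((N.fib_src hd).of_isPullback hM.flip)
      (q' := (k ≫ y₁) ≫ m₂) t (𝟙 E) (by simp [reassoc_of% ht₁])
    have H₁' := H₁.of_comp hn m₂
    -- The two stages end at `ρ ≫ t` after the source map, which the first contraction, restricted
    -- along `r`, identifies with `r`.
    have H₄ := (H₁'.precomp r).precomp ((k ≫ y₁) ≫ m₂)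
    refine ⟨EE, P, e₁, e₂, k ≫ z, r, hEE, hk'.comp ((Fib.of_disp N.disp).of_isPullback hz), ?_, ?_, ?_⟩
    · rw [hsrc, Category.assoc, reassoc_of% hr₁, hρ₂]
    · rw [Category.assoc, hz₂, reassoc_of% hr, hρY₂]
    · rw [hsrc]
      refine HRel.trans ?_ H₁'
      refine HRel.trans ?_ (by simpa using H₃)
      refine HRel.symm ?_
      simpa [reassoc_of% hr₁] using H₄

end PathObjects
end DepTT
namespace DepTT

/-! ### The path category of a display class in which every object is fibrant -/

section PathCategoryOfDisplayClass

variable {C : Type u} [Category.{v} C] (D : MorphismProperty C) {t : C} (ht : IsTerminal t)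

/-- Homotopy of maps. -/
def homotopyRel : HomRel C := fun _ Y f g => HRel D (ht.from Y) f g

/-- The maps that become invertible up to homotopy. -/
def homotopyEquivalences : MorphismProperty C :=
  fun _ _ f => IsIso ((Quotient.functor (homotopyRel D ht)).map f)

variable {D ht} [IsDisplayClass D]

theorem homotopyRel_congruence (h : ∀ X, Fib D (ht.from X)) : Congruence (homotopyRel D ht) where
  equivalence := ⟨fun _ => HRel.refl _ _, fun H => HRel.symm H, fun H K => HRel.trans H K⟩
  comp_left f _ _ H := HRel.precomp H f
  comp_right g H := HRel.map H (h _) g (𝟙 t) (ht.hom_ext _ _)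

theorem homotopyEquivalences_iff (h : ∀ X, Fib D (ht.from X)) {X Y : C} (f : X ⟶ Y) :
    homotopyEquivalences D ht f ↔
      ∃ g : Y ⟶ X, HRel D (ht.from X) (f ≫ g) (𝟙 X) ∧ HRel D (ht.from Y) (g ≫ f) (𝟙 Y) := by
  have := homotopyRel_congruence h
  let L := Quotient.functor (homotopyRel D ht)
  constructor
  · intro (hf : IsIso (L.map f))
    obtain ⟨g, hg⟩ := L.map_surjective (inv (L.map f))
    refine ⟨g, ?_, ?_⟩ <;> refine (Quotient.functor_map_eq_iff (homotopyRel D ht) _ _).1 ?_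
    · exact (L.map_comp f g).trans (by rw [hg, L.map_id, IsIso.hom_inv_id])
    · exact (L.map_comp g f).trans (by rw [hg, L.map_id, IsIso.inv_hom_id])
  · rintro ⟨g, h₁, h₂⟩
    refine ⟨L.map g, ?_, ?_⟩
    · rw [← L.map_comp, ← L.map_id]
      exact CategoryTheory.Quotient.sound _ h₁
    · rw [← L.map_comp, ← L.map_id]
      exact CategoryTheory.Quotient.sound _ h₂

theorem isIso_of_two_out_of_six {K : Type*} [Category* K] {X Y Z V : K} (f : X ⟶ Y) (g : Y ⟶ Z)
    (h : Z ⟶ V) (hfg : IsIso (f ≫ g)) (hgh : IsIso (g ≫ h)) :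
    IsIso f ∧ IsIso g ∧ IsIso h ∧ IsIso (f ≫ g ≫ h) := by
  have e₁ : g ≫ h ≫ inv (g ≫ h) = 𝟙 Y := by rw [← Category.assoc, IsIso.hom_inv_id]
  have e₂ : (inv (f ≫ g) ≫ f) ≫ g = 𝟙 Z := by rw [Category.assoc, IsIso.inv_hom_id]
  have hg : IsIso g := by
    refine ⟨h ≫ inv (g ≫ h), e₁, ?_⟩
    have : inv (f ≫ g) ≫ f = h ≫ inv (g ≫ h) := by
      rw [← Category.comp_id (inv (f ≫ g) ≫ f), ← e₁, ← Category.assoc, e₂, Category.id_comp]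
    rw [← this, e₂]
  have hf : IsIso f := IsIso.of_isIso_comp_right f g
  have hh : IsIso h := IsIso.of_isIso_comp_left g h
  exact ⟨hf, hg, hh, inferInstance⟩

/-- A homotopy inverse `g` is a point of the fibration `p` over `g ≫ p`; since `g ≫ p` is homotopic
to the identity, Leibniz transport moves it to a point over `𝟙 B`. -/
theorem exists_section_of_homotopyEquivalence (h : ∀ X, Fib D (ht.from X)) {E B : C} {p : E ⟶ B}
    (hp : Fib D p) (hw : homotopyEquivalences D ht p) : ∃ s : B ⟶ E, s ≫ p = 𝟙 B := by
  obtain ⟨g, -, hg⟩ := (homotopyEquivalences_iff h p).1 hw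
  exact hg.1.exists_lift_self (h B) hp g rfl

/-- A fibration that is a homotopy equivalence is a fibrewise deformation retraction. -/
theorem exists_section_hRel (h : ∀ X, Fib D (ht.from X)) {E B : C} {p : E ⟶ B}
    (hp : Fib D p) (hw : homotopyEquivalences D ht p) :
    ∃ s : B ⟶ E, s ≫ p = 𝟙 B ∧ HRel D p (p ≫ s) (𝟙 E) := by
  obtain ⟨s, hs⟩ := exists_section_of_homotopyEquivalence h hp hw
  obtain ⟨g, hg, -⟩ := (homotopyEquivalences_iff h p).1 hw
  have hsg : HRel D (ht.from E) (p ≫ s) (𝟙 E) := by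
    have := (hg.precomp s).precomp p
    rw [reassoc_of% hs, Category.comp_id] at this
    exact this.symm.trans hg
  obtain ⟨n, hn⟩ := hp
  obtain ⟨EE, P, e₁, e₂, st, r, hEE, hst, hr₁, hr₂, H⟩ := hn.exists_pathObject
  have hp : Fib D p := ⟨n, hn⟩
  -- Over a point `e`, the fibration `G` consists of the fibrewise paths from `s (p e)` to `e`. Over
  -- `p ≫ s` it has the constant path, and the homotopy `hsg`, which is not fibrewise, transports
  -- this to a point over the identity.
  obtain ⟨θ, hθ₁, hθ₂⟩ := hEE.exists_lift (p ≫ s) (𝟙 E) (by simp [hs])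
  obtain ⟨G, γ, γ', hG, hγ⟩ := hst.exists_pullback θ
  obtain ⟨σ, hσ, -⟩ := hG.exists_lift (p ≫ s) (p ≫ s ≫ r) (hEE.hom_ext
    (by simp [hθ₁, reassoc_of% hs, hr₁]) (by simp [hθ₂, hr₂]))
  obtain ⟨σ', hσ'⟩ := hsg.1.exists_lift_self (h E) hγ σ hσ
  have hχ : σ' ≫ γ' ≫ st = θ := by rw [← hG.w, reassoc_of% hσ']
  -- Applying the target map to the fibrewise contraction of `P` turns the resulting path into a
  -- homotopy over `B`.
  have := (H.precomp (σ' ≫ γ')).map (hst.comp (hp.of_isPullback hEE)) (q' := p) (st ≫ e₂) p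
    (by simp [hEE.w])
  refine ⟨s, hs, ?_⟩
  simpa [reassoc_of% hχ, hθ₁, hθ₂, hr₂] using this

/-- A fibrewise deformation retraction can be pulled back, which is why the homotopy had to be made
fibrewise first. -/
theorem homotopyEquivalences_of_isPullback (h : ∀ X, Fib D (ht.from X)) {P X Y Z : C} {q : P ⟶ Y}
    {g : P ⟶ X} {f : Y ⟶ Z} {p : X ⟶ Z} (hP : IsPullback q g f p) (hp : Fib D p)
    (hw : homotopyEquivalences D ht p) : homotopyEquivalences D ht q := by
  obtain ⟨s, hs, H⟩ := exists_section_hRel h hp hw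
  obtain ⟨s', hs₁, hs₂⟩ := hP.exists_lift (𝟙 Y) (f ≫ s) (by simp [hs])
  refine (homotopyEquivalences_iff h q).2 ⟨s', ?_, by rw [hs₁]; exact HRel.refl _ _⟩
  have : HRel D q (q ≫ s') (𝟙 P) := by
    refine HRel.of_isPullback hP (by simp [hs₁]) ?_
    simpa [hs₂, reassoc_of% hP.w] using H.precomp g
  rw [ht.hom_ext (ht.from P) (q ≫ ht.from Y)]
  exact this.of_comp (hp.of_isPullback hP) _

/-- This is the fibrewise path object of `B` over the terminal object; its contraction makes the
source map a homotopy inverse of `r`. -/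
theorem exists_pathObject (h : ∀ X, Fib D (ht.from X)) (B : C) :
    Nonempty (PathObject (Fib D) (homotopyEquivalences D ht) B) := by
  obtain ⟨n, hn⟩ := h B
  obtain ⟨EE, P, e₁, e₂, st, r, hEE, hst, hr₁, hr₂, H⟩ := hn.exists_pathObject
  exact ⟨{
    prod := BinaryFan.mk e₁ e₂
    isLimit := isProductOfIsTerminalIsPullback _ _ _ _ ht hEE.isLimit
    P := P
    r := r
    st := st
    weq := (homotopyEquivalences_iff h r).2 ⟨st ≫ e₁, by rw [hr₁]; exact HRel.refl _ _, by
      rw [ht.hom_ext (ht.from P) ((st ≫ e₁) ≫ ht.from B)]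
      exact H.of_comp (hst.comp ((h B).of_isPullback hEE)) _⟩
    fib := hst
    fst_fac := hr₁
    snd_fac := hr₂ }⟩

theorem isPathCategory_of_displayClass (h : ∀ X, Fib D (ht.from X)) :
    IsPathCategory (Fib D) (homotopyEquivalences D ht) where
  fib_of_isIso f _ := Fib.of_isIso f
  fib_comp _ _ hf hg := hf.comp hg
  exists_pullback _ f hp :=
    let ⟨_, _, _, hP, _⟩ := hp.exists_pullback f
    hP.hasPullback
  fib_pullback hP hp := hp.of_isPullback hP
  hasTerminal := ht.hasTerminal
  fib_terminal {X Y} hY f := by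
    have : IsIso (ht.from Y) := isIso_of_isTerminal hY ht _
    have e : f = ht.from X ≫ inv (ht.from Y) := hY.hom_ext _ _
    rw [e]
    exact (h X).comp (Fib.of_isIso _)
  weq_of_isIso f _ := (inferInstance : IsIso ((Quotient.functor (homotopyRel D ht)).map f))
  two_out_of_six f g k hfg hgk := by
    simp only [homotopyEquivalences, Functor.map_comp] at hfg hgk ⊢
    exact isIso_of_two_out_of_six _ _ _ hfg hgk
  exists_pathObject := exists_pathObject h
  exists_section _ hp hw := exists_section_of_homotopyEquivalence h hp hw
  weq_pullback hP hp hw := homotopyEquivalences_of_isPullback h hP hp hw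

end PathCategoryOfDisplayClass
end DepTT
namespace DepTT

/-! ### Extending substitutions and context morphisms by further variables -/

section Substitutions

variable {S : Signature.{u}}

theorem Sub.rename_eq_subst {n m : ℕ} (e : Expr S n) (ρ : Fin n → Fin m) :
    e.rename ρ = e.subst (fun i => Expr.var (ρ i)) := by
  have h := Expr.subst_rename e ρ (Sub.id S m)
  rwa [Expr.subst_id] at h

theorem Sub.lift_succ {n k : ℕ} (m : ℕ) (σ : Sub S n k) :
    Sub.lift (m + 1) σ = Sub.lift 1 (Sub.lift m σ) := by
  rw [Sub.lift_one]
  funext i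
  refine Fin.lastCases (n := n + m) ?_ (fun j => ?_) i
  · rw [Sub.snoc_last]
    exact Fin.addCases_right (Fin.last m)
  · rw [Sub.snoc_castSucc]
    refine Fin.addCases (fun a => ?_) (fun b => ?_) j
    · refine (Fin.addCases_left (n := m + 1) a).trans ?_
      simp only [Sub.comp, Sub.lift, Fin.addCases_left, Sub.rename_eq_subst, Expr.subst_subst]
      rfl
    · refine (Fin.addCases_right (n := m + 1) b.castSucc).trans ?_
      simp only [Sub.comp, Sub.lift, Fin.addCases_right]
      rfl

theorem Sub.lift_one_comp {n m k : ℕ} (t : Sub S n m) (s : Sub S (m + 1) k) :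
    (Sub.lift 1 t).comp s = (t.comp s.init).snoc (s (Fin.last m)) := by
  rw [Sub.lift_one, Sub.snoc_comp, Sub.comp_assoc, Sub.wk_comp]
  rfl

end Substitutions

open Judgement TypeTheory

namespace TypeTheory

variable {S : Signature.{u}} {T : TypeTheory S}

theorem isCtxMor_snoc {k n : ℕ} {Δ : Ctx S k} {Γ : Ctx S n} {A : Expr S n} {t : Sub S n k}
    {a : Expr S k} (ht : T.IsCtxMor Δ Γ t) (ha : T.Derivable Δ (hasType a (A.subst t))) :
    T.IsCtxMor Δ (Γ.snoc A) (t.snoc a) := by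
  refine ⟨?_, ?_⟩
  · rwa [Sub.init_snoc]
  · rwa [Sub.init_snoc, Sub.snoc_last]

theorem isCtxMor_wk {n : ℕ} {Γ : Ctx S n} {A : Expr S n} (h : T.Valid (Γ.snoc A)) :
    T.IsCtxMor (Γ.snoc A) Γ (Sub.wk S n) :=
  IsCtxMor.wk h.2 (isCtxMor_id h.1)

theorem valid_snoc_subst {k n : ℕ} {Δ : Ctx S k} {Γ : Ctx S n} {A : Expr S n} {t : Sub S n k}
    (hΔ : T.Valid Δ) (ht : T.IsCtxMor Δ Γ t) (h : T.Valid (Γ.snoc A)) :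
    T.Valid (Δ.snoc (A.subst t)) :=
  ⟨hΔ, derivable_subst hΔ ht h.2⟩

theorem isCtxMor_lift_one {k n : ℕ} {Δ : Ctx S k} {Γ : Ctx S n} {A : Expr S n} {t : Sub S n k}
    (hΔ : T.Valid Δ) (ht : T.IsCtxMor Δ Γ t) (h : T.Valid (Γ.snoc A)) :
    T.IsCtxMor (Δ.snoc (A.subst t)) (Γ.snoc A) (Sub.lift 1 t) := by
  have h' := valid_snoc_subst hΔ ht h
  rw [Sub.lift_one]
  refine isCtxMor_snoc (IsCtxMor.wk h'.2 ht) ?_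
  have := T.var_mem h'.2
  rwa [Expr.wk, Expr.subst_subst] at this

theorem isCtxMor_lift {k n m : ℕ} {Δ : Ctx S k} {Γ : Ctx S n} {t : Sub S n k} (hΔ : T.Valid Δ)
    (ht : T.IsCtxMor Δ Γ t) (Θ : Tel S n m) (h : T.Valid (Γ.append Θ)) :
    T.Valid (Δ.append (Θ.subst t)) ∧ T.IsCtxMor (Δ.append (Θ.subst t)) (Γ.append Θ) (Sub.lift m t) := by
  induction Θ with
  | nil =>
    rw [Sub.lift_zero]
    exact ⟨hΔ, ht⟩
  | snoc Θ A ih =>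
    obtain ⟨h₁, h₂⟩ := ih h.1
    rw [Sub.lift_succ]
    exact ⟨valid_snoc_subst h₁ h₂ h, isCtxMor_lift_one h₁ h₂ h⟩

end TypeTheory

/-! ### Display maps and fibrations in the classifying category -/

namespace ClassifyingCategory

variable {S : Signature.{u}} {T : TypeTheory S}

/-- The morphism between objects given by contexts that a sequence of terms defines. -/
def mor {k n : ℕ} {Δ : Ctx S k} {Γ : Ctx S n} (hΔ : T.Valid Δ) (hΓ : T.Valid Γ) (t : Sub S n k)
    (ht : T.IsCtxMor Δ Γ t) : of Δ hΔ ⟶ of Γ hΓ :=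
  Hom.mk (X := of Δ hΔ) (Y := of Γ hΓ) t ht

theorem exists_mor {k n : ℕ} {Δ : Ctx S k} {Γ : Ctx S n} {hΔ : T.Valid Δ} {hΓ : T.Valid Γ}
    (f : of Δ hΔ ⟶ of Γ hΓ) : ∃ (t : Sub S n k) (ht : T.IsCtxMor Δ Γ t), mor hΔ hΓ t ht = f :=
  let ⟨t, ht⟩ := Quotient.exists_rep f
  ⟨t.1, t.2, ht⟩

theorem mor_eq_iff {k n : ℕ} {Δ : Ctx S k} {Γ : Ctx S n} {hΔ : T.Valid Δ} {hΓ : T.Valid Γ}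
    {s t : Sub S n k} {hs : T.IsCtxMor Δ Γ s} {ht : T.IsCtxMor Δ Γ t} :
    mor hΔ hΓ s hs = mor hΔ hΓ t ht ↔ T.CtxMorEq Δ Γ s t :=
  Quotient.eq (r := morSetoid (of Δ hΔ) (of Γ hΓ))

theorem mor_congr {k n : ℕ} {Δ : Ctx S k} {Γ : Ctx S n} {hΔ : T.Valid Δ} {hΓ : T.Valid Γ}
    {s t : Sub S n k} {hs : T.IsCtxMor Δ Γ s} (h : s = t) :
    mor hΔ hΓ s hs = mor hΔ hΓ t (h ▸ hs) := by
  subst h; rfl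

/-- The projection `[Γ, x ∈ A] ⟶ [Γ]`. -/
def wkMor {n : ℕ} {Γ : Ctx S n} {A : Expr S n} (h : T.Valid (Γ.snoc A)) :
    of (Γ.snoc A) h ⟶ of Γ h.1 :=
  mor h h.1 (Sub.wk S n) (isCtxMor_wk h)

/-- Substitution in a type is pullback. -/
theorem isPullback_snoc {k n : ℕ} {Δ : Ctx S k} {Γ : Ctx S n} {A : Expr S n} {t : Sub S n k}
    (hΔ : T.Valid Δ) (ht : T.IsCtxMor Δ Γ t) (h : T.Valid (Γ.snoc A)) :
    IsPullback (wkMor (valid_snoc_subst hΔ ht h))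
      (mor (valid_snoc_subst hΔ ht h) h (Sub.lift 1 t) (isCtxMor_lift_one hΔ ht h))
      (mor hΔ h.1 t ht) (wkMor h) := by
  refine IsPullback.mk' ?_ (fun X φ ψ h₁ h₂ => ?_) (fun X a b hab => ?_)
  · refine mor_congr (?_ : t.comp (Sub.wk S k) = (Sub.wk S n).comp (Sub.lift 1 t))
    rw [Sub.wk_comp, Sub.lift_one, Sub.init_snoc]
  · induction X using ind with
    | h Θ hΘ =>
    obtain ⟨s, hs, rfl⟩ := exists_mor φ
    obtain ⟨s', hs', rfl⟩ := exists_mor ψ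
    have e₁ : T.CtxMorEq Θ Δ s.init s'.init := mor_eq_iff.1 h₁
    have e₂ : T.CtxMorEq Θ (Γ.snoc A) ((Sub.lift 1 t).comp s) ((Sub.lift 1 t).comp s') :=
      mor_eq_iff.1 h₂
    rw [Sub.lift_one_comp, Sub.lift_one_comp] at e₂
    have e₃ := e₂.2
    rw [Sub.snoc_last, Sub.snoc_last, Sub.init_snoc, ← Expr.subst_subst] at e₃
    exact mor_eq_iff.2 ⟨e₁, e₃⟩
  · induction X using ind with
    | h Θ hΘ =>
    obtain ⟨α, hα, rfl⟩ := exists_mor a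
    obtain ⟨β, hβ, rfl⟩ := exists_mor b
    have e : T.CtxMorEq Θ Γ (t.comp α) β.init := mor_eq_iff.1 hab
    have htα := IsCtxMor.comp hΘ hα ht
    have hl : T.IsCtxMor Θ (Δ.snoc (A.subst t)) (α.snoc (β (Fin.last n))) := by
      refine isCtxMor_snoc hα ?_
      rw [Expr.subst_subst]
      -- The last term of `β` has type `A` substituted along `β.init`, which agrees with `t.comp α`
      -- only up to definitional equality; hence the conversion.
      exact T.hasType_conv hβ.2 (T.type_symm (subst_congr_isType hΘ htα hβ.1 e h.2))
    refine ⟨mor hΘ _ _ hl, mor_congr (Sub.init_snoc α _), mor_eq_iff.2 (?_ :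
      T.CtxMorEq Θ (Γ.snoc A) ((Sub.lift 1 t).comp (α.snoc (β (Fin.last n)))) β)⟩
    · rw [Sub.lift_one_comp, Sub.init_snoc, Sub.snoc_last]
      refine ⟨?_, ?_⟩
      · rwa [Sub.init_snoc]
      · rw [Sub.snoc_last]
        exact T.term_refl hβ.2

/-- The projections that drop one variable. -/
inductive IsExtension : MorphismProperty (ClassifyingCategory T)
  | mk {n : ℕ} {Γ : Ctx S n} {A : Expr S n} (h : T.Valid (Γ.snoc A)) : IsExtension (wkMor h)

variable (T) in
/-- The morphisms that are isomorphic to a projection that drops one variable. -/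
def display : MorphismProperty (ClassifyingCategory T) := (IsExtension (T := T)).isoClosure

instance : (display T).RespectsIso := inferInstanceAs (IsExtension.isoClosure).RespectsIso

theorem display_wkMor {n : ℕ} {Γ : Ctx S n} {A : Expr S n} (h : T.Valid (Γ.snoc A)) :
    display T (wkMor h) :=
  MorphismProperty.le_isoClosure _ _ (IsExtension.mk h)

theorem display.exists_isPullback {X Y : ClassifyingCategory T} {f : X ⟶ Y} (hf : display T f) :
    ∃ (n : ℕ) (Γ : Ctx S n) (A : Expr S n) (h : T.Valid (Γ.snoc A)) (g : Y ⟶ of Γ h.1)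
      (g' : X ⟶ of (Γ.snoc A) h), IsPullback f g' g (wkMor h) := by
  obtain ⟨_, _, _, ⟨h⟩, ⟨i⟩⟩ := hf
  exact ⟨_, _, _, h, i.inv.right, i.inv.left, IsPullback.of_vert_isIso ⟨(Arrow.w i.inv).symm⟩⟩

/-- Display maps with target `[Γ]` are given by types over `Γ`. -/
theorem display.exists_iso {X : ClassifyingCategory T} {n : ℕ} {Γ : Ctx S n} {hΓ : T.Valid Γ}
    {f : X ⟶ of Γ hΓ} (hf : display T f) : ∃ (A : Expr S n) (h : T.Valid (Γ.snoc A))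
      (e : X ≅ of (Γ.snoc A) h), e.hom ≫ wkMor h = f := by
  obtain ⟨_, _, _, h', g, g', hP⟩ := hf.exists_isPullback
  obtain ⟨t, ht, rfl⟩ := exists_mor g
  exact ⟨_, _, hP.isoIsPullback _ _ (isPullback_snoc hΓ ht h'),
    IsPullback.isoIsPullback_hom_fst _ _ _ _⟩

theorem display.exists_pullback {X Y Z : ClassifyingCategory T} (f : X ⟶ Y) (g : Z ⟶ Y)
    (hf : display T f) : ∃ (W : ClassifyingCategory T) (f' : W ⟶ Z) (g' : W ⟶ X),
      IsPullback f' g' g f ∧ display T f' := by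
  induction Y using ind with
  | h Γ hΓ =>
  induction Z using ind with
  | h Δ hΔ =>
  obtain ⟨A, h, e, rfl⟩ := hf.exists_iso
  obtain ⟨t, ht, rfl⟩ := exists_mor g
  refine ⟨_, wkMor (valid_snoc_subst hΔ ht h),
    mor (valid_snoc_subst hΔ ht h) h (Sub.lift 1 t) (isCtxMor_lift_one hΔ ht h) ≫ e.inv, ?_,
    display_wkMor _⟩
  refine IsPullback.of_iso (isPullback_snoc hΔ ht h) (Iso.refl _) (Iso.refl _) e.symm (Iso.refl _) ?_ ?_ ?_ ?_
  all_goals simp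

/-- Substitution in a telescope is pullback. -/
theorem isPullback_append {k n m : ℕ} {Δ : Ctx S k} {Γ : Ctx S n} {t : Sub S n k}
    (hΔ : T.Valid Δ) (hΓ : T.Valid Γ) (ht : T.IsCtxMor Δ Γ t) (Θ : Tel S n m) (h : T.Valid (Γ.append Θ))
    (h' : T.Valid (Δ.append (Θ.subst t)))
    (h'' : T.IsCtxMor (Δ.append (Θ.subst t)) (Γ.append Θ) (Sub.lift m t)) :
    IsPullback (proj Δ (Θ.subst t) h') (mor h' h (Sub.lift m t) h'') (mor hΔ hΓ t ht)
      (proj Γ Θ h) := by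
  induction Θ with
  | nil =>
    rw [mor_congr (Sub.lift_zero t)]
    exact IsPullback.id_horiz _
  | snoc Θ A ih =>
    have h₁ := (isCtxMor_lift hΔ ht Θ h.1).2
    rw [mor_congr (Sub.lift_succ _ t)]
    exact (isPullback_snoc h'.1 h₁ h).paste_horiz (ih h.1 h'.1 h₁)

theorem fib_proj {n m : ℕ} {Γ : Ctx S n} (Δ : Tel S n m) (h : T.Valid (Γ.append Δ)) :
    Fib (display T) (proj Γ Δ h) := by
  induction Δ with
  | nil => exact Fib.of_isIso (𝟙 (of Γ h))
  | snoc Δ A ih => exact (Fib.of_disp (display_wkMor h)).comp (ih h.1)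

theorem FibN.exists_iso_proj {r : ℕ} : ∀ {X : ClassifyingCategory T} {n : ℕ} {Γ : Ctx S n}
    {hΓ : T.Valid Γ} {f : X ⟶ of Γ hΓ}, FibN (display T) r f →
    ∃ (m : ℕ) (Δ : Tel S n m) (h : T.Valid (Γ.append Δ)) (e : X ≅ of (Γ.append Δ) h),
      e.hom ≫ proj Γ Δ h = f := by
  induction r with
  | zero =>
    intro X n Γ hΓ f hf
    have : IsIso f := hf
    exact ⟨0, .nil, hΓ, @asIso _ _ X (of Γ hΓ) f this, Category.comp_id f⟩
  | succ r ih =>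
    intro X n Γ hΓ f hf
    obtain ⟨Z, d, p, hd, hp, rfl⟩ := hf.exists_fac
    obtain ⟨m, Δ, h, e, rfl⟩ := ih hp
    -- Composition with `e.hom` makes the target a context, where a display map is given by a type
    -- that can be appended to the telescope.
    obtain ⟨A, h', e', he'⟩ := (((display T).cancel_right_of_respectsIso d e.hom).2 hd).exists_iso
    exact ⟨m + 1, Δ.snoc A, h', e', by
      change e'.hom ≫ wkMor h' ≫ proj Γ Δ h = _
      rw [reassoc_of% he']⟩

theorem fib_display : Fib (display T) = fibrations T := by
  ext X Y f
  constructor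
  · rintro ⟨r, hf⟩
    induction Y using ind with
    | h Γ hΓ =>
    obtain ⟨m, Δ, h, e, rfl⟩ := FibN.exists_iso_proj hf
    exact ⟨_, _, _, IsDependentProjection.proj Γ Δ h, ⟨Arrow.isoMk e.symm (Iso.refl _) (by simp)⟩⟩
  · rintro ⟨_, _, _, ⟨Γ, Δ, h⟩, ⟨i⟩⟩
    obtain ⟨r, hr⟩ := fib_proj Δ h
    have := FibN.respectsIso (D := display T) r
    exact ⟨r, ((FibN (display T) r).arrow_mk_iso_iff i).1 hr⟩

theorem valid_nil : T.Valid Ctx.nil := trivial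

/-- The empty context is terminal. -/
def isTerminalNil : IsTerminal (of Ctx.nil (valid_nil (T := T))) :=
  IsTerminal.ofUniqueHom
    (fun X => Hom.mk (Y := of Ctx.nil (valid_nil (T := T))) (fun i => i.elim0) (by
      induction X using ind with
      | h Δ hΔ => trivial))
    (fun X f => by
      induction X using ind with
      | h Δ hΔ =>
      obtain ⟨t, ht, rfl⟩ := exists_mor f
      exact mor_eq_iff.2 trivial)

theorem fib_from_nil (X : ClassifyingCategory T) : Fib (display T) (isTerminalNil.from X) := by
  induction X using ind with
  | h Γ hΓ =>
  induction Γ with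
  | nil => exact ⟨0, isIso_of_isTerminal isTerminalNil isTerminalNil _⟩
  | snoc Γ A ih =>
    rw [isTerminalNil.hom_ext (isTerminalNil.from _) (wkMor hΓ ≫ isTerminalNil.from _)]
    exact (Fib.of_disp (display_wkMor hΓ)).comp (ih hΓ.1)

end ClassifyingCategory
end DepTT
namespace DepTT

/-! ### Invariance of weak extension under isomorphism -/

section WeakExtension

variable {C : Type u} [Category.{v} C] {D : MorphismProperty C}

theorem WeakExt.of_iso [D.RespectsIso] {U V U' V' : C} {i : U ⟶ V} {i' : U' ⟶ V'} (H : WeakExt D i)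
    (eU : U' ≅ U) (eV : V' ≅ V) (h : eU.hom ≫ i = i' ≫ eV.hom) : WeakExt D i' := by
  intro E π c hπ hc
  obtain ⟨j, hj, Q, a, b, QQ, q₁, q₂, hQ, hQQ, H⟩ := H (π ≫ eV.hom) (eU.inv ≫ c)
    ((D.cancel_right_of_respectsIso π eV.hom).2 hπ)
    (by rw [Category.assoc, reassoc_of% hc, ← h, Iso.inv_hom_id_assoc])
  refine ⟨eV.hom ≫ j, ?_, Q, a ≫ eU.inv, b, QQ, q₁, q₂, ?_, ?_, fun F φ ρ hφ h₁ h₂ => ?_⟩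
  · rw [← cancel_mono eV.hom]
    simp [hj]
  · refine IsPullback.of_iso hQ (Iso.refl _) eU.symm (Iso.refl _) eV.symm ?_ ?_ ?_ ?_
    · simp
    · simp
    · rw [Iso.symm_hom, Iso.symm_hom, Iso.comp_inv_eq, Category.assoc, ← h, Iso.inv_hom_id_assoc]
    · simp
  · refine IsPullback.of_iso hQQ (Iso.refl _) (Iso.refl _) (Iso.refl _) eU.symm ?_ ?_ ?_ ?_
    all_goals simp
  · obtain ⟨l, hl₁, hl₂, hl₃⟩ := H φ ρ hφ h₁ h₂
    refine ⟨eU.hom ≫ l, ?_, ?_, ?_⟩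
    · simp [reassoc_of% hl₁]
    · simp [hl₂, reassoc_of% h]
    · simp [hl₃]

end WeakExtension

/-! ### Substitution in the context of two points and a path -/

section Substitutions

variable {S : Signature.{u}}

theorem Sub.lift_succ_comp_snoc {n k l : ℕ} (m : ℕ) (t : Sub S n k) (s : Sub S (k + m) l) (a : Expr S l) :
    (Sub.lift (m + 1) t).comp (s.snoc a) = ((Sub.lift m t).comp s).snoc a := by
  rw [Sub.lift_succ]
  refine (Sub.lift_one_comp _ _).trans ?_
  rw [Sub.init_snoc, Sub.snoc_last]

theorem Sub.lift_three_comp {n k l : ℕ} (t : Sub S n k) (s : Sub S k l) (a b c : Expr S l) :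
    (Sub.lift 3 t).comp (((s.snoc a).snoc b).snoc c) = (((t.comp s).snoc a).snoc b).snoc c := by
  refine (Sub.lift_succ_comp_snoc 2 _ _ _).trans (congrArg (Sub.snoc · c) ?_)
  refine (Sub.lift_succ_comp_snoc 1 _ _ _).trans (congrArg (Sub.snoc · b) ?_)
  refine (Sub.lift_succ_comp_snoc 0 _ _ _).trans (congrArg (Sub.snoc · a) ?_)
  rw [Sub.lift_zero]

theorem Sub.wk_snoc_last (n : ℕ) : (Sub.wk S n).snoc (Expr.last S n) = Sub.id S (n + 1) :=
  Sub.snoc_init (Sub.id S (n + 1))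

theorem Expr.wk_subst {n m : ℕ} (e : Expr S n) (σ : Sub S (n + 1) m) : e.wk.subst σ = e.subst σ.init :=
  Expr.subst_subst _ _ _

theorem Expr.last_subst {n m : ℕ} (σ : Sub S (n + 1) m) : (Expr.last S n).subst σ = σ (Fin.last n) := rfl

theorem Expr.wk_subst_lift {n m : ℕ} (e : Expr S n) (σ : Sub S n m) :
    e.wk.subst (Sub.lift 1 σ) = (e.subst σ).wk := by
  rw [Expr.wk_subst, Sub.lift_one, Sub.init_snoc, Expr.wk, Expr.subst_subst]

theorem Expr.last_subst_lift {n m : ℕ} (σ : Sub S n m) :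
    (Expr.last S n).subst (Sub.lift 1 σ) = Expr.last S m := by
  rw [Expr.last_subst, Sub.lift_one, Sub.snoc_last]

namespace IdFormers

variable (F : IdFormers S)

/-- The telescope `[x ∈ A, y ∈ A, u ∈ Id_A(x, y)]`. -/
def idTel {n : ℕ} (A : Expr S n) : Tel S n 3 :=
  ((Tel.nil.snoc A).snoc A.wk).snoc (F.Id A.wk.wk (Expr.last S n).wk (Expr.last S (n + 1)))

theorem idTel_subst {n k : ℕ} (A : Expr S n) (ξ : Sub S n k) :
    (F.idTel A).subst ξ = F.idTel (A.subst ξ) := by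
  have h₁ : A.subst (Sub.lift 0 ξ) = A.subst ξ := by rw [Sub.lift_zero]
  have h₃ : (F.Id A.wk.wk (Expr.last S n).wk (Expr.last S (n + 1))).subst (Sub.lift 2 ξ) =
      F.Id (A.subst ξ).wk.wk (Expr.last S k).wk (Expr.last S (k + 1)) := by
    rw [Sub.lift_succ, F.Id_subst, Expr.wk_subst_lift, Expr.wk_subst_lift, Expr.wk_subst_lift,
      Expr.last_subst_lift, Expr.last_subst_lift]
  change ((Tel.nil.snoc (A.subst (Sub.lift 0 ξ))).snoc (A.wk.subst (Sub.lift 1 ξ))).snoc _ = _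
  rw [h₁, Expr.wk_subst_lift, h₃]
  rfl

theorem diag_comp {n k : ℕ} (A : Expr S n) (ξ : Sub S n k) :
    (F.diag A).comp (Sub.lift 1 ξ) = (Sub.lift 3 ξ).comp (F.diag (A.subst ξ)) := by
  rw [diag, diag, Sub.lift_three_comp, Sub.snoc_comp, Sub.snoc_comp, Sub.snoc_comp, F.r_subst,
    Expr.last_subst_lift, Expr.wk_subst_lift, Sub.wk_comp, Sub.lift_one, Sub.init_snoc]

end IdFormers

end Substitutions

open Judgement TypeTheory

/-! ### The elimination and computation rules along context morphisms -/

namespace PropIdTypes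

variable {S : Signature.{u}} {T : TypeTheory S} (I : PropIdTypes T)

theorem valid_idCtx {n : ℕ} {Γ : Ctx S n} {A : Expr S n} (h : T.Valid (Γ.snoc A)) :
    T.Valid (I.idCtx Γ A) := by
  have h' : T.Valid ((Γ.snoc A).snoc A.wk) := ⟨h, derivable_wk h.2 h.2⟩
  exact ⟨h', I.formation (derivable_wk (T.var_mem h.2) h'.2) (T.var_mem h'.2)⟩

theorem isCtxMor_diag {n : ℕ} {Γ : Ctx S n} {A : Expr S n} (h : T.Valid (Γ.snoc A)) :
    T.IsCtxMor (Γ.snoc A) (I.idCtx Γ A) (I.diag A) := by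
  have hx := T.var_mem h.2
  refine isCtxMor_snoc (isCtxMor_snoc (isCtxMor_snoc (isCtxMor_wk h) hx) ?_) ?_
  · rw [Expr.wk_subst, Sub.init_snoc]
    exact hx
  · rw [I.Id_subst, Expr.wk_subst, Sub.init_snoc, Expr.wk_subst, Sub.init_snoc, Expr.wk_subst,
      Sub.init_snoc, Expr.last_subst, Expr.last_subst, Sub.snoc_last, Sub.snoc_last]
    exact I.introduction hx

theorem isCtxMor_lift_three {k n : ℕ} {Ξ : Ctx S k} {Γ : Ctx S n} {A : Expr S n} {ξ : Sub S n k}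
    (hΞ : T.Valid Ξ) (hξ : T.IsCtxMor Ξ Γ ξ) (h : T.Valid (Γ.snoc A)) :
    T.IsCtxMor (I.idCtx Ξ (A.subst ξ)) (I.idCtx Γ A) (Sub.lift 3 ξ) := by
  have := (isCtxMor_lift hΞ hξ (I.idTel A) (I.valid_idCtx h)).2
  rwa [I.idTel_subst] at this

/-- The result of the elimination rule, for terms `x`, `y` and `u` that are given by `σ`. -/
def elim {k n m : ℕ} (A : Expr S n) (Δ : Tel S (n + 3) m) (C : Expr S (n + 3 + m))
    (d : Expr S (n + 1 + m)) (σ : Sub S (n + 3) k) : Expr S (k + m) :=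
  I.J (A.subst σ.init.init.init) (Δ.subst (Sub.lift 3 σ.init.init.init))
    (C.subst (Sub.lift m (Sub.lift 3 σ.init.init.init)))
    (d.subst (Sub.lift m (Sub.lift 1 σ.init.init.init)))
    (σ.init.init (Fin.last n)) (σ.init (Fin.last (n + 1))) (σ (Fin.last (n + 2)))

theorem elim_subst {k l n m : ℕ} (A : Expr S n) (Δ : Tel S (n + 3) m) (C : Expr S (n + 3 + m))
    (d : Expr S (n + 1 + m)) (σ : Sub S (n + 3) k) (τ : Sub S k l) :
    (I.elim A Δ C d σ).subst (Sub.lift m τ) = I.elim A Δ C d (σ.comp τ) := by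
  simp only [elim, I.J_subst, Expr.subst_subst, Tel.subst_subst, Sub.lift_comp]
  rfl

variable {n m : ℕ} {Γ : Ctx S n} {A : Expr S n} {Δ : Tel S (n + 3) m} {C : Expr S (n + 3 + m)}
  {d : Expr S (n + 1 + m)}

/-- The rules are applied in the ambient context `Ξ`, so the datum `d` has to be moved there;
`diag_comp` lets substitution and reflexivity be interchanged. -/
theorem derivable_base_subst {k : ℕ} {Ξ : Ctx S k} {ξ : Sub S n k} (hΞ : T.Valid Ξ)
    (h : T.Valid (Γ.snoc A)) (hξ : T.IsCtxMor Ξ Γ ξ)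
    (hd : T.Derivable ((Γ.snoc A).append (Δ.subst (I.diag A)))
      (hasType d (C.subst (Sub.lift m (I.diag A))))) :
    T.Derivable ((Ξ.snoc (A.subst ξ)).append ((Δ.subst (Sub.lift 3 ξ)).subst (I.diag (A.subst ξ))))
      (hasType (d.subst (Sub.lift m (Sub.lift 1 ξ)))
        ((C.subst (Sub.lift m (Sub.lift 3 ξ))).subst (Sub.lift m (I.diag (A.subst ξ))))) := by
  have := derivable_subst_tel (valid_snoc_subst hΞ hξ h) (isCtxMor_lift_one hΞ hξ h) _ hd
  simp only [Judgement.subst, Tel.subst_subst, Expr.subst_subst, Sub.lift_comp, I.diag_comp] at this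
  simpa only [Tel.subst_subst, Expr.subst_subst, Sub.lift_comp] using this

theorem hasType_elim {k : ℕ} {Ξ : Ctx S k} {σ : Sub S (n + 3) k} (hΞ : T.Valid Ξ)
    (h : T.Valid (Γ.snoc A)) (hσ : T.IsCtxMor Ξ (I.idCtx Γ A) σ)
    (hC : T.Derivable ((I.idCtx Γ A).append Δ) (isType C))
    (hd : T.Derivable ((Γ.snoc A).append (Δ.subst (I.diag A)))
      (hasType d (C.subst (Sub.lift m (I.diag A))))) :
    T.Derivable (Ξ.append (Δ.subst σ)) (hasType (I.elim A Δ C d σ) (C.subst (Sub.lift m σ))) := by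
  obtain ⟨⟨⟨hξ, hx⟩, hy⟩, hu⟩ := hσ
  rw [Expr.wk_subst] at hy
  rw [I.Id_subst, Expr.wk_subst, Expr.wk_subst, Expr.wk_subst, Expr.last_subst, Expr.last_subst] at hu
  have e : (Sub.lift 3 σ.init.init.init).comp (Sub.inst₃ (σ.init.init (Fin.last n))
      (σ.init (Fin.last (n + 1))) (σ (Fin.last (n + 2)))) = σ := by
    rw [Sub.inst₃, Sub.lift_three_comp, Sub.comp_id, Sub.snoc_init, Sub.snoc_init, Sub.snoc_init]
  have := I.elimination (derivable_subst_tel (valid_idCtx I (valid_snoc_subst hΞ hξ h))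
    (I.isCtxMor_lift_three hΞ hξ h) _ hC) hx hy hu (I.derivable_base_subst hΞ h hξ hd)
  rwa [Tel.subst_subst, Expr.subst_subst, Sub.lift_comp, e] at this

theorem exists_computation (h : T.Valid (Γ.snoc A))
    (hC : T.Derivable ((I.idCtx Γ A).append Δ) (isType C))
    (hd : T.Derivable ((Γ.snoc A).append (Δ.subst (I.diag A)))
      (hasType d (C.subst (Sub.lift m (I.diag A))))) :
    ∃ p, T.Derivable ((Γ.snoc A).append (Δ.subst (I.diag A)))
      (hasType p (I.Id (C.subst (Sub.lift m (I.diag A))) (I.elim A Δ C d (I.diag A)) d)) := by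
  have hw := isCtxMor_wk h
  have e : (Sub.lift 3 (Sub.wk S n)).comp (Sub.inst₃ (Expr.last S n) (Expr.last S n)
      (I.r A.wk (Expr.last S n))) = I.diag A := by
    rw [Sub.inst₃, Sub.lift_three_comp, Sub.comp_id]
    rfl
  -- The rule is used in the context extended by `x ∈ A`, for weakened data and the variable `x`
  -- itself. Undoing the weakening recovers the original `Δ`, `C` and `d`.
  have := I.computation (derivable_subst_tel (valid_idCtx I (valid_snoc_subst h hw h))
    (I.isCtxMor_lift_three h hw h) _ hC) (T.var_mem h.2) (I.derivable_base_subst h h hw hd)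
  simp only [Tel.subst_subst, Expr.subst_subst, Sub.lift_comp, Sub.lift_one_inst, Sub.wk_snoc_last,
    Sub.lift_id, Expr.subst_id] at this
  erw [e] at this
  have e' : I.elim A Δ C d (I.diag A) = I.J A.wk (Δ.subst (Sub.lift 3 (Sub.wk S n)))
      (C.subst (Sub.lift m (Sub.lift 3 (Sub.wk S n)))) (d.subst (Sub.lift m (Sub.lift 1 (Sub.wk S n))))
      (Expr.last S n) (Expr.last S n) (I.r A.wk (Expr.last S n)) := by
    simp only [elim, IdFormers.diag, Sub.init_snoc, Sub.snoc_last]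
    rfl
  rw [e']
  exact ⟨_, this⟩

/-- The elimination and computation rule in the generic case. -/
theorem exists_elim (h : T.Valid (Γ.snoc A)) (hC : T.Derivable ((I.idCtx Γ A).append Δ) (isType C))
    (hd : T.Derivable ((Γ.snoc A).append (Δ.subst (I.diag A)))
      (hasType d (C.subst (Sub.lift m (I.diag A))))) :
    ∃ j p, T.Derivable ((I.idCtx Γ A).append Δ) (hasType j C) ∧
      T.Derivable ((Γ.snoc A).append (Δ.subst (I.diag A)))
        (hasType p (I.Id (C.subst (Sub.lift m (I.diag A))) (j.subst (Sub.lift m (I.diag A))) d)) := by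
  obtain ⟨p, hp⟩ := I.exists_computation h hC hd
  have hj := I.hasType_elim (I.valid_idCtx h) h (isCtxMor_id (I.valid_idCtx h)) hC hd
  rw [Tel.subst_id, Sub.lift_id, Expr.subst_id] at hj
  exact ⟨_, p, hj, by rwa [I.elim_subst, Sub.id_comp]⟩

end PropIdTypes
end DepTT
namespace DepTT
open Judgement TypeTheory

/-! ### Identity types make the classifying category a display class -/

namespace ClassifyingCategory

variable {S : Signature.{u}} {T : TypeTheory S}

theorem mor_snoc_comp_wkMor {k n : ℕ} {Δ : Ctx S k} {Γ : Ctx S n} {A : Expr S n} {t : Sub S n k}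
    {a : Expr S k} (hΔ : T.Valid Δ) (h : T.Valid (Γ.snoc A)) (ht : T.IsCtxMor Δ Γ t)
    (ha : T.Derivable Δ (hasType a (A.subst t))) :
    mor hΔ h (t.snoc a) (isCtxMor_snoc ht ha) ≫ wkMor h = mor hΔ h.1 t ht :=
  mor_congr (Sub.init_snoc t a)

/-- Lifts of a morphism along a projection are given by terms. -/
theorem exists_term {k n : ℕ} {Δ : Ctx S k} {Γ : Ctx S n} {A : Expr S n} {t : Sub S n k}
    {hΔ : T.Valid Δ} {h : T.Valid (Γ.snoc A)} {ht : T.IsCtxMor Δ Γ t} {f : of Δ hΔ ⟶ of (Γ.snoc A) h}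
    (hf : f ≫ wkMor h = mor hΔ h.1 t ht) : ∃ (a : Expr S k) (ha : T.Derivable Δ (hasType a (A.subst t))),
      f = mor hΔ h (t.snoc a) (isCtxMor_snoc ht ha) := by
  obtain ⟨s, hs, rfl⟩ := exists_mor f
  have e : T.CtxMorEq Δ Γ s.init t := mor_eq_iff.1 hf
  have ha := T.hasType_conv hs.2 (subst_congr_isType hΔ hs.1 ht e h.2)
  refine ⟨_, ha, mor_eq_iff.2 ⟨?_, ?_⟩⟩
  · rwa [Sub.init_snoc]
  · rw [Sub.init_snoc, Sub.snoc_last]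
    exact T.term_refl ha

variable (I : PropIdTypes T)

/-- Elimination into a type that depends on `x, y ∈ B` only. -/
theorem exists_term_of_id {n : ℕ} {Γ : Ctx S n} {B a b p : Expr S n} {G : Expr S (n + 2)}
    {g : Expr S (n + 1)} (h : T.Valid (Γ.snoc B))
    (hG : T.Derivable ((Γ.snoc B).snoc B.wk) (isType G)) (ha : T.Derivable Γ (hasType a B))
    (hb : T.Derivable Γ (hasType b B)) (hp : T.Derivable Γ (hasType p (I.Id B a b)))
    (hg : T.Derivable (Γ.snoc B) (hasType g (G.subst ((Sub.id S (n + 1)).snoc (Expr.last S n))))) :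
    ∃ q, T.Derivable Γ (hasType q (G.subst (((Sub.id S n).snoc a).snoc b))) := by
  have e : G.wk.subst (I.diag B) = G.subst ((Sub.id S (n + 1)).snoc (Expr.last S n)) := by
    rw [Expr.wk_subst, IdFormers.diag, Sub.init_snoc, Sub.wk_snoc_last]
  have e' : G.wk.subst (Sub.inst₃ a b p) = G.subst (((Sub.id S n).snoc a).snoc b) := by
    rw [Expr.wk_subst, Sub.inst₃, Sub.init_snoc]
  have := I.elimination (Δ := .nil) (C := G.wk) (d := g) (derivable_wk hG (I.valid_idCtx h).2) ha hb hp
    (by rw [Sub.lift_zero, e]; exact hg)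
  rw [Sub.lift_zero, e'] at this
  exact ⟨_, this⟩

/-- The term built with `J` is the extended section, and the term built with `H` identifies its
restriction with `d`. Eliminating the latter into an arbitrary reflexive type `G` over pairs gives
the Leibniz clause of `WeakExt`. -/
theorem weakExt_lift_diag {n m : ℕ} {Γ : Ctx S n} {A : Expr S n} (Δ : Tel S (n + 3) m)
    (h : T.Valid (Γ.snoc A)) (hV : T.Valid ((I.idCtx Γ A).append Δ))
    (hU : T.Valid ((Γ.snoc A).append (Δ.subst (I.diag A))))
    (hi : T.IsCtxMor ((Γ.snoc A).append (Δ.subst (I.diag A))) ((I.idCtx Γ A).append Δ)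
      (Sub.lift m (I.diag A))) :
    WeakExt (display T) (mor hU hV (Sub.lift m (I.diag A)) hi) := by
  intro E π c hπ hc
  obtain ⟨C, hVC, e, rfl⟩ := hπ.exists_iso
  obtain ⟨d, hd, hcd⟩ := exists_term (f := c ≫ e.hom) ((Category.assoc _ _ _).trans hc)
  obtain ⟨j, p, hj, hp⟩ := I.exists_elim h hVC.2 hd
  -- From here on only a context morphism `i : U ⟶ V` matters; `Q` is `U` extended by the
  -- substituted type, and `QQ` is `U` extended by it twice.
  generalize (Γ.snoc A).append (Δ.subst (I.diag A)) = U at *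
  generalize (I.idCtx Γ A).append Δ = V at *
  generalize Sub.lift m (I.diag A) = i at *
  have hUB := valid_snoc_subst hU hi hVC
  have hUBB := valid_snoc_subst hUB (isCtxMor_wk hUB) hUB
  have hQ := isPullback_snoc hU hi hVC
  have hQQ := isPullback_snoc hUB (isCtxMor_wk hUB) hUB
  have hji := derivable_subst hU hi hj
  have hid := isCtxMor_id hU
  have hid' {a : Expr S _} (ha : T.Derivable U (hasType a (C.subst i))) :
      T.Derivable U (hasType a ((C.subst i).subst (Sub.id S _))) := by rwa [Expr.subst_id]
  have hj' : T.Derivable V (hasType j (C.subst (Sub.id S _))) := by rwa [Expr.subst_id]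
  have hb {a : Expr S _} (ha : T.Derivable U (hasType a (C.subst i))) :
      mor hU hUB ((Sub.id S _).snoc a) (isCtxMor_snoc hid (hid' ha)) ≫
        mor hUB hVC (Sub.lift 1 i) (isCtxMor_lift_one hU hi hVC) =
      mor hU hVC (i.snoc a) (isCtxMor_snoc hi ha) := mor_congr (Sub.lift_one_inst i a)
  refine ⟨mor hV hVC ((Sub.id S _).snoc j) (isCtxMor_snoc (isCtxMor_id hV) hj') ≫ e.inv, ?_, _,
    wkMor hUB, mor hUB hVC (Sub.lift 1 i) (isCtxMor_lift_one hU hi hVC) ≫ e.inv, _, _, _, ?_, hQQ,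
    fun F φ ρ hφ h₁ h₂ => ?_⟩
  · rw [Category.assoc, Iso.inv_hom_id_assoc]
    exact mor_snoc_comp_wkMor hV hVC (isCtxMor_id hV) hj'
  · refine IsPullback.of_iso hQ (Iso.refl _) (Iso.refl _) e.symm (Iso.refl _) ?_ ?_ ?_ ?_
    all_goals simp
  · obtain ⟨G, hG, e', rfl⟩ := hφ.exists_iso
    have hx : T.Derivable (U.snoc (C.subst i)) (hasType (Expr.last S _)
        ((C.subst i).wk.subst (Sub.id S _))) := by
      rw [Expr.subst_id]
      exact T.var_mem hUB.2
    have hδ := isCtxMor_snoc (isCtxMor_id hUB) hx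
    rw [Category.assoc, ← Category.assoc] at h₁ h₂
    -- The two equations place `ρ` over the diagonal, so it amounts to a term of `G` at the pair of
    -- variables `(x, x)`.
    have hρ : (ρ ≫ e'.hom) ≫ wkMor hG = mor hUB hUBB _ hδ := by
      refine hQQ.hom_ext ?_ ?_
      · exact ((Category.assoc _ _ _).trans h₁).trans
          (mor_snoc_comp_wkMor hUB hUBB (isCtxMor_id hUB) hx).symm
      · exact ((Category.assoc _ _ _).trans h₂).trans
          (mor_congr ((Sub.lift_one_inst _ _).trans (Sub.wk_snoc_last _))).symm
    obtain ⟨g, hg, -⟩ := exists_term hρ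
    obtain ⟨q, hq⟩ := exists_term_of_id I hUB hG.2 hji hd hp hg
    have hd' : T.Derivable U (hasType d ((C.subst i).wk.subst ((Sub.id S _).snoc (j.subst i)))) := by
      rwa [Expr.wk_subst, Sub.init_snoc, Expr.subst_id]
    have hjd := isCtxMor_snoc (isCtxMor_snoc hid (hid' hji)) hd'
    have hl := mor_snoc_comp_wkMor hU hG hjd hq
    have hl₁ := mor_snoc_comp_wkMor hU hUBB (isCtxMor_snoc hid (hid' hji)) hd'
    have hl₂ : mor hU hUBB _ hjd ≫ mor hUBB hUB (Sub.lift 1 (Sub.wk S _))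
        (isCtxMor_lift_one hUB (isCtxMor_wk hUB) hUB) =
        mor hU hUB ((Sub.id S _).snoc d) (isCtxMor_snoc hid (hid' hd)) :=
      mor_congr ((Sub.lift_succ_comp_snoc 0 _ _ _).trans (congrArg (Sub.snoc · d) (by
        rw [Sub.lift_zero]
        exact Sub.init_snoc _ _)))
    refine ⟨mor hU hG _ (isCtxMor_snoc hjd hq) ≫ e'.inv, ?_, ?_, ?_⟩
    · simp only [Category.assoc, Iso.inv_hom_id_assoc]
      rw [reassoc_of% hl, reassoc_of% hl₁]
      exact mor_snoc_comp_wkMor hU hUB hid (hid' hji)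
    · simp only [Category.assoc, Iso.inv_hom_id_assoc]
      rw [reassoc_of% hl, reassoc_of% hl₁, reassoc_of% (hb hji), ← Category.assoc]
      congr 1
      exact mor_congr (Sub.snoc_comp (Sub.id S _) j i).symm
    · simp only [Category.assoc, Iso.inv_hom_id_assoc]
      rw [reassoc_of% hl, reassoc_of% hl₂, reassoc_of% (hb hd), ← hcd, Category.assoc,
        Iso.hom_inv_id, Category.comp_id]

/-- The projection `[Γ, x ∈ A, y ∈ A, u ∈ Id_A(x, y)] ⟶ [Γ]`. -/
def idProj {n : ℕ} {Γ : Ctx S n} {A : Expr S n} (h : T.Valid (Γ.snoc A)) :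
    of (I.idCtx Γ A) (I.valid_idCtx h) ⟶ of Γ h.1 :=
  wkMor (I.valid_idCtx h) ≫ wkMor (valid_snoc_subst h (isCtxMor_wk h) h) ≫ wkMor h

theorem isPullback_idCtx {k n : ℕ} {Ξ : Ctx S k} {Γ : Ctx S n} {A : Expr S n} {ξ : Sub S n k}
    (hΞ : T.Valid Ξ) (hξ : T.IsCtxMor Ξ Γ ξ) (h : T.Valid (Γ.snoc A)) :
    IsPullback (idProj I (valid_snoc_subst hΞ hξ h))
      (mor (I.valid_idCtx (valid_snoc_subst hΞ hξ h)) (I.valid_idCtx h) (Sub.lift 3 ξ)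
        (I.isCtxMor_lift_three hΞ hξ h)) (mor hΞ h.1 ξ hξ)
      (idProj I h) := by
  -- The substituted telescope equals the telescope of the substituted type only by a proved
  -- equation, so it is replaced by a variable `Θ` to avoid casts.
  have key (Θ : Tel S k 3) (e : (I.idTel A).subst ξ = Θ) (h₁ : T.Valid (Ξ.append Θ))
      (h₂ : T.IsCtxMor (Ξ.append Θ) (I.idCtx Γ A) (Sub.lift 3 ξ)) :
      IsPullback (proj Ξ Θ h₁) (mor h₁ (I.valid_idCtx h) (Sub.lift 3 ξ) h₂) (mor hΞ h.1 ξ hξ)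
        (proj Γ (I.idTel A) (I.valid_idCtx h)) := by
    subst e
    exact isPullback_append hΞ h.1 hξ (I.idTel A) (I.valid_idCtx h) h₁ h₂
  exact key _ (I.idTel_subst A ξ) _ _

theorem diag_comp_proj {n : ℕ} {Γ : Ctx S n} {A : Expr S n} (h : T.Valid (Γ.snoc A)) :
    mor h (I.valid_idCtx h) (I.diag A) (I.isCtxMor_diag h) ≫ idProj I h = wkMor h := by
  refine mor_congr (?_ : (I.diag A).init.init.init = Sub.wk S n)
  rw [IdFormers.diag, Sub.init_snoc, Sub.init_snoc, Sub.init_snoc]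

/-- Composed with the projections of the identity contexts, the square becomes the pullback square
of `A` alone; pasting cancellation does the rest. -/
theorem isPullback_diag {k n : ℕ} {Ξ : Ctx S k} {Γ : Ctx S n} {A : Expr S n} {ξ : Sub S n k}
    (hΞ : T.Valid Ξ) (hξ : T.IsCtxMor Ξ Γ ξ) (h : T.Valid (Γ.snoc A)) :
    IsPullback (mor (valid_snoc_subst hΞ hξ h) h (Sub.lift 1 ξ) (isCtxMor_lift_one hΞ hξ h))
      (mor (valid_snoc_subst hΞ hξ h) (I.valid_idCtx (valid_snoc_subst hΞ hξ h)) (I.diag (A.subst ξ))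
        (I.isCtxMor_diag (valid_snoc_subst hΞ hξ h)))
      (mor h (I.valid_idCtx h) (I.diag A) (I.isCtxMor_diag h))
      (mor (I.valid_idCtx (valid_snoc_subst hΞ hξ h)) (I.valid_idCtx h) (Sub.lift 3 ξ)
        (I.isCtxMor_lift_three hΞ hξ h)) := by
  refine (IsPullback.of_right ?_ ?_ (isPullback_idCtx I hΞ hξ h)).flip
  · rw [diag_comp_proj, diag_comp_proj]
    exact isPullback_snoc hΞ hξ h
  · exact mor_congr (I.diag_comp A ξ).symm

/-- The identity type of a type over `Γ`. -/
def idObj {n : ℕ} {Γ : Ctx S n} {A : Expr S n} (h : T.Valid (Γ.snoc A)) :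
    IdObj (display T) (wkMor h) where
  AA := of ((Γ.snoc A).snoc A.wk) (valid_snoc_subst h (isCtxMor_wk h) h)
  I := of (I.idCtx Γ A) (I.valid_idCtx h)
  pr₁ := wkMor (valid_snoc_subst h (isCtxMor_wk h) h)
  pr₂ := mor (valid_snoc_subst h (isCtxMor_wk h) h) h (Sub.lift 1 (Sub.wk S n))
    (isCtxMor_lift_one h (isCtxMor_wk h) h)
  st := wkMor (I.valid_idCtx h)
  r := mor h (I.valid_idCtx h) (I.diag A) (I.isCtxMor_diag h)
  isPullback := isPullback_snoc h (isCtxMor_wk h) h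
  disp := display_wkMor _
  r_fst := by
    refine mor_congr (?_ : (I.diag A).init.init = Sub.id S (n + 1))
    rw [IdFormers.diag, Sub.init_snoc, Sub.init_snoc, Sub.wk_snoc_last]
  r_snd := by
    refine mor_congr (?_ : ((Sub.lift 1 (Sub.wk S n)).comp (Sub.wk S (n + 2))).comp (I.diag A) =
      Sub.id S (n + 1))
    rw [Sub.comp_assoc, Sub.wk_comp, IdFormers.diag, Sub.init_snoc, Sub.lift_one_comp, Sub.init_snoc,
      Sub.snoc_last, Sub.wk_comp, Sub.init_snoc, Sub.wk_snoc_last]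
  weakExt := by
    intro X K E U x k₁ k₂ δ w i hK hδ hU
    induction X using ind with
    | h Ξ hΞ =>
    obtain ⟨ξ, hξ, rfl⟩ := exists_mor x
    have h' := valid_snoc_subst hΞ hξ h
    let eK := hK.isoIsPullback _ _ (isPullback_idCtx I hΞ hξ h)
    have heK : eK.hom ≫ mor (I.valid_idCtx h') (I.valid_idCtx h) (Sub.lift 3 ξ)
        (I.isCtxMor_lift_three hΞ hξ h) = k₂ := IsPullback.isoIsPullback_hom_snd _ _ _ _
    -- Replace `K` by the identity context over `Ξ` and `δ` by the projection of a telescope over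
    -- it. Then `i` becomes, up to isomorphism, the lifted diagonal.
    obtain ⟨_, hδ'⟩ := hδ.comp (Fib.of_isIso eK.hom)
    obtain ⟨m, Δ, hV, eE, heE⟩ := FibN.exists_iso_proj hδ'
    obtain ⟨hU₀, hi⟩ := isCtxMor_lift h' (I.isCtxMor_diag h') Δ hV
    have hP := (isPullback_append h' (I.valid_idCtx h') (I.isCtxMor_diag h') Δ hV hU₀ hi).paste_horiz
      (isPullback_diag I hΞ hξ h)
    have hU' : IsPullback w (i ≫ eE.hom) (mor h (I.valid_idCtx h) (I.diag A) (I.isCtxMor_diag h))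
        (proj _ Δ hV ≫ mor (I.valid_idCtx h') (I.valid_idCtx h) (Sub.lift 3 ξ)
          (I.isCtxMor_lift_three hΞ hξ h)) := by
      refine IsPullback.of_iso hU (Iso.refl _) (Iso.refl _) eE (Iso.refl _) ?_ ?_ ?_ ?_
      · simp
      · simp
      · simp
      · rw [reassoc_of% heE, heK, Iso.refl_hom, Category.comp_id]
    exact (weakExt_lift_diag I Δ h' hV hU₀ hi).of_iso (hU'.isoIsPullback _ _ hP) eE
      (IsPullback.isoIsPullback_hom_snd _ _ _ _)

/-- Every display map is a base change of a one-variable projection and inherits an identity object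
from it. -/
theorem isDisplayClass (I : PropIdTypes T) : IsDisplayClass (display T) where
  respectsIso := inferInstance
  exists_pullback := display.exists_pullback
  exists_idObj d hd := by
    obtain ⟨_, _, _, h, _, _, hP⟩ := hd.exists_isPullback
    obtain ⟨N, -⟩ := IdObj.exists_baseChange display.exists_pullback (idObj I h) hP hd
    exact ⟨N⟩

end ClassifyingCategory
end DepTT

theorem mainTheorem1 {S : DepTT.Signature.{u}} (T : DepTT.TypeTheory S) (I : DepTT.PropIdTypes T) :
    ∃ W : CategoryTheory.MorphismProperty (DepTT.ClassifyingCategory T),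
      DepTT.IsPathCategory (DepTT.ClassifyingCategory.fibrations T) W := by
  have := DepTT.ClassifyingCategory.isDisplayClass I
  rw [← DepTT.ClassifyingCategory.fib_display]
  exact ⟨_, DepTT.isPathCategory_of_displayClass DepTT.ClassifyingCategory.fib_from_nil⟩
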